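/- All graphs are finite and simple, and "path" means induced path. For a graph $G$ and $X\subseteq V(G)$, let $N(X)$ be the set of vertices outside $X$ with a neighbour in $X$, let $N[X]=X\cup N(X)$, and write $N(v)=N(\{v\})$, $N[v]=N[\{v\}]$. The interior $P^*$ of a path $P$ is $P$ without its ends. Two disjoint sets are anticomplete if there are no edges between them; paths and subgraphs are identified with their vertex sets. A hole is an induced cycle of length at least $4$. A theta consists of three internally disjoint paths, each of length at least $2$, with the same two ends, whose interiors are pairwise anticomplete. A prism consists of two disjoint triangles $a_1a_2a_3$, $b_1b_2b_3$ and paths $P_i$ from $a_i$ to $b_i$ ($i=1,2,3$) such that $P_i\cup P_j$ is a hole for all $i\neq j$. A wheel $(H,x)$ is a hole $H$ with a vertex $x$ having at least three neighbours in $H$; it is even if $x$ has an even number of neighbours in $H$, and proper if $\alpha(N(x)\cap H)\ge 3$, where $\alpha$ is the independence number. A pyramid consists of a vertex $a$ (the apex), a triangle $b_1b_2b_3$ (the base) and paths $P_i$ from $a$ to $b_i$ ($i=1,2,3$) such that $P_i\cup P_j$ is a hole for all $i\ne j$. A loaded pyramid with corner $b_2$ is a pair $\Pi=(\Sigma,P)$,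 where $\Sigma$ is a pyramid as above with $a$ adjacent to $b_2$, and $P=p_1\text{-}\cdots\text{-}p_k$ ($k\ge1$) is a path such that $p_1$ is adjacent to $b_2$; $p_k$ has a neighbour in $P_1^*$; $P_3$ is anticomplete to $P$; $b_2$ is anticomplete to $P\setminus\{p_1\}$; and $P_1\setminus\{b_1\}$ is anticomplete to $P\setminus\{p_k\}$. We also write $\Pi$ for its vertex set $\Sigma\cup P$. Theorem. Let $G$ be a $C_4$-free odd-signable graph, that is, a graph with no induced $C_4$, theta, prism or even wheel. (i) If $(H,v)$ is a proper wheel in $G$, then there is no connected component $D$ of $G\setminus N[v]$ with $H\subseteq N[D]$. (ii) If $\Pi$ is a loaded pyramid in $G$ with corner $b_2$, then there is no connected component $D$ of $G\setminus N[b_2]$ with $\Pi\setminus\{b_2\}\subseteq N[D]$. -/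

import Mathlib

universe u

section

open SimpleGraph

variable {V : Type u}

/-- The closed neighbourhood `N[X]`: the vertices of `X` and all vertices with a neighbour
in `X`. -/
def closedNbhd (G : SimpleGraph V) (X : Set V) : Set V :=
  X ∪ {w | ∃ x ∈ X, G.Adj x w}

/-- `D` is the vertex set of a connected component of the graph `G ∖ X`. -/
def IsComponentOfDelete (G : SimpleGraph V) (X D : Set V) : Prop :=
  ∃ C : (G.induce Xᶜ).ConnectedComponent, D = Subtype.val '' C.supp

/-- `X` and `Y` are disjoint and there are no edges between them. -/
def Anticomplete (G : SimpleGraph V) (X Y : Set V) : Prop :=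
  Disjoint X Y ∧ ∀ x ∈ X, ∀ y ∈ Y, ¬ G.Adj x y

/-- The walk `p` is a path which is an induced subgraph of `G`. -/
def IsInducedPath {G : SimpleGraph V} {a b : V} (p : G.Walk a b) : Prop :=
  p.IsPath ∧ p.IsChordless

/-- The vertex set of a walk. -/
def walkVerts {G : SimpleGraph V} {a b : V} (p : G.Walk a b) : Set V :=
  {x | x ∈ p.support}

/-- The interior of a walk: its vertices other than its two ends. -/
def walkInterior {G : SimpleGraph V} {a b : V} (p : G.Walk a b) : Set V :=
  walkVerts p \ {a, b}

/-- `H` is (the vertex set of) a hole: an induced cycle of length at least four. -/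
def IsHole (G : SimpleGraph V) (H : Set V) : Prop :=
  ∃ (v : V) (c : G.Walk v v), c.IsCycle ∧ c.IsChordless ∧ 4 ≤ c.length ∧ walkVerts c = H

/-- `G` contains a theta (as an induced subgraph): two vertices `a`, `b` and three paths of
length at least two between them whose interiors are pairwise disjoint and anticomplete. -/
def HasTheta (G : SimpleGraph V) : Prop :=
  ∃ (a b : V) (P : Fin 3 → G.Walk a b),
    (∀ i, IsInducedPath (P i)) ∧
    (∀ i, 2 ≤ (P i).length) ∧
    (∀ i j, i ≠ j → Anticomplete G (walkInterior (P i)) (walkInterior (P j)))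

/-- `G` contains a prism (as an induced subgraph): two disjoint triangles `a 0, a 1, a 2` and
`b 0, b 1, b 2`, and three paths `P i` from `a i` to `b i`, any two of which form a hole. -/
def HasPrism (G : SimpleGraph V) : Prop :=
  ∃ (a b : Fin 3 → V) (P : ∀ i, G.Walk (a i) (b i)),
    (∀ i j, i ≠ j → G.Adj (a i) (a j)) ∧
    (∀ i j, i ≠ j → G.Adj (b i) (b j)) ∧
    (∀ i j, a i ≠ b j) ∧
    (∀ i, IsInducedPath (P i)) ∧
    (∀ i j, i ≠ j → IsHole G (walkVerts (P i) ∪ walkVerts (P j)))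

/-- `(H, x)` is a wheel: `H` is a hole and `x` has at least three neighbours in `H`
(so that `x` is not itself a vertex of `H`). -/
def IsWheel (G : SimpleGraph V) (H : Set V) (x : V) : Prop :=
  IsHole G H ∧ 3 ≤ (G.neighborSet x ∩ H).ncard

/-- `G` contains an even wheel. -/
def HasEvenWheel (G : SimpleGraph V) : Prop :=
  ∃ (H : Set V) (x : V), IsWheel G H x ∧ Even (G.neighborSet x ∩ H).ncard

/-- `(H, x)` is a proper wheel: the independence number of `N(x) ∩ H` is at least three. -/
def IsProperWheel (G : SimpleGraph V) (H : Set V) (x : V) : Prop :=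
  IsWheel G H x ∧ 3 ≤ (G.induce (G.neighborSet x ∩ H)).indepNum

/-- The class of (`C₄`, theta, prism, even wheel)-free graphs, that is, of the
`C₄`-free odd-signable graphs. -/
def IsC4FreeOddSignable (G : SimpleGraph V) : Prop :=
  ¬ (cycleGraph 4) ⊴ G ∧ ¬ HasTheta G ∧ ¬ HasPrism G ∧ ¬ HasEvenWheel G

/-- A pyramid in `G`, with apex `a`, base the triangle `b₁ b₂ b₃` and paths `Pᵢ` from `a`
to `bᵢ`, any two of which form a hole. -/
structure Pyramid (G : SimpleGraph V) where
  a : V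
  b₁ : V
  b₂ : V
  b₃ : V
  P₁ : G.Walk a b₁
  P₂ : G.Walk a b₂
  P₃ : G.Walk a b₃
  adj₁₂ : G.Adj b₁ b₂
  adj₁₃ : G.Adj b₁ b₃
  adj₂₃ : G.Adj b₂ b₃
  path₁ : IsInducedPath P₁
  path₂ : IsInducedPath P₂
  path₃ : IsInducedPath P₃
  hole₁₂ : IsHole G (walkVerts P₁ ∪ walkVerts P₂)
  hole₁₃ : IsHole G (walkVerts P₁ ∪ walkVerts P₃)
  hole₂₃ : IsHole G (walkVerts P₂ ∪ walkVerts P₃)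

/-- The vertex set of a pyramid. -/
def Pyramid.verts {G : SimpleGraph V} (S : Pyramid G) : Set V :=
  walkVerts S.P₁ ∪ walkVerts S.P₂ ∪ walkVerts S.P₃

/-- A loaded pyramid in `G`: a pyramid whose apex `a` is adjacent to `b₂`, together with a
path `P` from `p` (the first vertex) to `q` (the last vertex, possibly equal to `p`).
Its corner is `b₂`. -/
structure LoadedPyramid (G : SimpleGraph V) extends Pyramid G where
  p : V
  q : V
  P : G.Walk p q
  path : IsInducedPath P
  apex_adj : G.Adj a b₂
  first_adj : G.Adj p b₂
  last_adj : ∃ y ∈ walkInterior P₁, G.Adj q y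
  anti₃ : Anticomplete G (walkVerts P₃) (walkVerts P)
  anti₂ : Anticomplete G {b₂} (walkVerts P \ {p})
  anti₁ : Anticomplete G (walkVerts P₁ \ {b₁}) (walkVerts P \ {q})

/-- The vertex set of a loaded pyramid. -/
def LoadedPyramid.verts {G : SimpleGraph V} (L : LoadedPyramid G) : Set V :=
  L.toPyramid.verts ∪ walkVerts L.P

end

/-! ### Induced paths as vertex sets, and connection inside a set. -/

section

open SimpleGraph

variable {V : Type*} {G : SimpleGraph V}

/-! Fix the hub `v` (the centre of the wheel, or the corner `b₂`) and call its neighbours spokes.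
Everything rests on one parity fact, `IsHole.odd`: a vertex outside a hole with two nonadjacent
neighbours on it has an odd number of neighbours there, since otherwise there is an even wheel or a
theta. By `square_free`, a non-neighbour of `v` sees only pairwise adjacent spokes. Every
contradiction is then a theta, a prism, a violation of `IsHole.odd`, or an appeal to
`no_four_spokes`, which packages the most frequent combination of these.

For (i), suppose that a component `D` of the complement of `N[v]` dominates the hole. If some rim
vertex is not a spoke, cutting the rim at the outermost spokes seen from it gives a `HubRing`: a
path `b` between two spokes, carrying an odd number of spokes in all, and a path `Q` without spokes.
Call an inner vertex of `b` a target if it is no spoke or a spoke of even rank along `b`. Since `D`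
is connected, contains `Q` and dominates `b`, it contains a path `p` from a neighbour of `Q` to a
neighbour of a target, cut so that only its first vertex sees `Q` and only its last vertex sees
targets (`Conf`). The other vertices of `p` see only spokes of odd rank, and any two of these bound
a segment of `b` with an odd number of spokes. Parity and thetas show that all inner attachments of
`p` are at one spoke (`Conf.unique_attach`, `Conf.attach_eq`). `Att.contra` examines the last vertex
of `p` against the segment around its target, and shows that this segment has no spoke at distance
two or more from both its ends. What survives is the configuration `Short`, which is refuted case by
case.

If all rim vertices are spokes, a shortest path in `D` joining two nonadjacent rim vertices closes a
ring with each of the two arcs of the rim. The ring result makes the arcs so short that the rim has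
at most six vertices. But the rim is odd and has three pairwise nonadjacent vertices, hence at least
seven.

For (ii), the pyramid and its load provide a `Core`: the path `A` from the apex `a` to `b₃`, and a
set `K` through which the neighbour `a'` of `a` on `P₁` is joined to both `b₁` and `p`. A path in
`D` from the interior of `A` towards `a'` first comes close to `a'`, `p` or `K` at a vertex `c`
(`Bridge`). Wherever `c` attaches, `no_four_spokes`, `no_fork` or a theta applies. If `P` attaches
to the interior of `P₁` at `a'` only, `no_fork` refutes the loaded pyramid without using `D`. -/

/-- `Anti G S T`: the sets `S` and `T` are disjoint with no edges between them. -/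
def Anti (G : SimpleGraph V) (S T : Set V) : Prop :=
  ∀ x ∈ S, ∀ y ∈ T, x ≠ y ∧ ¬ G.Adj x y

theorem Anti.symm {S T : Set V} (h : Anti G S T) : Anti G T S :=
  fun x hx y hy => ⟨(h y hy x hx).1.symm, fun e => (h y hy x hx).2 e.symm⟩

theorem Anti.mono {S T S' T' : Set V} (h : Anti G S T) (hS : S' ⊆ S) (hT : T' ⊆ T) :
    Anti G S' T' :=
  fun x hx y hy => h x (hS hx) y (hT hy)

/-- `IPath G S a b`: the set `S` induces a path of `G` with ends `a` and `b`. -/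
inductive IPath (G : SimpleGraph V) : Set V → V → V → Prop
  | refl (a : V) : IPath G {a} a a
  | cons {S : Set V} {a b c : V} (hab : G.Adj a b) (h : IPath G S b c) (ha : a ∉ S)
      (hS : ∀ x ∈ S, G.Adj a x → x = b) : IPath G (insert a S) a c

namespace IPath

variable {S T : Set V} {a b c d : V}

theorem left_mem (h : IPath G S a b) : a ∈ S := by
  cases h <;> simp

theorem right_mem (h : IPath G S a b) : b ∈ S := by
  induction h with
  | refl a => simp
  | cons _ _ _ _ ih => exact Set.mem_insert_of_mem _ ih

theorem append (h : IPath G S a b) (h' : IPath G T c d) (hbc : G.Adj b c)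
    (hx : ∀ x ∈ S, ∀ y ∈ T, x ≠ y ∧ (G.Adj x y → x = b ∧ y = c)) : IPath G (S ∪ T) a d := by
  induction h with
  | refl a =>
    rw [Set.singleton_union]
    exact .cons hbc h' (fun ha => (hx a rfl a ha).1 rfl) fun x hxT e => ((hx a rfl x hxT).2 e).2
  | @cons S a e b hab h ha hS ih =>
    rw [Set.insert_union]
    refine .cons hab (ih hbc fun x hxS y hy => hx x (.inr hxS) y hy) ?_ ?_
    · rintro (h1 | h1)
      · exact ha h1
      · exact (hx a (.inl rfl) a h1).1 rfl
    · rintro x (h1 | h1) e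
      · exact hS x h1 e
      · exact absurd (((hx a (.inl rfl) x h1).2 e).1 ▸ h.right_mem) ha

theorem symm (h : IPath G S a b) : IPath G S b a := by
  induction h with
  | refl a => exact .refl a
  | @cons S a e b hab h ha hS ih =>
    rw [← Set.union_singleton]
    refine ih.append (.refl a) hab.symm ?_
    rintro x hx y rfl
    exact ⟨fun e => ha (e ▸ hx), fun e => ⟨hS x hx e.symm, rfl⟩⟩

/-- The path `S` from `a` to `b` is divided at its vertex `x` into `S₁` and `S₂`. -/
structure Split (G : SimpleGraph V) (S : Set V) (a x b : V) (S₁ S₂ : Set V) : Prop where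
  left : IPath G S₁ a x
  right : IPath G S₂ x b
  union : S₁ ∪ S₂ = S
  cross : ∀ y ∈ S₁, ∀ z ∈ S₂, y ≠ x → z ≠ x → y ≠ z ∧ ¬ G.Adj y z

namespace Split

variable {S₁ S₂ : Set V} {x y : V}

theorem subset_left (h : Split G S a x b S₁ S₂) : S₁ ⊆ S := h.union ▸ Set.subset_union_left

theorem subset_right (h : Split G S a x b S₁ S₂) : S₂ ⊆ S := h.union ▸ Set.subset_union_right

theorem eq_of_mem (h : Split G S a x b S₁ S₂) (h1 : y ∈ S₁) (h2 : y ∈ S₂) : y = x := by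
  by_contra hne
  exact (h.cross y h1 y h2 hne hne).1 rfl

theorem anti (h : Split G S a x b S₁ S₂) : Anti G (S₁ \ {x}) (S₂ \ {x}) :=
  fun y hy z hz => h.cross y hy.1 z hz.1 hy.2 hz.2

theorem symm (h : Split G S a x b S₁ S₂) : Split G S b x a S₂ S₁ :=
  ⟨h.right.symm, h.left.symm, by rw [Set.union_comm, h.union], fun y hy z hz h1 h2 =>
    ⟨(h.cross z hz y hy h2 h1).1.symm, fun e => (h.cross z hz y hy h2 h1).2 e.symm⟩⟩

theorem mem (h : Split G S a x b S₁ S₂) : x ∈ S := h.subset_left h.left.right_mem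

end Split

/-- Division of a path at its last vertex with a given property. -/
theorem exists_last (h : IPath G S a b) {p : V → Prop} (hp : ∃ x ∈ S, p x) :
    ∃ x S₁ S₂, Split G S a x b S₁ S₂ ∧ p x ∧ ∀ y ∈ S₂, p y → y = x := by
  induction h with
  | refl a =>
    obtain ⟨x, rfl, hx⟩ := hp
    exact ⟨x, {x}, {x}, ⟨.refl x, .refl x, by simp, by simp⟩, hx, by simp⟩
  | @cons S a e b hab h ha hS ih =>
    by_cases hq : ∃ x ∈ S, p x
    · obtain ⟨x, S₁, S₂, hs, hx, hl⟩ := ih hq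
      refine ⟨x, insert a S₁, S₂, ⟨.cons hab hs.left (fun h1 => ha (hs.subset_left h1))
        fun y hy => hS y (hs.subset_left hy), hs.right, by rw [Set.insert_union, hs.union], ?_⟩,
        hx, hl⟩
      rintro y (rfl | hy) z hz h1 h2
      · refine ⟨fun e => ha (hs.subset_right (e ▸ hz)), fun e => h2 ?_⟩
        have := hS z (hs.subset_right hz) e
        subst this
        exact hs.eq_of_mem hs.left.left_mem hz
      · exact hs.cross y hy z hz h1 h2
    · obtain ⟨x, rfl | hxS, hx⟩ := hp
      · refine ⟨x, {x}, insert x S, ⟨.refl x, .cons hab h ha hS, by simp, by simp⟩, hx, ?_⟩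
        rintro y (rfl | hy) hpy
        · rfl
        · exact absurd ⟨y, hy, hpy⟩ hq
      · exact absurd ⟨x, hxS, hx⟩ hq

/-- Division of a path at its first vertex with a given property. -/
theorem exists_first (h : IPath G S a b) {p : V → Prop} (hp : ∃ x ∈ S, p x) :
    ∃ x S₁ S₂, Split G S a x b S₁ S₂ ∧ p x ∧ ∀ y ∈ S₁, p y → y = x := by
  obtain ⟨x, S₁, S₂, hs, hx, hl⟩ := h.symm.exists_last hp
  exact ⟨x, S₂, S₁, hs.symm, hx, hl⟩

theorem split (h : IPath G S a b) {x : V} (hx : x ∈ S) : ∃ S₁ S₂, Split G S a x b S₁ S₂ := by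
  obtain ⟨_, S₁, S₂, hs, rfl, -⟩ := h.exists_first (p := (· = x)) ⟨x, hx, rfl⟩
  exact ⟨S₁, S₂, hs⟩

/-- Removing the first vertex of a path. -/
theorem tail (h : IPath G S a b) (hab : a ≠ b) :
    ∃ a', G.Adj a a' ∧ IPath G (S \ {a}) a' b ∧ ∀ x ∈ S, G.Adj a x → x = a' := by
  cases h with
  | refl a => exact absurd rfl hab
  | @cons S a e b hae h ha hS =>
    refine ⟨e, hae, ?_, ?_⟩
    · rwa [Set.insert_sdiff_self_of_notMem ha]
    · rintro x (rfl | hx) h1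
      · exact absurd h1 (G.loopless.irrefl _)
      · exact hS x hx h1

theorem eq_singleton (h : IPath G S a a) : S = {a} := by
  cases h with
  | refl a => rfl
  | cons hae h ha hS => exact absurd h.right_mem ha

theorem eq_pair (h : IPath G S a b) (hab : G.Adj a b) : S = {a, b} := by
  cases h with
  | refl a => exact absurd hab (G.loopless.irrefl _)
  | @cons S a e b hae h ha hS =>
    obtain rfl := hS b h.right_mem hab
    rw [h.eq_singleton]

theorem edge (hab : G.Adj a b) : IPath G {a, b} a b :=
  .cons hab (.refl b) (by simpa using hab.ne) (by simp)

/-- Prepending a vertex. -/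
theorem cons' (h : IPath G S b c) (hab : G.Adj a b) (hS : ∀ x ∈ S, x ≠ a ∧ (G.Adj a x → x = b)) :
    IPath G (insert a S) a c :=
  .cons hab h (fun ha => (hS a ha).1 rfl) fun x hx => (hS x hx).2

/-- Gluing two paths at a common end. -/
theorem glue (h : IPath G S a b) (h' : IPath G T b c) (hx : Anti G (S \ {b}) (T \ {b})) :
    IPath G (S ∪ T) a c := by
  by_cases hbc : b = c
  · subst hbc
    rw [h'.eq_singleton, Set.union_eq_left.2 (by simpa using h.right_mem)]
    exact h
  · obtain ⟨b', hb', ht, hu⟩ := h'.tail hbc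
    have : S ∪ T = S ∪ T \ {b} := by
      ext x
      by_cases hx : x = b
      · subst hx; simp [h.right_mem]
      · simp [hx]
    rw [this]
    refine h.append ht hb' ?_
    intro x hxS y hy
    by_cases hxb : x = b
    · subst hxb
      exact ⟨fun e => hy.2 e.symm, fun e => ⟨rfl, hu y hy.1 e⟩⟩
    · exact ⟨(hx x ⟨hxS, hxb⟩ y hy).1, fun e => absurd e (hx x ⟨hxS, hxb⟩ y hy).2⟩

end IPath

/-- `Reach G X a b`: some induced path from `a` to `b` lies in `X`. -/
def Reach (G : SimpleGraph V) (X : Set V) (a b : V) : Prop :=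
  ∃ S ⊆ X, IPath G S a b

namespace Reach

variable {X Y : Set V} {a b c : V}

theorem refl (ha : a ∈ X) : Reach G X a a := ⟨{a}, by simpa using ha, .refl a⟩

theorem symm (h : Reach G X a b) : Reach G X b a := by
  obtain ⟨S, h1, h2⟩ := h
  exact ⟨S, h1, h2.symm⟩

theorem mono (h : Reach G X a b) (hXY : X ⊆ Y) : Reach G Y a b := by
  obtain ⟨S, h1, h2⟩ := h
  exact ⟨S, h1.trans hXY, h2⟩

theorem left_mem (h : Reach G X a b) : a ∈ X := by
  obtain ⟨S, h1, h2⟩ := h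
  exact h1 h2.left_mem

theorem right_mem (h : Reach G X a b) : b ∈ X := by
  obtain ⟨S, h1, h2⟩ := h
  exact h1 h2.right_mem

/-- Walks are shortened to induced paths here: if `a` lies on the path, what follows it is kept;
otherwise the new path leaves `a` for the last neighbour of `a` on the old one. This makes `Reach`
transitive although induced paths do not concatenate. -/
theorem cons (h : Reach G X b c) (ha : a ∈ X) (hab : G.Adj a b) : Reach G X a c := by
  obtain ⟨S, hSX, h⟩ := h
  by_cases haS : a ∈ S
  · obtain ⟨S₁, S₂, hs⟩ := h.split haS
    exact ⟨S₂, hs.subset_right.trans hSX, hs.right⟩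
  · obtain ⟨x, S₁, S₂, hs, hx, hl⟩ := h.exists_last (p := fun x => G.Adj a x) ⟨b, h.left_mem, hab⟩
    exact ⟨insert a S₂, Set.insert_subset ha (hs.subset_right.trans hSX),
      .cons hx hs.right (fun h1 => haS (hs.subset_right h1)) hl⟩

theorem trans (h : Reach G X a b) (h' : Reach G X b c) : Reach G X a c := by
  obtain ⟨S, hSX, h⟩ := h
  induction h with
  | refl a => exact h'
  | cons hab h ha hS ih =>
    exact (ih h' fun x hx => hSX (.inr hx)).cons (hSX (.inl rfl)) hab

theorem snoc (h : Reach G X a b) (hc : c ∈ X) (hbc : G.Adj b c) : Reach G X a c :=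
  (h.symm.cons hc hbc.symm).symm

theorem edge (ha : a ∈ X) (hb : b ∈ X) (hab : G.Adj a b) : Reach G X a b :=
  (refl hb).cons ha hab

end Reach

namespace IPath

variable {S X : Set V} {a b c : V}

theorem reach' (h : IPath G S a b) (hSX : S ⊆ X) : Reach G X a b := ⟨S, hSX, h⟩

theorem reach_mem (h : IPath G S a b) {x y : V} (hx : x ∈ S) (hy : y ∈ S) : Reach G S x y := by
  obtain ⟨S₁, S₂, hs⟩ := h.split hx
  obtain ⟨T₁, T₂, ht⟩ := h.split hy
  exact (hs.left.reach' hs.subset_left).symm.trans (ht.left.reach' ht.subset_left)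

/-- An induced path set gives an induced path in the sense of walks. -/
theorem exists_walk (h : IPath G S a b) :
    ∃ p : G.Walk a b, IsInducedPath p ∧ walkVerts p = S := by
  induction h with
  | refl a =>
    refine ⟨.nil, ⟨by simp, ?_⟩, by ext; simp [walkVerts]⟩
    rw [Walk.isChordless_iff_forall_mem_edges]
    intro u w hu hw e
    simp at hu hw
    subst hu hw
    exact absurd e (G.loopless.irrefl _)
  | @cons S a e b hab h ha hS ih =>
    obtain ⟨p, ⟨hp, hc⟩, hv⟩ := ih
    have hm : ∀ x, x ∈ p.support ↔ x ∈ S := fun x => by rw [← hv]; rfl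
    refine ⟨.cons hab p, ⟨?_, ?_⟩, ?_⟩
    · rw [Walk.cons_isPath_iff]
      exact ⟨hp, by rwa [hm]⟩
    · rw [Walk.isChordless_iff_forall_mem_edges] at hc ⊢
      intro u w hu hw huw
      simp only [Walk.support_cons, List.mem_cons, Walk.edges_cons] at hu hw ⊢
      rcases hu with rfl | hu <;> rcases hw with rfl | hw
      · exact absurd huw (G.loopless.irrefl _)
      · left; rw [hS w ((hm w).1 hw) huw]
      · left; rw [hS u ((hm u).1 hu) huw.symm, Sym2.eq_swap]
      · exact .inr (hc hu hw huw)
    · ext x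
      simp [walkVerts, hm]

end IPath

/-- Together with `exists_walk` this confines walks to the translation of the definitions; the
combinatorial arguments use vertex sets. -/
theorem IsInducedPath.iPath {a b : V} {p : G.Walk a b} (h : IsInducedPath p) :
    IPath G (walkVerts p) a b := by
  obtain ⟨hp, hc⟩ := h
  induction p with
  | nil =>
    convert IPath.refl _
    ext; simp [walkVerts]
  | @cons a e b hab p ih =>
    rw [Walk.cons_isPath_iff] at hp
    have hv : walkVerts (Walk.cons hab p) = insert a (walkVerts p) := by
      ext; simp [walkVerts]
    rw [hv]
    rw [Walk.isChordless_iff_forall_mem_edges] at hc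
    refine .cons hab (ih hp.1 ?_) hp.2 ?_
    · rw [Walk.isChordless_iff_forall_mem_edges]
      intro u w hu hw huw
      have := hc (by simp [hu]) (by simp [hw]) huw
      simp only [Walk.edges_cons, List.mem_cons] at this
      rcases this with h1 | h1
      · exfalso
        rw [Sym2.eq_iff] at h1
        rcases h1 with ⟨rfl, rfl⟩ | ⟨rfl, rfl⟩
        · exact hp.2 hu
        · exact hp.2 hw
      · exact h1
    · intro x hx hax
      have hx' : x ∈ p.support := hx
      have := hc (by simp) (by simp [hx']) hax
      simp only [Walk.edges_cons, List.mem_cons] at this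
      rcases this with h1 | h1
      · rw [Sym2.eq_iff] at h1
        rcases h1 with ⟨_, rfl⟩ | ⟨_, rfl⟩
        · rfl
        · exact absurd hx' hp.2
      · exact absurd (p.fst_mem_support_of_mem_edges h1) hp.2

end

/-! ### Holes built from and opened into path sets. -/

section

open SimpleGraph

variable {V : Type*} {G : SimpleGraph V}

/-- A path and a vertex adjacent exactly to its two nonadjacent ends form a hole. -/
theorem IPath.isHole {S : Set V} {a b w : V} (h : IPath G S a b) (hw : w ∉ S)
    (hwa : G.Adj w a) (hwb : G.Adj w b) (hS : ∀ x ∈ S, G.Adj w x → x = a ∨ x = b)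
    (hne : a ≠ b) (hab : ¬ G.Adj a b) : IsHole G (insert w S) := by
  obtain ⟨p, ⟨hp, hc⟩, rfl⟩ := h.exists_walk
  have hw' : w ∉ p.support := hw
  have hlen : 2 ≤ p.length := by
    by_contra hlt
    rcases p with _ | ⟨h1, _ | ⟨h2, p⟩⟩
    · exact hne rfl
    · exact hab h1
    · simp at hlt
  refine ⟨w, .cons hwa (p.concat hwb.symm), ?_, ?_, ?_, ?_⟩
  · rw [Walk.cons_isCycle_iff]
    refine ⟨hp.concat hw' _, ?_⟩
    simp only [Walk.edges_concat, List.concat_eq_append, List.mem_append, List.mem_singleton]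
    rintro (h1 | h1)
    · exact hw' (p.fst_mem_support_of_mem_edges h1)
    · rw [Sym2.eq_iff] at h1
      rcases h1 with ⟨rfl, _⟩ | ⟨_, h1⟩
      · exact hw' p.end_mem_support
      · exact hne h1
  · rw [Walk.isChordless_iff_forall_mem_edges] at hc ⊢
    intro u x hu hx hux
    simp only [Walk.support_cons, List.mem_cons, Walk.edges_cons, Walk.support_concat,
      Walk.edges_concat, List.concat_eq_append, List.mem_append, List.not_mem_nil, or_false] at hu hx ⊢
    have key : ∀ x ∈ p.support, G.Adj w x → s(w, x) = s(w, a) ∨ s(w, x) ∈ p.edges ∨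
        s(w, x) = s(b, w) := by
      intro x hx e
      rcases hS x hx e with rfl | rfl
      · exact .inl rfl
      · exact .inr (.inr Sym2.eq_swap)
    have hu' : u = w ∨ u ∈ p.support := by tauto
    have hx' : x = w ∨ x ∈ p.support := by tauto
    rcases hu' with rfl | hu' <;> rcases hx' with rfl | hx'
    · exact absurd hux (G.loopless.irrefl _)
    · exact key x hx' hux
    · rw [Sym2.eq_swap]; exact key u hu' hux.symm
    · exact .inr (.inl (hc hu' hx' hux))
  · simp; omega
  · ext x
    have := p.start_mem_support
    simp [walkVerts, Walk.support_concat]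
    tauto

/-- Removing a vertex of a hole leaves a path. -/
theorem IsHole.open_at {H : Set V} (hH : IsHole G H) {w : V} (hw : w ∈ H) :
    ∃ a b, a ≠ b ∧ ¬ G.Adj a b ∧ G.Adj w a ∧ G.Adj w b ∧ IPath G (H \ {w}) a b ∧
      ∀ x ∈ H, G.Adj w x → x = a ∨ x = b := by
  classical
  obtain ⟨v, c, hcy, hch, hlen, rfl⟩ := hH
  -- The closed walk is rotated to start at `w`, so that its first and last edges give the two
  -- neighbours of `w`.
  obtain ⟨c, hcy, hch, hlen, hv⟩ : ∃ c' : G.Walk w w, c'.IsCycle ∧ c'.IsChordless ∧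
      4 ≤ c'.length ∧ walkVerts c = walkVerts c' := by
    have hw' : w ∈ c.support := hw
    have hsup : ∀ x, x ∈ (c.rotate w hw').support ↔ x ∈ c.support := by
      intro x
      simp
    refine ⟨c.rotate w hw', hcy.rotate hw', ?_, by rwa [Walk.length_rotate], ?_⟩
    · rw [Walk.isChordless_iff_forall_mem_edges] at hch ⊢
      intro a b ha hb hab
      rw [(c.rotate_edges w hw').perm.mem_iff]
      exact hch ((hsup a).1 ha) ((hsup b).1 hb) hab
    · ext x; exact (hsup x).symm
  rw [hv]
  rw [Walk.isChordless_iff_forall_mem_edges] at hch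
  rcases c with _ | ⟨hwa, p⟩
  · simp at hlen
  rename_i a
  rw [Walk.cons_isCycle_iff] at hcy
  obtain ⟨hp, hwap⟩ := hcy
  -- Reversal exposes the last edge of the walk to a case split.
  obtain ⟨q, rfl⟩ : ∃ q, p = Walk.reverse q := ⟨p.reverse, by simp⟩
  rcases q with _ | ⟨hwb, q⟩
  · simp at hlen
  rename_i b
  rw [Walk.isPath_reverse_iff, Walk.cons_isPath_iff] at hp
  have hne : a ≠ b := by
    rintro rfl
    rw [Walk.edges_reverse, List.mem_reverse, Walk.edges_cons] at hwap
    simp at hwap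
  have hedge : ∀ x y, x ∈ q.support → y ∈ q.support → G.Adj x y → s(x, y) ∈ q.edges := by
    intro x y hx hy hxy
    have := hch (by simp [hx]) (by simp [hy]) hxy
    simp only [Walk.edges_cons, List.mem_cons, Walk.edges_reverse, List.mem_reverse,
      Sym2.eq_iff] at this
    rcases this with (⟨rfl, _⟩ | ⟨_, rfl⟩) | (⟨rfl, _⟩ | ⟨_, rfl⟩) | h
    · exact absurd hx hp.2
    · exact absurd hy hp.2
    · exact absurd hx hp.2
    · exact absurd hy hp.2
    · exact h
  refine ⟨a, b, hne, ?_, hwa, hwb, ?_, ?_⟩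
  · intro hab
    have h1 := hedge b a (by simp) (by simp) hab.symm
    rcases q with _ | ⟨h2, q⟩
    · exact hne rfl
    · rw [Walk.cons_isPath_iff] at hp
      rw [Walk.edges_cons, List.mem_cons] at h1
      rcases h1 with h1 | h1
      · rw [Sym2.eq_iff] at h1
        rcases h1 with ⟨_, rfl⟩ | ⟨rfl, _⟩
        · have := hp.1.1
          rw [Walk.isPath_iff_nil, ← Walk.length_eq_zero_iff] at this
          rw [Walk.length_cons, Walk.length_reverse, Walk.length_cons, Walk.length_cons, this] at hlen
          simp at hlen
        · exact G.loopless.irrefl _ h2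
      · exact hp.1.2 (q.fst_mem_support_of_mem_edges h1)
  · have : walkVerts (Walk.cons hwa (Walk.cons hwb q).reverse) \ {w} = walkVerts q := by
      ext x
      by_cases hx : x = w
      · subst hx; simp [walkVerts, hp.2]
      · have := q.start_mem_support
        simp [walkVerts, hx]
        rintro rfl; assumption
    rw [this]
    refine (IsInducedPath.iPath ⟨hp.1, ?_⟩).symm
    rw [Walk.isChordless_iff_forall_mem_edges]
    exact fun x y hx hy => hedge x y hx hy
  · intro x hx hwx
    have := hch (by simp) hx hwx
    simp only [Walk.edges_cons, List.mem_cons, Walk.edges_reverse, List.mem_reverse,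
      Sym2.eq_iff] at this
    rcases this with (⟨_, rfl⟩ | ⟨rfl, rfl⟩) | (⟨_, rfl⟩ | ⟨rfl, rfl⟩) | h
    · exact .inl rfl
    · exact absurd hwx (G.loopless.irrefl _)
    · exact .inr rfl
    · exact absurd hwx (G.loopless.irrefl _)
    · exact absurd (q.fst_mem_support_of_mem_edges h) hp.2

/-- Two disjoint paths joined by edges between their corresponding ends form a hole. -/
theorem IPath.isHole_union {S T : Set V} {a b c d : V} (hS : IPath G S a b) (hT : IPath G T c d)
    (hac : G.Adj a c) (hbd : G.Adj b d) (hab : a ≠ b) (hcd : c ≠ d)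
    (hx : ∀ x ∈ S, ∀ y ∈ T, x ≠ y ∧ (G.Adj x y → x = a ∧ y = c ∨ x = b ∧ y = d)) :
    IsHole G (S ∪ T) := by
  obtain ⟨c', hc', ht, hu⟩ := hT.tail hcd
  -- The vertex `c` closes the hole: on `S` followed by the reverse of `T \ {c}`, its neighbours are
  -- the two ends `a` and `c'`.
  have hTc : S ∪ T = insert c (S ∪ T \ {c}) := by
    ext x
    by_cases h : x = c
    · subst h; simp [hT.left_mem]
    · simp [h]
  have hac' : ¬ G.Adj a c' := by
    intro e
    rcases (hx a hS.left_mem c' ht.left_mem.1).2 e with ⟨_, h⟩ | ⟨h, _⟩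
    · exact ht.left_mem.2 h
    · exact hab h
  rw [hTc]
  refine (hS.append ht.symm hbd ?_).isHole ?_ hac.symm hc' ?_
    (hx a hS.left_mem c' ht.left_mem.1).1 hac'
  · intro x hxS y hy
    refine ⟨(hx x hxS y hy.1).1, fun e => ?_⟩
    rcases (hx x hxS y hy.1).2 e with ⟨_, h⟩ | h
    · exact absurd h hy.2
    · exact h
  · rintro (h | h)
    · exact (hx c h c hT.left_mem).1 rfl
    · exact h.2 rfl
  · rintro x (h | h) e
    · rcases (hx x h c hT.left_mem).2 e.symm with h | h
      · exact .inl h.1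
      · exact absurd h.2 hcd
    · exact .inr (hu x h.1 e)

/-! ### What the excluded subgraphs forbid. -/

section free

variable (hG : IsC4FreeOddSignable G)

include hG

/-- No theta, for paths given as sets that connect the two ends. -/
theorem theta_free {a b : V} {X Y Z : Set V} (hne : a ≠ b) (hab : ¬ G.Adj a b)
    (hX : Reach G X a b) (hY : Reach G Y a b) (hZ : Reach G Z a b)
    (hXY : Anti G (X \ {a, b}) (Y \ {a, b})) (hXZ : Anti G (X \ {a, b}) (Z \ {a, b}))
    (hYZ : Anti G (Y \ {a, b}) (Z \ {a, b})) : False := by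
  have key : ∀ X, Reach G X a b → ∃ p : G.Walk a b, IsInducedPath p ∧ 2 ≤ p.length ∧
      walkVerts p ⊆ X := by
    rintro X ⟨S, hSX, hS⟩
    obtain ⟨p, hp, rfl⟩ := hS.exists_walk
    refine ⟨p, hp, ?_, hSX⟩
    by_contra hlt
    rcases p with _ | ⟨h1, _ | ⟨h2, p⟩⟩
    · exact hne rfl
    · exact hab h1
    · simp at hlt
  obtain ⟨p, hp, hlp, hpX⟩ := key X hX
  obtain ⟨q, hq, hlq, hqY⟩ := key Y hY
  obtain ⟨r, hr, hlr, hrZ⟩ := key Z hZ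
  have conv : ∀ S T : Set V, Anti G S T → Anticomplete G S T := fun S T h =>
    ⟨Set.disjoint_left.2 fun x hx hx' => (h x hx x hx').1 rfl, fun x hx y hy => (h x hx y hy).2⟩
  have hpX := Set.sdiff_subset_sdiff_left (t := {a, b}) hpX
  have hqY := Set.sdiff_subset_sdiff_left (t := {a, b}) hqY
  have hrZ := Set.sdiff_subset_sdiff_left (t := {a, b}) hrZ
  refine hG.2.1 ⟨a, b, ![p, q, r], ?_, ?_, ?_⟩
  · intro i; fin_cases i <;> simpa
  · intro i; fin_cases i <;> simpa
  · intro i j hij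
    fin_cases i <;> fin_cases j <;> simp at hij ⊢ <;> apply conv
    · exact hXY.mono hpX hqY
    · exact hXZ.mono hpX hrZ
    · exact (hXY.mono hpX hqY).symm
    · exact hYZ.mono hqY hrZ
    · exact (hXZ.mono hpX hrZ).symm
    · exact (hYZ.mono hqY hrZ).symm

/-- No theta, for paths given by sets containing their interiors. -/
theorem theta_free' {a b : V} {X Y Z : Set V} (hne : a ≠ b) (hab : ¬ G.Adj a b)
    (hX : Reach G (insert a (insert b X)) a b) (hY : Reach G (insert a (insert b Y)) a b)
    (hZ : Reach G (insert a (insert b Z)) a b)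
    (hXY : Anti G X Y) (hXZ : Anti G X Z) (hYZ : Anti G Y Z) : False := by
  have key : ∀ X : Set V, insert a (insert b X) \ {a, b} ⊆ X := by
    rintro X u ⟨rfl | rfl | h, h'⟩
    · simp at h'
    · simp at h'
    · exact h
  exact theta_free hG hne hab hX hY hZ (hXY.mono (key X) (key Y)) (hXZ.mono (key X) (key Z))
    (hYZ.mono (key Y) (key Z))

/-- No prism, for paths given as sets that connect their ends. -/
theorem prism_free {a₁ a₂ a₃ b₁ b₂ b₃ : V} {X Y Z : Set V}
    (ha₁₂ : G.Adj a₁ a₂) (ha₁₃ : G.Adj a₁ a₃) (ha₂₃ : G.Adj a₂ a₃)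
    (hb₁₂ : G.Adj b₁ b₂) (hb₁₃ : G.Adj b₁ b₃) (hb₂₃ : G.Adj b₂ b₃)
    (h₁ : a₁ ≠ b₁) (h₂ : a₂ ≠ b₂) (h₃ : a₃ ≠ b₃)
    (hX : Reach G X a₁ b₁) (hY : Reach G Y a₂ b₂) (hZ : Reach G Z a₃ b₃)
    (hXY : ∀ x ∈ X, ∀ y ∈ Y, x ≠ y ∧ (G.Adj x y → x = a₁ ∧ y = a₂ ∨ x = b₁ ∧ y = b₂))
    (hXZ : ∀ x ∈ X, ∀ y ∈ Z, x ≠ y ∧ (G.Adj x y → x = a₁ ∧ y = a₃ ∨ x = b₁ ∧ y = b₃))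
    (hYZ : ∀ x ∈ Y, ∀ y ∈ Z, x ≠ y ∧ (G.Adj x y → x = a₂ ∧ y = a₃ ∨ x = b₂ ∧ y = b₃)) :
    False := by
  have na₁₂ : a₁ ≠ b₂ := (hXY _ hX.left_mem _ hY.right_mem).1
  have na₁₃ : a₁ ≠ b₃ := (hXZ _ hX.left_mem _ hZ.right_mem).1
  have na₂₃ : a₂ ≠ b₃ := (hYZ _ hY.left_mem _ hZ.right_mem).1
  have na₂₁ : a₂ ≠ b₁ := (hXY _ hX.right_mem _ hY.left_mem).1.symm
  have na₃₁ : a₃ ≠ b₁ := (hXZ _ hX.right_mem _ hZ.left_mem).1.symm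
  have na₃₂ : a₃ ≠ b₂ := (hYZ _ hY.right_mem _ hZ.left_mem).1.symm
  obtain ⟨S, hSX, hS⟩ := hX
  obtain ⟨T, hTY, hT⟩ := hY
  obtain ⟨U, hUZ, hU⟩ := hZ
  have h12 := hS.isHole_union hT ha₁₂ hb₁₂ h₁ h₂ fun x hx y hy => hXY x (hSX hx) y (hTY hy)
  have h13 := hS.isHole_union hU ha₁₃ hb₁₃ h₁ h₃ fun x hx y hy => hXZ x (hSX hx) y (hUZ hy)
  have h23 := hT.isHole_union hU ha₂₃ hb₂₃ h₂ h₃ fun x hx y hy => hYZ x (hTY hx) y (hUZ hy)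
  obtain ⟨p, hp, rfl⟩ := hS.exists_walk
  obtain ⟨q, hq, rfl⟩ := hT.exists_walk
  obtain ⟨r, hr, rfl⟩ := hU.exists_walk
  refine hG.2.2.1 ⟨![a₁, a₂, a₃], ![b₁, b₂, b₃],
    Fin.cons p (Fin.cons q (Fin.cons r fun i => i.elim0)), ?_, ?_, ?_, ?_, ?_⟩
  · intro i j hij
    fin_cases i <;> fin_cases j <;> simp at hij ⊢ <;> first | assumption | (symm; assumption)
  · intro i j hij
    fin_cases i <;> fin_cases j <;> simp at hij ⊢ <;> first | assumption | (symm; assumption)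
  · intro i j
    fin_cases i <;> fin_cases j <;> simp <;> assumption
  · intro i; fin_cases i
    · exact hp
    · exact hq
    · exact hr
  · intro i j hij
    fin_cases i <;> fin_cases j <;> simp at hij
    · exact h12
    · exact h13
    · exact Set.union_comm (walkVerts p) _ ▸ h12
    · exact h23
    · exact Set.union_comm (walkVerts p) _ ▸ h13
    · exact Set.union_comm (walkVerts q) _ ▸ h23

/-- Used in two ways: two spokes with a common neighbour other than `v` and outside `N(v)` are
adjacent; and a common neighbour of two nonadjacent spokes, other than `v`, is adjacent to `v`. -/
theorem square_free {a b c d : V} (hab : G.Adj a b) (hbc : G.Adj b c) (hcd : G.Adj c d)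
    (hda : G.Adj d a) (hac : a ≠ c) (hac' : ¬ G.Adj a c) (hbd : b ≠ d) : G.Adj b d := by
  by_contra hbd'
  apply hG.1
  refine ⟨⟨⟨![a, b, c, d], ?_⟩, ?_⟩⟩
  · intro i j
    have := hab.ne; have := hbc.ne; have := hcd.ne; have := hda.ne
    have := hab.ne'; have := hbc.ne'; have := hcd.ne'; have := hda.ne'
    have := hac.symm; have := hbd.symm
    fin_cases i <;> fin_cases j <;> simp <;> assumption
  · intro i j
    have h1 := hab.symm; have h2 := hbc.symm; have h3 := hcd.symm; have h4 := hda.symm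
    have h5 : ¬ G.Adj c a := fun e => hac' e.symm
    have h6 : ¬ G.Adj d b := fun e => hbd' e.symm
    have hc : (cycleGraph 4).Adj i j ↔ i + 1 = j ∨ j + 1 = i := by
      clear * -; revert i j; decide
    change G.Adj (![a, b, c, d] i) (![a, b, c, d] j) ↔ _
    rw [hc]
    fin_cases i <;> fin_cases j <;> simp [hab, hbc, hcd, hda, h1, h2, h3, h4, h5, h6, hac', hbd']

/-- A vertex with two nonadjacent neighbours on a hole has oddly many neighbours there. -/
theorem IsHole.odd [Finite V] {C : Set V} (hC : IsHole G C) {z x y : V} (hz : z ∉ C)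
    (hx : x ∈ C) (hy : y ∈ C) (hzx : G.Adj z x) (hzy : G.Adj z y) (hne : x ≠ y)
    (hxy : ¬ G.Adj x y) : Odd (G.neighborSet z ∩ C).ncard := by
  by_contra hev
  rw [Nat.not_odd_iff_even] at hev
  have hsub : ({x, y} : Set V) ⊆ G.neighborSet z ∩ C := by
    rintro u (rfl | rfl)
    · exact ⟨hzx, hx⟩
    · exact ⟨hzy, hy⟩
  have h2 := Set.ncard_le_ncard hsub (Set.toFinite _)
  rw [Set.ncard_pair hne] at h2
  -- An even number above two is an even wheel. If `x` and `y` are the only neighbours, they divide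
  -- the hole into two arcs that form a theta with the path `x`, `z`, `y`.
  rcases h2.lt_or_eq with h3 | h3
  · exact hG.2.2.2 ⟨C, z, ⟨hC, h3⟩, hev⟩
  · have heq := Set.eq_of_subset_of_ncard_le hsub (by rw [Set.ncard_pair hne, h3])
      (Set.toFinite _)
    have hu : ∀ u ∈ C, G.Adj z u → u = x ∨ u = y := by
      intro u hu e
      have : u ∈ ({x, y} : Set V) := heq ▸ ⟨e, hu⟩
      simpa using this
    obtain ⟨a, b, -, -, hxa, hxb, hp, hu'⟩ := hC.open_at hx
    obtain ⟨S₁, S₂, hs⟩ := hp.split (x := y) ⟨hy, hne.symm⟩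
    have hsub₁ : S₁ ⊆ C \ {x} := hs.subset_left
    have hsub₂ : S₂ ⊆ C \ {x} := hs.subset_right
    refine theta_free hG (X := insert x S₁) (Y := insert x S₂) (Z := {x, z, y}) hne hxy
      ((hs.left.reach' (by simp)).cons (by simp) hxa)
      ((hs.right.symm.reach' (by simp)).cons (by simp) hxb)
      (((Reach.refl (by simp)).cons (by simp) hzy).cons (by simp) hzx.symm) ?_ ?_ ?_
    · refine hs.anti.mono ?_ ?_ <;>
      · rintro u ⟨rfl | h, h'⟩
        · simp at h'
        · exact ⟨h, fun e => h' (.inr e)⟩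
    all_goals
      rintro u ⟨rfl | h, h'⟩ w ⟨rfl | rfl | rfl, hw⟩ <;> simp at h' hw
      have hu2 : u ∈ C := by first | exact (hsub₁ h).1 | exact (hsub₂ h).1
      refine ⟨fun e => hz (e ▸ hu2), fun e => ?_⟩
      rcases hu u hu2 e.symm with rfl | rfl <;> simp at h'

end free

end

/-! ### Four spokes that reach a common non-neighbour of the hub. -/

section

open SimpleGraph

variable {V : Type*} {G : SimpleGraph V}

/-- The first and last vertex of a path with a given property. -/
theorem IPath.exists_first_last {L : Set V} {a b : V} (h : IPath G L a b) {p : V → Prop}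
    (hp : ∃ x ∈ L, p x) :
    ∃ e f A M B, IPath G A a e ∧ IPath G M e f ∧ IPath G B f b ∧ A ∪ M ∪ B = L ∧ p e ∧ p f ∧
      (∀ y ∈ A, p y → y = e) ∧ (∀ y ∈ B, p y → y = f) ∧ Anti G (A \ {e}) ((M ∪ B) \ {e}) ∧
      Anti G ((A ∪ M) \ {f}) (B \ {f}) := by
  obtain ⟨e, A, C, hs, he, hA⟩ := h.exists_first hp
  obtain ⟨f, M, B, ht, hf, hB⟩ := hs.right.exists_last ⟨e, hs.right.left_mem, he⟩
  refine ⟨e, f, A, M, B, hs.left, ht.left, ht.right, ?_, he, hf, hA, hB, ?_, ?_⟩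
  · rw [Set.union_assoc, ht.union, hs.union]
  · rw [ht.union]
    exact hs.anti
  · rintro x ⟨hx | hx, hxf⟩ y ⟨hy, hyf⟩
    · have hy' : y ∈ C := ht.subset_right hy
      by_cases hxe : x = e
      · subst hxe
        exact ht.cross x ht.left.left_mem y hy hxf hyf
      · refine hs.cross x hx y hy' hxe ?_
        rintro rfl
        exact hyf (ht.eq_of_mem ht.left.left_mem hy)
    · exact ht.cross x hx y hy hxf hyf

/-- Two paths with a common first vertex and adjacent last vertices form a hole. -/
theorem IPath.isHole_glue {S T : Set V} {c x s : V} (hS : IPath G S c x) (hT : IPath G T c s)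
    (hxs : G.Adj x s) (hcx : ¬ G.Adj c x) (hne : c ≠ x) (hne' : c ≠ s)
    (hx : ∀ y ∈ S, ∀ t ∈ T, y ≠ c → t ≠ c → y ≠ t ∧ (G.Adj y t → y = x ∧ t = s)) :
    IsHole G (S ∪ T) := by
  obtain ⟨s', hs', hS', hSu⟩ := hS.tail hne
  obtain ⟨t', ht', hT', hTu⟩ := hT.tail hne'
  have h1 : S ∪ T = insert c (S \ {c} ∪ T \ {c}) := by
    have := hS.left_mem
    ext y; simp; grind
  rw [h1]
  have hs1 := hS'.left_mem
  have ht1 := hT'.left_mem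
  simp only [Set.mem_sdiff, Set.mem_singleton_iff] at hs1 ht1
  refine (hS'.append hT'.symm hxs ?_).isHole ?_ hs' ht' ?_ ?_ ?_
  · rintro y ⟨hy, hyc⟩ t ⟨ht, htc⟩
    exact hx y hy t ht hyc htc
  · simp
  · rintro y (hy | hy) e
    · exact .inl (hSu y hy.1 e)
    · exact .inr (hTu y hy.1 e)
  · exact (hx _ hs1.1 _ ht1.1 hs1.2 ht1.2).1
  · intro e
    obtain ⟨rfl, -⟩ := (hx _ hs1.1 _ ht1.1 hs1.2 ht1.2).2 e
    exact hcx hs'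

section free

variable [Finite V] (hG : IsC4FreeOddSignable G)

include hG

/-- Two spokes `x`, `x'`, joined to `c`, together with two paths from `c` to spokes `s` and `r`
such that `x` is adjacent to `s`. -/
theorem no_four_spokes {v c x x' s r : V} {L L' T R : Set V}
    (hL : IPath G L c x) (hL' : IPath G L' c x') (hT : IPath G T c s) (hR : IPath G R c r)
    (hvc : ¬ G.Adj v c) (hvx : G.Adj v x) (hvx' : G.Adj v x') (hvs : G.Adj v s) (hvr : G.Adj v r)
    (hvL : ∀ y ∈ L, y ≠ v ∧ (G.Adj v y → y = x)) (hvL' : ∀ y ∈ L', y ≠ v ∧ (G.Adj v y → y = x'))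
    (hvT : ∀ y ∈ T, y ≠ v ∧ (G.Adj v y → y = s)) (hvR : ∀ y ∈ R, y ≠ v ∧ (G.Adj v y → y = r))
    (hxx' : ¬ G.Adj x x') (hne : x ≠ x') (hsx : G.Adj s x) (hsx' : ¬ G.Adj s x')
    (hrx : ¬ G.Adj r x) (hrx' : ¬ G.Adj r x')
    (hLT : ∀ y ∈ L, ∀ t ∈ T, y ≠ c → t ≠ c → y ≠ t ∧ (G.Adj y t → y = x ∧ t = s))
    (hLR : ∀ y ∈ L, ∀ t ∈ R, y ≠ c → t ≠ c → y ≠ t ∧ ¬ G.Adj y t)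
    (hLT' : ∀ y ∈ L', ∀ t ∈ T, y ≠ c → t ≠ c → y ≠ t ∧ ¬ G.Adj y t)
    (hLR' : ∀ y ∈ L', ∀ t ∈ R, y ≠ c → t ≠ c → y ≠ t ∧ ¬ G.Adj y t) : False := by
  have hcx : c ≠ x := by rintro rfl; exact hvc hvx
  have hcx' : c ≠ x' := by rintro rfl; exact hvc hvx'
  have hcs : c ≠ s := by rintro rfl; exact hvc hvs
  have hcr : c ≠ r := by rintro rfl; exact hvc hvr
  have mL := hL.left_mem; have mL' := hL'.left_mem; have mT := hT.left_mem
  have mR := hR.left_mem; have nL := hL.right_mem; have nL' := hL'.right_mem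
  have nT := hT.right_mem; have nR := hR.right_mem
  have hxL' : x ∉ L' := fun h => hne ((hvL' x h).2 hvx)
  have hx'L : x' ∉ L := fun h => hne ((hvL x' h).2 hvx').symm
  have hrx2 : r ≠ x := (hLR x nL r nR hcx.symm hcr.symm).1.symm
  have hrx2' : r ≠ x' := (hLR' x' nL' r nR hcx'.symm hcr.symm).1.symm
  have hsx2' : s ≠ x' := (hLT' x' nL' s nT hcx'.symm hcs.symm).1.symm
  have hxR : x ∉ R := fun h => hrx2 ((hvR x h).2 hvx).symm
  have hxT : x ∉ T := fun h => hsx.ne ((hvT x h).2 hvx).symm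
  have hx'R : x' ∉ R := fun h => hrx2' ((hvR x' h).2 hvx').symm
  have hx'T : x' ∉ T := fun h => hsx2' ((hvT x' h).2 hvx').symm
  have irr := G.loopless.irrefl
  -- closing a path through `c` between two nonadjacent spokes
  have close : ∀ {S U : Set V} {e f : V}, IPath G S c e → IPath G U c f → G.Adj v e → G.Adj v f →
      e ≠ f → ¬ G.Adj e f → (∀ y ∈ S, y ≠ v ∧ (G.Adj v y → y = e)) →
      (∀ y ∈ U, y ≠ v ∧ (G.Adj v y → y = f)) →
      (∀ y ∈ S, ∀ t ∈ U, y ≠ c → t ≠ c → y ≠ t ∧ ¬ G.Adj y t) →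
      IsHole G (insert v (S ∪ U)) := by
    intro S U e f hS hU he hf hef hef' hvS hvU hSU
    refine (hS.symm.glue hU fun y hy t ht => hSU y hy.1 t ht.1 hy.2 ht.2).isHole ?_ he hf ?_ hef hef'
    · rintro (h | h)
      · exact (hvS v h).1 rfl
      · exact (hvU v h).1 rfl
    · rintro y (h | h) e
      · exact .inl ((hvS y h).2 e)
      · exact .inr ((hvU y h).2 e)
  -- If `x` sees `L'`, the holes through `v`, `L'`, `R` and through `v`, `L'`, `T` meet the
  -- neighbourhood of `x` in sets that differ in `s` alone, so both cannot be odd.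
  by_cases h1 : ∃ y ∈ L', G.Adj x y
  · obtain ⟨y, hy, hxy⟩ := h1
    have hvy : ¬ G.Adj v y := fun e => hxx' ((hvL' y hy).2 e ▸ hxy)
    have o1 := (close hL' hR hvx' hvr hrx2'.symm (fun e => hrx' e.symm) hvL' hvR hLR').odd hG
      (z := x) (x := v) (y := y) (by simp [hvx.ne', hxL', hxR]) (by simp) (by simp [hy]) hvx.symm hxy
      (hvL' y hy).1.symm hvy
    have o2 := (close hL' hT hvx' hvs hsx2'.symm (fun e => hsx' e.symm) hvL' hvT hLT').odd hG
      (z := x) (x := v) (y := y) (by simp [hvx.ne', hxL', hxT]) (by simp) (by simp [hy]) hvx.symm hxy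
      (hvL' y hy).1.symm hvy
    have e1 : G.neighborSet x ∩ insert v (L' ∪ R) = insert v (G.neighborSet x ∩ L') := by
      clear * - hvx hrx hLR hcr hne hxL' hL' hR nL mL' hcx hLT' hsx hxR hxT hLT hvs hcs nT
      ext u
      have := hvx.symm
      have := hLR x nL u
      have := hLT x nL u
      have := hsx.symm
      simp only [Set.mem_inter_iff, mem_neighborSet, Set.mem_insert_iff, Set.mem_union]
      grind
    have e2 : G.neighborSet x ∩ insert v (L' ∪ T) = insert v (insert s (G.neighborSet x ∩ L')) := by
      ext u
      have := hvx.symm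
      have := hsx.symm
      simp only [Set.mem_inter_iff, mem_neighborSet, Set.mem_insert_iff, Set.mem_union]
      grind
    have hvL2 : v ∉ L' := fun h => (hvL' v h).1 rfl
    have hsL2 : s ∉ L' := fun h => hsx2' ((hvL' s h).2 hvs)
    rw [e1, Set.ncard_insert_of_notMem (by simp [hvL2])] at o1
    rw [e2, Set.ncard_insert_of_notMem (by simp [hvL2, hvs.ne]),
      Set.ncard_insert_of_notMem (by simp [hsL2])] at o2
    rw [Nat.odd_iff] at o1 o2
    omega
  push Not at h1
  obtain ⟨c', hcc', hLt, -⟩ := hL.tail hcx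
  -- Coming from `x'`, the vertex `z` is the first of `L'` with a neighbour on `L`. The positions of
  -- its first and last neighbours `e`, `f` on `L` decide which configuration appears.
  obtain ⟨z, P, P', hs, ⟨e₀, he₀, hze₀⟩, hP⟩ := hL'.symm.exists_first (p := fun z => ∃ e ∈ L, G.Adj z e)
    ⟨c, mL', c', hLt.left_mem.1, hcc'⟩
  have hzP := hs.left.right_mem
  have hx'P := hs.left.left_mem
  have hPL' := hs.subset_left
  have hzL : z ∉ L := by
    intro hz
    have hzx' : z ≠ x' := fun e => hx'L (e ▸ hz)
    obtain ⟨z', hzz', ht, -⟩ := hs.left.symm.tail hzx'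
    exact ht.left_mem.2 (hP z' ht.left_mem.1 ⟨z, hz, hzz'.symm⟩)
  have hPL : ∀ y ∈ P, y ∉ L := by
    intro y hy hyL
    by_cases hyz : y = z
    · exact hzL (hyz ▸ hyL)
    by_cases hyx : y = x
    · subst hyx; exact hxL' (hPL' hy)
    obtain ⟨y', hyy', hyt⟩ : ∃ y', G.Adj y y' ∧ y' ∈ L := by
      obtain ⟨S₁, S₂, hsp⟩ := hL.split hyL
      obtain ⟨y', h1, h2, -⟩ := hsp.right.tail hyx
      exact ⟨y', h1, hsp.subset_right h2.left_mem.1⟩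
    exact hyz (hP y hy ⟨y', hyt, hyy'⟩)
  have hcP : c ∉ P := fun h => hPL c h mL
  have hzx : ¬ G.Adj z x := fun e => h1 z (hPL' hzP) e.symm
  obtain ⟨e, f, A, M, B, hA, hM, hB, hu, he, hf, hAl, hBl, hAB, hAB'⟩ :=
    hL.exists_first_last (p := fun y => G.Adj z y) ⟨e₀, he₀, hze₀⟩
  have hAL : A ⊆ L := by rw [← hu]; clear * -; intro y; simp; tauto
  have hBL : B ⊆ L := by rw [← hu]; clear * -; intro y; simp; tauto
  have hzPadj : ∀ y ∈ P, ∀ t ∈ L, G.Adj y t → y = z := fun y hy t ht e => hP y hy ⟨t, ht, e⟩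
  have meA := hA.right_mem; have mcA := hA.left_mem
  have mfB := hB.left_mem; have mxB := hB.right_mem
  have meM := hM.left_mem; have mfM := hM.right_mem
  have hex : e ≠ x := fun h => hzx (h ▸ he)
  have hfx : f ≠ x := fun h => hzx (h ▸ hf)
  have hve : ¬ G.Adj v e := fun h => hex ((hvL e (hAL meA)).2 h)
  have hvP : ∀ y ∈ P, y ≠ v ∧ (G.Adj v y → y = x') := fun y hy => hvL' y (hPL' hy)
  simp only [Anti, Set.mem_sdiff, Set.mem_union, Set.mem_singleton_iff] at hAB hAB'
  have hvL2 : v ∉ L := fun h => (hvL v h).1 rfl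
  have hcB : c ∈ B → e = c := by
    intro hcB
    by_contra h
    exact (hAB c ⟨mcA, Ne.symm h⟩ c ⟨.inr hcB, Ne.symm h⟩).1 rfl
  have hPT : ∀ y ∈ P, ∀ t ∈ T, t ≠ c → y ≠ t ∧ ¬ G.Adj y t := fun y hy t ht htc =>
    hLT' y (hPL' hy) t ht (fun h => hcP (h ▸ hy)) htc
  have hPR : ∀ y ∈ P, ∀ t ∈ R, t ≠ c → y ≠ t ∧ ¬ G.Adj y t := fun y hy t ht htc =>
    hLR' y (hPL' hy) t ht (fun h => hcP (h ▸ hy)) htc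
  have hPB : ∀ y ∈ P, ∀ t ∈ B, y ≠ t ∧ (G.Adj y t → y = z ∧ t = f) := by
    intro y hy t ht
    refine ⟨fun h => hPL y hy (h ▸ hBL ht), fun h => ?_⟩
    obtain rfl := hzPadj y hy t (hBL ht) h
    exact ⟨rfl, hBl t ht h⟩
  have hPA : ∀ y ∈ P, ∀ t ∈ A, y ≠ t ∧ (G.Adj y t → y = z ∧ t = e) := by
    intro y hy t ht
    refine ⟨fun h => hPL y hy (h ▸ hAL ht), fun h => ?_⟩
    obtain rfl := hzPadj y hy t (hAL ht) h
    exact ⟨rfl, hAl t ht h⟩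
  have hBR : ∀ y ∈ B, ∀ t ∈ R, y ≠ c → t ≠ c → y ≠ t ∧ ¬ G.Adj y t := fun y hy t ht =>
    hLR y (hBL hy) t ht
  -- One attachment: a theta with ends `e` and `v`, through `x`, through `c` and `r`, and through
  -- `P` and `x'`.
  by_cases hef : e = f
  · subst hef
    have hev : e ≠ v := (hvL e (hAL meA)).1
    refine theta_free' hG (a := e) (b := v) (X := B \ {e}) (Y := A \ {e} ∪ R \ {c})
      (Z := P) hev (fun h => hve h.symm) ?_ ?_ ?_ ?_ ?_ ?_
    · exact (hB.reach' (by clear * -; intro; simp; tauto)).snoc (by simp) hvx.symm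
    · refine (hA.symm.reach' (by clear * -; intro; simp; tauto)).trans
        ((hR.reach' ?_).snoc (by simp) hvr.symm)
      clear * - mcA
      intro y; simp; grind
    · exact ((hs.left.symm.reach' (by clear * -; intro; simp; tauto)).snoc (by simp) hvx'.symm).cons
        (by simp) he.symm
    · rintro y ⟨hy, hye⟩ t (⟨ht, hte⟩ | ⟨ht, htc⟩) <;> simp only [Set.mem_singleton_iff] at *
      · have := hAB t ⟨ht, hte⟩ y ⟨.inr hy, hye⟩
        exact ⟨this.1.symm, fun h => this.2 h.symm⟩
      · exact hBR y hy t ht (by rintro rfl; exact hye (hcB hy).symm) htc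
    · rintro y ⟨hy, hye⟩ t ht
      have := hPB t ht y hy
      exact ⟨this.1.symm, fun h => hye (this.2 h.symm).2⟩
    · rintro y (⟨hy, hye⟩ | ⟨hy, hyc⟩) t ht
      · have := hPA t ht y hy
        exact ⟨this.1.symm, fun h => hye (this.2 h.symm).2⟩
      · have := hPR t ht y hy hyc
        exact ⟨this.1.symm, fun h => this.2 h.symm⟩
  have hcB' : c ∉ B := by
    intro h
    obtain rfl := hcB h
    exact hef (hBl e h he)
  have heB : e ∉ B := fun h => hef (hBl e h he)
  have hfA : f ∉ A := fun h => hef (hAl f h hf).symm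
  have hAB2 : ∀ y ∈ A, ∀ t ∈ B, y ≠ t ∧ (G.Adj y t → y = e ∧ t = f) := by
    clear * - heB hfA hAB hAB' hef meM
    intro y hy t ht
    have hte : t ≠ e := fun h => heB (h ▸ ht)
    have hyf : y ≠ f := fun h => hfA (h ▸ hy)
    refine ⟨?_, fun h => ⟨?_, ?_⟩⟩
    · rintro rfl; exact (hAB y ⟨hy, hte⟩ y ⟨.inr ht, hte⟩).1 rfl
    · by_contra hye; exact (hAB y ⟨hy, hye⟩ t ⟨.inr ht, hte⟩).2 h
    · by_contra htf; exact (hAB' y ⟨.inl hy, hyf⟩ t ⟨ht, htf⟩).2 h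
  -- Two adjacent attachments: a prism with triangles `z`, `e`, `f` and `v`, `s`, `x`.
  by_cases hef' : G.Adj e f
  · have hes : e ≠ s := fun h => hve (h ▸ hvs)
    refine prism_free hG he hf hef' hvs hvx hsx (hvP z hzP).1 hes hfx
      (X := insert v P) (Y := A ∪ T) (Z := B)
      ((hs.left.symm.reach' (by simp)).snoc (by simp) hvx'.symm)
      ((hA.symm.reach' (by simp)).trans (hT.reach' (by simp)))
      (hB.reach' subset_rfl) ?_ ?_ ?_
    · rintro y (rfl | hy) t (ht | ht)
      · exact ⟨(hvL t (hAL ht)).1.symm, fun h => absurd ((hvL t (hAL ht)).2 h)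
          fun h => (hAB2 t ht x mxB).1 h⟩
      · exact ⟨(hvT t ht).1.symm, fun h => .inr ⟨rfl, (hvT t ht).2 h⟩⟩
      · exact ⟨(hPA y hy t ht).1, fun h => .inl ((hPA y hy t ht).2 h)⟩
      · by_cases htc : t = c
        · subst htc
          exact ⟨(hPA y hy t mcA).1, fun h => .inl ((hPA y hy t mcA).2 h)⟩
        · exact ⟨(hPT y hy t ht htc).1, fun h => absurd h (hPT y hy t ht htc).2⟩
    · rintro y (rfl | hy) t ht
      · exact ⟨(hvL t (hBL ht)).1.symm, fun h => .inr ⟨rfl, (hvL t (hBL ht)).2 h⟩⟩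
      · exact ⟨(hPB y hy t ht).1, fun h => .inl ((hPB y hy t ht).2 h)⟩
    · rintro y (hy | hy) t ht
      · exact ⟨(hAB2 y hy t ht).1, fun h => .inl ((hAB2 y hy t ht).2 h)⟩
      · by_cases hyc : y = c
        · subst hyc
          exact ⟨(hAB2 y mcA t ht).1, fun h => .inl ((hAB2 y mcA t ht).2 h)⟩
        · have := hLT t (hBL ht) y hy (fun h => hcB' (h ▸ ht)) hyc
          exact ⟨this.1.symm, fun h => .inr (this.2 h.symm).symm⟩
  -- Two nonadjacent attachments. If `z = x'`, the hole through `v`, `L`, `R` gives `z` exactly one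
  -- neighbour more, namely `v`, than the hole formed by `L` and `T`. Otherwise there is a theta
  -- with ends `z` and `v`.
  by_cases hzx' : z = x'
  · subst hzx'
    have o1 := (close hL hR hvx hvr hrx2.symm (fun e => hrx e.symm) hvL hvR hLR).odd hG
      (z := z) (x := v) (y := e) (by simp [hvx'.ne', hzL, hx'R]) (by simp) (by simp [hAL meA])
      hvx'.symm he (hvL e (hAL meA)).1.symm hve
    have o2 := (hL.isHole_glue hT hsx.symm (fun h => h1 c mL' h.symm) hcx hcs hLT).odd hG
      (z := z) (x := e) (y := f) (by simp [hzL, hx'T]) (.inl (hAL meA)) (.inl (hBL mfB))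
      he hf hef hef'
    have e1 : G.neighborSet z ∩ insert v (L ∪ R) = insert v (G.neighborSet z ∩ L) := by
      clear * - hvx' hPR hx'P mL
      ext u
      have := hvx'.symm
      have := hPR z hx'P u
      simp only [Set.mem_inter_iff, mem_neighborSet, Set.mem_insert_iff, Set.mem_union]
      grind
    have e2 : G.neighborSet z ∩ (L ∪ T) = G.neighborSet z ∩ L := by
      clear * - hPT hx'P mL
      ext u
      have := hPT z hx'P u
      simp only [Set.mem_inter_iff, mem_neighborSet, Set.mem_union]
      grind
    rw [e1, Set.ncard_insert_of_notMem (by simp [hvL2])] at o1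
    rw [e2] at o2
    rw [Nat.odd_iff] at o1 o2
    omega
  · refine theta_free' hG (a := z) (b := v) (X := B) (Y := A ∪ R) (Z := P \ {z}) (hvP z hzP).1
      (fun h => hzx' ((hvP z hzP).2 h.symm)) ?_ ?_ ?_ ?_ ?_ ?_
    · exact ((hB.reach' (by clear * -; intro; simp; tauto)).snoc (by simp) hvx.symm).cons (by simp) hf
    · exact ((hA.symm.reach' (by clear * -; intro; simp; tauto)).trans
        ((hR.reach' (by clear * -; intro; simp; tauto)).snoc (by simp) hvr.symm)).cons (by simp) he
    · exact (hs.left.symm.reach' (by clear * -; intro; simp; tauto)).snoc (by simp) hvx'.symm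
    · rintro y hy t (ht | ht)
      · exact ⟨(hAB2 t ht y hy).1.symm, fun h => hef' (by
          obtain ⟨h1, h2⟩ := (hAB2 t ht y hy).2 h.symm
          exact h1 ▸ h2 ▸ h.symm)⟩
      · have hyc : y ≠ c := fun h => hcB' (h ▸ hy)
        by_cases htc : t = c
        · subst htc
          exact ⟨hyc, fun h => hef' (by
            obtain ⟨h1, h2⟩ := (hAB2 t mcA y hy).2 h.symm
            exact h1 ▸ h2 ▸ h.symm)⟩
        · exact hBR y hy t ht hyc htc
    · rintro y hy t ⟨ht, htz⟩
      exact ⟨(hPB t ht y hy).1.symm, fun h => htz ((hPB t ht y hy).2 h.symm).1⟩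
    · rintro y (hy | hy) t ⟨ht, htz⟩
      · exact ⟨(hPA t ht y hy).1.symm, fun h => htz ((hPA t ht y hy).2 h.symm).1⟩
      · by_cases hyc : y = c
        · subst hyc
          exact ⟨(hPA t ht y mcA).1.symm, fun h => htz ((hPA t ht y mcA).2 h.symm).1⟩
        · exact ⟨(hPR t ht y hy hyc).1.symm, fun h => (hPR t ht y hy hyc).2 h.symm⟩

end free

end

/-! ### Indexed paths, and a vertex attached to a path between two spokes. -/

section

open SimpleGraph

variable {V : Type*} {G : SimpleGraph V}

/-- The first `n + 1` terms of the sequence `b` are the vertices of an induced path, in order. -/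
structure ISeq (G : SimpleGraph V) (b : ℕ → V) (n : ℕ) : Prop where
  inj : ∀ i ≤ n, ∀ j ≤ n, b i = b j → i = j
  adj : ∀ i ≤ n, ∀ j ≤ n, (G.Adj (b i) (b j) ↔ i + 1 = j ∨ j + 1 = i)

namespace ISeq

variable {b : ℕ → V} {n : ℕ}

theorem shift (h : ISeq G b n) {k m : ℕ} (hm : k + m ≤ n) : ISeq G (fun i => b (k + i)) m :=
  ⟨fun i hi j hj e => by have := h.inj (k + i) (by omega) (k + j) (by omega) e; omega,
    fun i hi j hj => by rw [h.adj (k + i) (by omega) (k + j) (by omega)]; omega⟩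

theorem mirror (h : ISeq G b n) : ISeq G (fun i => b (n - i)) n :=
  ⟨fun i hi j hj e => by have := h.inj (n - i) (by omega) (n - j) (by omega) e; omega,
    fun i hi j hj => by rw [h.adj (n - i) (by omega) (n - j) (by omega)]; omega⟩

theorem far (h : ISeq G b n) {i j : ℕ} (hi : i ≤ n) (hj : j ≤ n) (hij : i + 1 < j ∨ j + 1 < i) :
    b i ≠ b j ∧ ¬ G.Adj (b i) (b j) := by
  refine ⟨fun e => ?_, fun e => ?_⟩
  · have := h.inj i hi j hj e; omega
  · rw [h.adj i hi j hj] at e; omega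

theorem ne (h : ISeq G b n) {i j : ℕ} (hi : i ≤ n) (hj : j ≤ n) (hij : i ≠ j) : b i ≠ b j :=
  fun e => hij (h.inj i hi j hj e)

theorem iPath (h : ISeq G b n) {i j : ℕ} (hij : i ≤ j) (hj : j ≤ n) :
    IPath G (b '' Set.Icc i j) (b i) (b j) := by
  obtain ⟨d, rfl⟩ := Nat.exists_eq_add_of_le hij
  clear hij
  induction d generalizing i with
  | zero => simpa using IPath.refl (b i)
  | succ d ih =>
    have h1 : Set.Icc i (i + (d + 1)) = insert i (Set.Icc (i + 1) (i + 1 + d)) := by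
      ext k; simp; omega
    rw [h1, Set.image_insert_eq]
    have h2 : i + (d + 1) = i + 1 + d := by omega
    rw [h2] at hj ⊢
    refine .cons ((h.adj i (by omega) (i + 1) (by omega)).2 (.inl rfl)) (ih hj) ?_ ?_
    · rintro ⟨k, ⟨hk1, hk2⟩, e⟩
      have := h.inj k (by omega) i (by omega) e
      omega
    · rintro _ ⟨k, ⟨hk1, hk2⟩, rfl⟩ e
      rw [h.adj i (by omega) k (by omega)] at e
      have : k = i + 1 := by omega
      rw [this]

theorem reach (h : ISeq G b n) {i j : ℕ} (hij : i ≤ j) (hj : j ≤ n) {X : Set V}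
    (hX : ∀ k, i ≤ k → k ≤ j → b k ∈ X) : Reach G X (b i) (b j) :=
  (h.iPath hij hj).reach' (by rintro _ ⟨k, ⟨h1, h2⟩, rfl⟩; exact hX k h1 h2)

theorem reach_symm (h : ISeq G b n) {i j : ℕ} (hij : i ≤ j) (hj : j ≤ n) {X : Set V}
    (hX : ∀ k, i ≤ k → k ≤ j → b k ∈ X) : Reach G X (b j) (b i) :=
  (h.reach hij hj hX).symm

end ISeq

/-- The vertices of a path can be listed in order. -/
theorem IPath.exists_iSeq {S : Set V} {a b : V} (h : IPath G S a b) :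
    ∃ (f : ℕ → V) (n : ℕ), ISeq G f n ∧ f 0 = a ∧ f n = b ∧ S = f '' Set.Icc 0 n := by
  induction h with
  | refl a => exact ⟨fun _ => a, 0, ⟨by intros; omega, by intro i hi j hj; simp; try omega⟩, rfl, rfl, by simp⟩
  | @cons S a e b hab h ha hS ih =>
    obtain ⟨f, n, hf, h0, hn, rfl⟩ := ih
    have hf' : ∀ j ≤ n, f j ∈ f '' Set.Icc 0 n := fun j hj => ⟨j, ⟨by omega, hj⟩, rfl⟩
    refine ⟨fun i => if i = 0 then a else f (i - 1), n + 1, ⟨?_, ?_⟩, by simp, by simpa, ?_⟩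
    · intro i hi j hj
      rcases i with _ | i <;> rcases j with _ | j <;> simp
      · rintro rfl; exact ha (hf' j (by omega))
      · rintro rfl; exact ha (hf' i (by omega))
      · intro e; exact hf.inj i (by omega) j (by omega) e
    · have key : ∀ j ≤ n, (G.Adj a (f j) ↔ j = 0) := by
        intro j hj
        refine ⟨fun e => hf.inj j hj 0 (by omega) ((hS _ (hf' j hj) e).trans h0.symm), ?_⟩
        rintro rfl
        rwa [h0]
      intro i hi j hj
      rcases i with _ | i <;> rcases j with _ | j <;> simp
      · rw [key j (by omega)]
      · rw [G.adj_comm, key i (by omega)]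
      · rw [hf.adj i (by omega) j (by omega)]
    · ext x
      simp only [Set.mem_insert_iff, Set.mem_image, Set.mem_Icc]
      constructor
      · rintro (rfl | ⟨k, hk, rfl⟩)
        · exact ⟨0, by simp, by simp⟩
        · exact ⟨k + 1, by omega, by simp⟩
      · rintro ⟨k, hk, rfl⟩
        rcases k with _ | k
        · simp
        · exact .inr ⟨k, by omega, by simp⟩

/-- A path `b` with spokes as ends and a vertex `c` joined to both ends through `F`. -/
structure Att (G : SimpleGraph V) (v : V) (b : ℕ → V) (l : ℕ) (c : V) (F : Set V) : Prop where
  seq : ISeq G b l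
  bv : ∀ i ≤ l, b i ≠ v
  v0 : G.Adj v (b 0)
  vl : G.Adj v (b l)
  cv : c ≠ v
  nvc : ¬ G.Adj v c
  bc : ∀ i ≤ l, b i ≠ c
  Fv : ∀ y ∈ F, y ≠ v ∧ ¬ G.Adj v y
  Fb : ∀ y ∈ F, ∀ i ≤ l, b i ≠ y
  Fb' : ∀ y ∈ F, ∀ i, 0 < i → i < l → ¬ G.Adj (b i) y
  reachl : Reach G (insert c (insert (b l) F)) c (b l)
  reach0 : Reach G (insert c (insert (b 0) F)) c (b 0)

namespace Att

variable {v c : V} {b : ℕ → V} {l : ℕ} {F : Set V}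

theorem mirror (A : Att G v b l c F) : Att G v (fun i => b (l - i)) l c F where
  seq := A.seq.mirror
  bv i hi := A.bv _ (by omega)
  v0 := A.vl
  vl := by simpa using A.v0
  cv := A.cv
  nvc := A.nvc
  bc i hi := A.bc _ (by omega)
  Fv := A.Fv
  Fb y hy i hi := A.Fb y hy _ (by omega)
  Fb' y hy i hi hi' := A.Fb' y hy _ (by omega) (by omega)
  reachl := by simpa using A.reach0
  reach0 := by simpa using A.reachl

variable [Finite V]
variable (hG : IsC4FreeOddSignable G)

include hG

omit [Finite V] in
/-- Spokes adjacent to a common vertex are adjacent to each other. -/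
theorem clique (A : Att G v b l c F) {y : V} (hyv : y ≠ v) (hvy : ¬ G.Adj v y) {i j : ℕ} (hi : i ≤ l)
    (hj : j ≤ l) (hij : i + 1 < j ∨ j + 1 < i) (vi : G.Adj v (b i)) (vj : G.Adj v (b j))
    (ci : G.Adj y (b i)) : ¬ G.Adj y (b j) := fun cj =>
  (A.seq.far hi hj hij).2 (square_free hG vi ci.symm cj vj.symm hyv.symm hvy (A.seq.far hi hj hij).1)

/-- The hole through `c`, `b i, …, b l` and back to `c` by `F` has an odd number of spokes as soon
as one of them is not adjacent to `b l`. If there is none, `b l` is the only spoke on the segment,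
an odd number again, or `b (l - 1)` is the only other one. -/
theorem odd_or (A : Att G v b l c F) {i : ℕ} (hi : 0 < i) (hil : i < l) (hci : G.Adj c (b i))
    (hmax : ∀ k, i < k → k < l → ¬ G.Adj c (b k)) :
    Odd {k | (i ≤ k ∧ k ≤ l) ∧ G.Adj v (b k)}.ncard ∨
      G.Adj v (b (l - 1)) ∧ ∀ k, i ≤ k → k + 2 ≤ l → ¬ G.Adj v (b k) := by
  by_cases h1 : ∃ k, i ≤ k ∧ k + 2 ≤ l ∧ G.Adj v (b k)
  · left
    obtain ⟨k, hik, hkl, hvk⟩ := h1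
    obtain ⟨L, hL, hLp⟩ := A.reachl
    have hLi : ∀ y ∈ L, y = c ∨ y = b l ∨ y ∈ F := fun y hy => by simpa using hL hy
    have hole : IsHole G (L ∪ b '' Set.Icc i l) := by
      by_cases hcl : G.Adj c (b l)
      · rw [hLp.eq_pair hcl]
        have : ({c, b l} ∪ b '' Set.Icc i l : Set V) = insert c (b '' Set.Icc i l) := by
          have : b l ∈ b '' Set.Icc i l := ⟨l, ⟨hil.le, le_rfl⟩, rfl⟩
          ext x; simp only [Set.mem_union, Set.mem_insert_iff, Set.mem_singleton_iff]
          constructor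
          · rintro ((rfl | rfl) | h) <;> simp_all
          · rintro (rfl | h) <;> simp_all
        rw [this]
        refine (A.seq.iPath hil.le le_rfl).isHole ?_ hci hcl ?_
          (A.seq.far (by omega) le_rfl (by omega)).1 (A.seq.far (by omega) le_rfl (by omega)).2
        · rintro ⟨j, ⟨_, hj⟩, e⟩; exact A.bc j hj e
        · rintro _ ⟨j, ⟨hj1, hj2⟩, rfl⟩ e
          by_contra hne
          push Not at hne
          have h1 : j ≠ i := fun h => hne.1 (by rw [h])
          have h2 : j ≠ l := fun h => hne.2 (by rw [h])
          exact hmax j (by omega) (by omega) e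
      · refine hLp.symm.isHole_glue (A.seq.iPath hil.le le_rfl).symm hci (fun e => hcl e.symm)
          (A.bc l le_rfl) (A.seq.ne le_rfl (by omega) (by omega)) ?_
        rintro y hy _ ⟨j, ⟨hj1, hj2⟩, rfl⟩ hyl hjl
        have hj3 : j ≠ l := fun h => hjl (by rw [h])
        rcases hLi y hy with rfl | rfl | hy
        · refine ⟨(A.bc j hj2).symm, fun e => ⟨rfl, ?_⟩⟩
          by_contra hne
          have h1 : j ≠ i := fun h => hne (by rw [h])
          exact hmax j (by omega) (by omega) e
        · exact absurd rfl hyl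
        · exact ⟨(A.Fb y hy j hj2).symm, fun e => absurd e.symm (A.Fb' y hy j (by omega) (by omega))⟩
    have o := hole.odd hG (z := v) (x := b l) (y := b k) ?_ (.inl hLp.right_mem)
      (.inr ⟨k, ⟨hik, by omega⟩, rfl⟩) A.vl hvk (A.seq.far le_rfl (by omega) (by omega)).1
      (A.seq.far le_rfl (by omega) (by omega)).2
    · have e : G.neighborSet v ∩ (L ∪ b '' Set.Icc i l) =
          b '' {k | (i ≤ k ∧ k ≤ l) ∧ G.Adj v (b k)} := by
        ext x
        simp only [Set.mem_inter_iff, mem_neighborSet, Set.mem_union, Set.mem_image, Set.mem_Icc,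
          Set.mem_ofPred_eq]
        constructor
        · rintro ⟨h, hx | ⟨j, hj, rfl⟩⟩
          · rcases hLi x hx with rfl | rfl | hx
            · exact absurd h A.nvc
            · exact ⟨l, ⟨⟨hil.le, le_rfl⟩, h⟩, rfl⟩
            · exact absurd h (A.Fv x hx).2
          · exact ⟨j, ⟨hj, h⟩, rfl⟩
        · rintro ⟨j, ⟨hj, h⟩, rfl⟩
          exact ⟨h, .inr ⟨j, hj, rfl⟩⟩
      rw [e] at o
      rwa [Set.InjOn.ncard_image] at o
      rintro j ⟨hj, -⟩ k ⟨hk, -⟩ e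
      exact A.seq.inj j hj.2 k hk.2 e
    · rintro (h | ⟨j, ⟨_, hj⟩, e⟩)
      · rcases hLi v h with h | h | h
        · exact A.cv h.symm
        · exact A.bv l le_rfl h.symm
        · exact (A.Fv v h).1 rfl
      · exact A.bv j hj e
  · push Not at h1
    by_cases h2 : G.Adj v (b (l - 1))
    · exact .inr ⟨h2, h1⟩
    · left
      have : {k | (i ≤ k ∧ k ≤ l) ∧ G.Adj v (b k)} = {l} := by
        ext k
        simp only [Set.mem_ofPred_eq, Set.mem_singleton_iff]
        constructor
        · rintro ⟨⟨hk1, hk2⟩, hv⟩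
          by_contra hne
          by_cases h3 : k = l - 1
          · exact h2 (h3 ▸ hv)
          · exact h1 k hk1 (by omega) hv
        · rintro rfl
          exact ⟨⟨by omega, le_rfl⟩, A.vl⟩
      rw [this]; simp

end Att

end

/-! ### The local argument: the inner neighbours of `c` on a path between two spokes. -/

section

open SimpleGraph

variable {V : Type*} {G : SimpleGraph V}

namespace Att

variable {v c : V} {b : ℕ → V} {l : ℕ} {F : Set V}

/-- The vertices of `F` and of `b` between given indices. -/
theorem anti_seg (A : Att G v b l c F) {i j : ℕ} (hi : 0 < i) (hj : j < l) :
    Anti G F (b '' Set.Icc i j) := by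
  rintro y hy _ ⟨k, ⟨h1, h2⟩, rfl⟩
  exact ⟨(A.Fb y hy k (by omega)).symm,
    fun e => A.Fb' y hy k (by omega) (by omega) e.symm⟩

theorem anti_segs (A : Att G v b l c F) {i j i' j' : ℕ} (h : j + 1 < i') (hj : j' ≤ l) :
    Anti G (b '' Set.Icc i j) (b '' Set.Icc i' j') := by
  rintro _ ⟨k, ⟨h1, h2⟩, rfl⟩ _ ⟨k', ⟨h1', h2'⟩, rfl⟩
  exact A.seq.far (by omega) (by omega) (by omega)

theorem anti_v (A : Att G v b l c F) : Anti G F {v} := by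
  rintro y hy _ rfl
  exact ⟨(A.Fv y hy).1, fun e => (A.Fv y hy).2 e.symm⟩

theorem anti_seg_v (A : Att G v b l c F) {i j : ℕ} (hj : j ≤ l)
    (h : ∀ k, i ≤ k → k ≤ j → ¬ G.Adj v (b k)) : Anti G (b '' Set.Icc i j) {v} := by
  rintro _ ⟨k, ⟨h1, h2⟩, rfl⟩ _ rfl
  exact ⟨A.bv k (by omega), fun e => h k h1 h2 e.symm⟩

theorem anti_union {S T U : Set V} (h : Anti G S T) (h' : Anti G S U) : Anti G S (T ∪ U) := by
  rintro y hy z (hz | hz)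
  · exact h y hy z hz
  · exact h' y hy z hz

variable [Finite V] (hG : IsC4FreeOddSignable G)

include hG

/-- `no_four_spokes` at `c`: the spokes `b 0` and `b l` are reached through `F`, the spoke `b 1`
down from `b i`, and a fourth one from `b j` towards `b m`, stopping at the first spoke met. The
margins at `j` and `m` keep the fourth spoke off the neighbours of `b 0` and `b l`. -/
theorem near_spoke (A : Att G v b l c F) (hv1 : G.Adj v (b 1)) {i j m : ℕ} (hi : 0 < i)
    (hci : G.Adj c (b i)) (hno : ∀ k, 2 ≤ k → k ≤ i → ¬ G.Adj v (b k))
    (hj : 2 ≤ j) (hjl : j + 2 ≤ l) (hcj : G.Adj c (b j))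
    (hm : 2 ≤ m) (hml : m + 2 ≤ l) (hvm : G.Adj v (b m)) : False := by
  have him : i < m := by
    by_contra h
    exact hno m hm (by omega) hvm
  have hcb : ∀ k ≤ l, b k ≠ c := A.bc
  obtain ⟨L, hL, hLp⟩ := A.reach0
  obtain ⟨L', hL', hLp'⟩ := A.reachl
  obtain ⟨T, hT, hTp⟩ : Reach G (insert c (b '' Set.Icc 1 i)) c (b 1) :=
    (A.seq.reach_symm (i := 1) (j := i) hi (by omega)
      fun k h1 h2 => .inr ⟨k, ⟨h1, h2⟩, rfl⟩).cons (by simp) hci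
  obtain ⟨R₀, hR₀, hRp₀⟩ : Reach G (insert c (b '' Set.Icc 2 (l - 2))) c (b m) := by
    refine Reach.cons (b := b j) ?_ (by simp) hcj
    rcases le_total j m with h | h
    · exact A.seq.reach h (by omega) fun k h1 h2 => .inr ⟨k, ⟨by omega, by omega⟩, rfl⟩
    · exact A.seq.reach_symm h (by omega) fun k h1 h2 => .inr ⟨k, ⟨by omega, by omega⟩, rfl⟩
  obtain ⟨r, R, R', hs, hvr, hRv⟩ := hRp₀.exists_first (p := fun y => G.Adj v y)
    ⟨b m, hRp₀.right_mem, hvm⟩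
  have hR : R ⊆ insert c (b '' Set.Icc 2 (l - 2)) := hs.subset_left.trans hR₀
  have hRm : ∀ y ∈ R, y ≠ c → ∃ k, 2 ≤ k ∧ k + 2 ≤ l ∧ y = b k := by
    intro y hy hyc
    rcases hR hy with h | ⟨k, ⟨h1, h2⟩, rfl⟩
    · exact absurd h hyc
    · exact ⟨k, h1, by omega, rfl⟩
  have hTm : ∀ y ∈ T, y ≠ c → ∃ k, 1 ≤ k ∧ k ≤ i ∧ y = b k := by
    intro y hy hyc
    rcases hT hy with h | ⟨k, ⟨h1, h2⟩, rfl⟩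
    · exact absurd h hyc
    · exact ⟨k, h1, by omega, rfl⟩
  have hLm : ∀ y ∈ L, y = c ∨ y = b 0 ∨ y ∈ F := fun y hy => by simpa using hL hy
  have hLm' : ∀ y ∈ L', y = c ∨ y = b l ∨ y ∈ F := fun y hy => by simpa using hL' hy
  have hrc : r ≠ c := by rintro rfl; exact A.nvc hvr
  obtain ⟨kr, hkr, hkr', rfl⟩ := hRm r hs.left.right_mem hrc
  refine no_four_spokes hG hLp hLp' hTp hs.left A.nvc A.v0 A.vl hv1 hvr ?_ ?_ ?_ ?_
    (A.seq.far (by omega) (by omega) (by omega)).2 (A.seq.ne (by omega) (by omega) (by omega))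
    ((A.seq.adj _ (by omega) _ (by omega)).2 (.inr rfl))
    (A.seq.far (by omega) (by omega) (by omega)).2
    (A.seq.far (by omega) (by omega) (by omega)).2
    (A.seq.far (by omega) (by omega) (by omega)).2 ?_ ?_ ?_ ?_
  · intro y hy
    rcases hLm y hy with rfl | rfl | hy
    · exact ⟨A.cv, fun e => absurd e A.nvc⟩
    · exact ⟨A.bv _ (by omega), fun _ => rfl⟩
    · exact ⟨(A.Fv y hy).1, fun e => absurd e (A.Fv y hy).2⟩
  · intro y hy
    rcases hLm' y hy with rfl | rfl | hy
    · exact ⟨A.cv, fun e => absurd e A.nvc⟩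
    · exact ⟨A.bv _ (by omega), fun _ => rfl⟩
    · exact ⟨(A.Fv y hy).1, fun e => absurd e (A.Fv y hy).2⟩
  · intro y hy
    by_cases hyc : y = c
    · subst hyc; exact ⟨A.cv, fun e => absurd e A.nvc⟩
    obtain ⟨k, h1, h2, rfl⟩ := hTm y hy hyc
    refine ⟨A.bv _ (by omega), fun e => ?_⟩
    by_cases hk : k = 1
    · rw [hk]
    · exact absurd e (hno k (by omega) h2)
  · intro y hy
    refine ⟨?_, hRv y hy⟩
    by_cases hyc : y = c
    · subst hyc; exact A.cv
    obtain ⟨k, h1, h2, rfl⟩ := hRm y hy hyc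
    exact A.bv _ (by omega)
  · intro y hy t ht hyc htc
    obtain ⟨k, h1, h2, rfl⟩ := hTm t ht htc
    rcases hLm y hy with rfl | rfl | hy
    · exact absurd rfl hyc
    · refine ⟨A.seq.ne (by omega) (by omega) (by omega), fun e => ⟨rfl, ?_⟩⟩
      rw [A.seq.adj _ (by omega) _ (by omega)] at e
      have : k = 1 := by omega
      rw [this]
    · exact ⟨(A.Fb y hy k (by omega)).symm,
        fun e => absurd e.symm (A.Fb' y hy k (by omega) (by omega))⟩
  · intro y hy t ht hyc htc
    obtain ⟨k, h1, h2, rfl⟩ := hRm t ht htc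
    rcases hLm y hy with rfl | rfl | hy
    · exact absurd rfl hyc
    · exact A.seq.far (by omega) (by omega) (by omega)
    · exact ⟨(A.Fb y hy k (by omega)).symm,
        fun e => absurd e.symm (A.Fb' y hy k (by omega) (by omega))⟩
  · intro y hy t ht hyc htc
    obtain ⟨k, h1, h2, rfl⟩ := hTm t ht htc
    rcases hLm' y hy with rfl | rfl | hy
    · exact absurd rfl hyc
    · exact A.seq.far (by omega) (by omega) (by omega)
    · exact ⟨(A.Fb y hy k (by omega)).symm,
        fun e => absurd e.symm (A.Fb' y hy k (by omega) (by omega))⟩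
  · intro y hy t ht hyc htc
    obtain ⟨k, h1, h2, rfl⟩ := hRm t ht htc
    rcases hLm' y hy with rfl | rfl | hy
    · exact absurd rfl hyc
    · exact A.seq.far (by omega) (by omega) (by omega)
    · exact ⟨(A.Fb y hy k (by omega)).symm,
        fun e => absurd e.symm (A.Fb' y hy k (by omega) (by omega))⟩

/-- On the hole formed by `v`, `b l`, `c` and the segment from `b i` down to the nearest spoke, the
vertex `b (i + 1)` sees exactly `v` and `b i`, which are nonadjacent. -/
theorem hub_next (A : Att G v b l c F) {i r : ℕ} (hcl : G.Adj c (b l)) (hci : G.Adj c (b i))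
    (hmin : ∀ k, 0 < k → k < i → ¬ G.Adj c (b k)) (hr : r ≤ i) (hvr : G.Adj v (b r))
    (hvk : G.Adj v (b (i + 1))) (hil : i + 2 < l) : False := by
  have nci : ¬ G.Adj v (b i) := fun h =>
    A.clique hG A.cv A.nvc (i := l) (j := i) le_rfl (by omega) (by omega) A.vl h hcl hci
  have nck : ¬ G.Adj c (b (i + 1)) := 
    A.clique hG A.cv A.nvc (i := l) (j := i + 1) le_rfl (by omega) (by omega) A.vl hvk hcl
  have nc0 : ¬ G.Adj c (b 0) := 
    A.clique hG A.cv A.nvc (i := l) (j := 0) le_rfl (by omega) (by omega) A.vl A.v0 hcl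
  obtain ⟨x, S, S', hs, hvx, hSv⟩ := (A.seq.iPath hr (by omega)).symm.exists_first
    (p := fun y => G.Adj v y) ⟨b r, ⟨r, ⟨le_rfl, hr⟩, rfl⟩, hvr⟩
  have hSm : ∀ y ∈ S, ∃ k, k ≤ i ∧ y = b k := by
    intro y hy
    obtain ⟨k, ⟨h1, h2⟩, rfl⟩ := hs.subset_left hy
    exact ⟨k, h2, rfl⟩
  have hp : IPath G ({b l, c} ∪ S) (b l) x := by
    refine (IPath.edge hcl.symm).append hs.left hci ?_
    rintro y hy t ht
    obtain ⟨k, h2, rfl⟩ := hSm t ht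
    rcases hy with rfl | rfl
    · exact ⟨A.seq.ne le_rfl (by omega) (by omega),
        fun e => absurd e (A.seq.far le_rfl (by omega) (by omega)).2⟩
    · refine ⟨(A.bc k (by omega)).symm, fun e => ⟨rfl, ?_⟩⟩
      by_contra hne
      have h3 : k ≠ i := fun h => hne (by rw [h])
      by_cases h4 : k = 0
      · rw [h4] at e; exact nc0 e
      · exact hmin k (by omega) (by omega) e
  obtain ⟨kx, hkx, rfl⟩ := hSm x hs.left.right_mem
  have hole := hp.isHole (w := v) (by
      rintro ((h | h) | h)
      · exact A.bv l le_rfl h.symm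
      · exact A.cv h.symm
      · obtain ⟨k, h2, h⟩ := hSm v h
        exact A.bv k (by omega) h.symm) A.vl hvx (by
      rintro y ((rfl | rfl) | h) e
      · exact .inl rfl
      · exact absurd e A.nvc
      · exact .inr (hSv y h e)) (A.seq.ne le_rfl (by omega) (by omega))
      (A.seq.far le_rfl (by omega) (by omega)).2
  have hbk : ∀ y ∈ insert v ({b l, c} ∪ S), b (i + 1) ≠ y ∧ 
      (G.Adj (b (i + 1)) y → y = v ∨ y = b i) := by
    rintro y (rfl | (rfl | rfl) | h)
    · exact ⟨A.bv _ (by omega), fun _ => .inl rfl⟩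
    · exact ⟨A.seq.ne (by omega) le_rfl (by omega),
        fun e => absurd e (A.seq.far (by omega) le_rfl (by omega)).2⟩
    · exact ⟨A.bc _ (by omega), fun e => absurd e.symm nck⟩
    · obtain ⟨k, h2, rfl⟩ := hSm y h
      refine ⟨A.seq.ne (by omega) (by omega) (by omega), fun e => ?_⟩
      rw [A.seq.adj _ (by omega) _ (by omega)] at e
      have : k = i := by omega
      exact .inr (by rw [this])
  have hbi : b i ∈ S := hs.left.left_mem
  have hki : G.Adj (b (i + 1)) (b i) := (A.seq.adj _ (by omega) _ (by omega)).2 (.inr rfl)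
  have o := hole.odd hG (z := b (i + 1)) (x := v) (y := b i) (fun h => (hbk _ h).1 rfl) (by simp)
    (by simp [hbi]) hvk.symm hki (A.bv i (by omega)).symm nci
  have e : G.neighborSet (b (i + 1)) ∩ insert v ({b l, c} ∪ S) = {v, b i} := by
    ext y
    constructor
    · rintro ⟨h1, h2⟩
      exact (hbk y h2).2 h1
    · rintro (rfl | rfl)
      · exact ⟨hvk.symm, by simp⟩
      · exact ⟨hki, by simp [hbi]⟩
  rw [e, Set.ncard_pair (A.bv i (by omega)).symm] at o
  revert o; decide

-- Theta with ends `c` and `v`: through `F` and `b l`, down from `b i` to `b r`, and up from `b j`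
-- to `b s`. The margin at `s` separates `b l` from the last path.
omit [Finite V] in
theorem no_both (A : Att G v b l c F) {i j r s : ℕ} (hij : i + 1 < j)
    (hci : G.Adj c (b i)) (hcj : G.Adj c (b j)) (hr : 2 ≤ r) (hri : r ≤ i) (hvr : G.Adj v (b r))
    (hjs : j ≤ s) (hs : s + 2 ≤ l) (hvs : G.Adj v (b s)) : False := by
  refine theta_free' hG (a := c) (b := v) (X := insert (b l) F) (Y := b '' Set.Icc r i)
    (Z := b '' Set.Icc j s) A.cv (fun e => A.nvc e.symm) ?_ ?_ ?_ ?_ ?_ ?_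
  · exact (A.reachl.mono (by clear * -; intro y; simp; tauto)).snoc (by simp) A.vl.symm
  · exact ((A.seq.reach_symm hri (by omega) fun k h1 h2 => .inr (.inr ⟨k, ⟨h1, h2⟩, rfl⟩)).snoc
      (by simp) hvr.symm).cons (by simp) hci
  · exact ((A.seq.reach hjs (by omega) fun k h1 h2 => .inr (.inr ⟨k, ⟨h1, h2⟩, rfl⟩)).snoc
      (by simp) hvs.symm).cons (by simp) hcj
  · rintro y (rfl | hy)
    · rintro _ ⟨k, ⟨h1, h2⟩, rfl⟩
      exact A.seq.far (by omega) (by omega) (by omega)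
    · exact A.anti_seg (by omega) (by omega) y hy
  · rintro y (rfl | hy)
    · rintro _ ⟨k, ⟨h1, h2⟩, rfl⟩
      exact A.seq.far (by omega) (by omega) (by omega)
    · exact A.anti_seg (by omega) (by omega) y hy
  · exact A.anti_segs hij (by omega)

/-- If `c` is not adjacent to `b l`, these two are the ends of a theta through `F`, along `b` from
`b j`, and through `b r` and `v`. If it is, the middle spoke `b k` serves as the upper one in a
theta with ends `c` and `v`, except when `k = i + 1`, which is `hub_next`. -/
theorem no_lower (A : Att G v b l c F) {i j r k : ℕ} (hik : i < k) (hkj : k < j) (hjl : j < l)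
    (hvk : G.Adj v (b k)) (hci : G.Adj c (b i)) (hcj : G.Adj c (b j))
    (hr : 2 ≤ r) (hri : r ≤ i) (hvr : G.Adj v (b r))
    (hmin : ∀ k, 0 < k → k < i → ¬ G.Adj c (b k))
    (hno : ∀ k, j ≤ k → k < l → ¬ G.Adj v (b k)) : False := by
  by_cases hcl : G.Adj c (b l)
  · by_cases hk : k = i + 1
    · subst hk
      exact A.hub_next hG hcl hci hmin hri hvr hvk (by omega)
    · refine theta_free' hG (a := c) (b := v) (X := insert (b 0) F) (Y := b '' Set.Icc r i)
        (Z := b '' Set.Icc k j) A.cv (fun e => A.nvc e.symm) ?_ ?_ ?_ ?_ ?_ ?_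
      · exact (A.reach0.mono (by clear * -; intro y; simp; tauto)).snoc (by simp) A.v0.symm
      · exact ((A.seq.reach_symm hri (by omega) fun k h1 h2 => .inr (.inr ⟨k, ⟨h1, h2⟩, rfl⟩)).snoc
          (by simp) hvr.symm).cons (by simp) hci
      · exact ((A.seq.reach_symm hkj.le (by omega)
          fun k h1 h2 => .inr (.inr ⟨k, ⟨h1, h2⟩, rfl⟩)).snoc (by simp) hvk.symm).cons (by simp) hcj
      · rintro y (rfl | hy)
        · rintro _ ⟨k, ⟨h1, h2⟩, rfl⟩
          exact A.seq.far (by omega) (by omega) (by omega)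
        · exact A.anti_seg (by omega) (by omega) y hy
      · rintro y (rfl | hy)
        · rintro _ ⟨k, ⟨h1, h2⟩, rfl⟩
          exact A.seq.far (by omega) (by omega) (by omega)
        · exact A.anti_seg (by omega) (by omega) y hy
      · exact A.anti_segs (by omega) (by omega)
  · refine theta_free' hG (a := c) (b := b l) (X := F) (Y := b '' Set.Icc j (l - 1))
      (Z := b '' Set.Icc r i ∪ {v}) (A.bc l le_rfl).symm hcl A.reachl ?_ ?_ ?_ ?_ ?_
    · refine (A.seq.reach hjl.le le_rfl fun k h1 h2 => ?_).cons (by simp) hcj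
      by_cases hkl : k = l
      · subst hkl; simp
      · exact .inr (.inr ⟨k, ⟨h1, by omega⟩, rfl⟩)
    · exact (((A.seq.reach_symm hri (by omega)
        fun k h1 h2 => .inr (.inr (.inl ⟨k, ⟨h1, h2⟩, rfl⟩))).snoc
          (by simp) hvr.symm).cons (by simp) hci).snoc (by simp) A.vl
    · exact A.anti_seg (by omega) (by omega)
    · exact anti_union (A.anti_seg (by omega) (by omega)) A.anti_v
    · exact anti_union (A.anti_segs (by omega) (by omega)).symm
        (A.anti_seg_v (by omega) fun k h1 h2 => hno k h1 (by omega))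

/-- Being adjacent to the spoke `b 0`, the vertex `c` misses `b l`. A theta joins these two through
`F`, along `b` from `b j`, and through `b i, …, b k` and `v`; if `b k` is next to `b j`, the
reversed `hub_next` applies instead. -/
theorem no_none_of_adj (A : Att G v b l c F) {i j k : ℕ} (hi : 0 < i) (hik : i < k) (hkj : k < j)
    (hjl : j < l)
    (hvk : G.Adj v (b k)) (hci : G.Adj c (b i)) (hcj : G.Adj c (b j)) (hc0 : G.Adj c (b 0))
    (hmax : ∀ k, j < k → k < l → ¬ G.Adj c (b k))
    (hno : ∀ k, j ≤ k → k < l → ¬ G.Adj v (b k)) : False := by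
  have hcl : ¬ G.Adj c (b l) := A.clique hG A.cv A.nvc (i := 0) (j := l) (by omega) le_rfl (by omega)
    A.v0 A.vl hc0
  by_cases hk : k + 1 = j
  · refine A.mirror.hub_next hG (i := l - j) (r := 0) (by simpa using hc0) ?_ ?_ (by omega)
      (by simpa using A.vl) ?_ (by omega)
    · have : l - (l - j) = j := by omega
      simpa [this] using hcj
    · intro t h1 h2
      exact hmax (l - t) (by omega) (by omega)
    · have : l - (l - j + 1) = k := by omega
      simpa [this] using hvk
  · refine theta_free' hG (a := c) (b := b l) (X := F) (Y := b '' Set.Icc j (l - 1))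
      (Z := b '' Set.Icc i k ∪ {v}) (A.bc l le_rfl).symm hcl A.reachl ?_ ?_ ?_ ?_ ?_
    · refine (A.seq.reach hjl.le le_rfl fun k h1 h2 => ?_).cons (by simp) hcj
      by_cases hkl : k = l
      · subst hkl; simp
      · exact .inr (.inr ⟨k, ⟨h1, by omega⟩, rfl⟩)
    · exact (((A.seq.reach hik.le (by omega)
        fun k h1 h2 => .inr (.inr (.inl ⟨k, ⟨h1, h2⟩, rfl⟩))).snoc
          (by simp) hvk.symm).cons (by simp) hci).snoc (by simp) A.vl
    · exact A.anti_seg (by omega) (by omega)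
    · exact anti_union (A.anti_seg (by omega) (by omega)) A.anti_v
    · exact anti_union (A.anti_segs (by omega) (by omega)).symm
        (A.anti_seg_v (by omega) fun k h1 h2 => hno k h1 (by omega))

/-- If `c` sees an end of `b`, the preceding lemma applies, after reversal if needed. Otherwise a
path through `F` from `c` to `b l` is followed: if it meets a neighbour of `b 0`, there is a theta
with ends `c` and `b 0`, and if not, one with ends `c` and `b l`. In both, the third path runs to
the other end of `b` and returns by `v`. -/
theorem no_none (A : Att G v b l c F) {i j k : ℕ} (hi : 0 < i) (hik : i < k) (hkj : k < j)
    (hjl : j < l) (hvk : G.Adj v (b k)) (hci : G.Adj c (b i)) (hcj : G.Adj c (b j))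
    (hmin : ∀ k, 0 < k → k < i → ¬ G.Adj c (b k))
    (hmax : ∀ k, j < k → k < l → ¬ G.Adj c (b k))
    (hno' : ∀ k, 0 < k → k ≤ i → ¬ G.Adj v (b k))
    (hno : ∀ k, j ≤ k → k < l → ¬ G.Adj v (b k)) : False := by
  by_cases hc0 : G.Adj c (b 0)
  · exact A.no_none_of_adj hG hi hik hkj hjl hvk hci hcj hc0 hmax hno
  by_cases hcl : G.Adj c (b l)
  · have e1 : l - (l - i) = i := by omega
    have e2 : l - (l - j) = j := by omega
    have e3 : l - (l - k) = k := by omega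
    refine A.mirror.no_none_of_adj hG (i := l - j) (j := l - i) (k := l - k) (by omega) (by omega)
      (by omega) (by omega) (by simpa [e3]) (by simpa [e2]) (by simpa [e1]) (by simpa)
      (fun t h1 h2 => hmin _ (by omega) (by omega)) (fun t h1 h2 => hno' _ (by omega) (by omega))
  obtain ⟨L, hL, hLp⟩ := A.reachl
  have hLm : ∀ y ∈ L, y = c ∨ y = b l ∨ y ∈ F := fun y hy => by simpa using hL hy
  by_cases h0 : ∃ y ∈ L, G.Adj y (b 0)
  · obtain ⟨z, S, S', hs, hz, hSz⟩ := hLp.exists_first (p := fun y => G.Adj y (b 0)) h0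
    have hzF : z ∈ F := by
      rcases hLm z hs.mem with rfl | rfl | h
      · exact absurd hz hc0
      · exact absurd hz (A.seq.far le_rfl (by omega) (by omega)).2
      · exact h
    have hzl : ¬ G.Adj z (b l) := A.clique hG (A.Fv z hzF).1 (A.Fv z hzF).2 (i := 0) (j := l)
      (by omega) le_rfl (by omega) A.v0 A.vl hz
    have hzbl : b l ≠ z := A.Fb z hzF l le_rfl
    have hbl : b l ∉ S := fun h => hzbl (hs.eq_of_mem h hs.right.right_mem)
    have hSF : ∀ y ∈ S, y ≠ c → y ∈ F := by
      intro y hy hyc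
      rcases hLm y (hs.subset_left hy) with rfl | rfl | h
      · exact absurd rfl hyc
      · exact absurd hy hbl
      · exact h
    have hSF' : S \ {c} ⊆ F := fun y hy => hSF y hy.1 hy.2
    refine theta_free' hG (a := c) (b := b 0) (X := S \ {c}) (Y := b '' Set.Icc 1 i)
      (Z := b '' Set.Icc j l ∪ {v}) (A.bc 0 (by omega)).symm hc0 ?_ ?_ ?_ ?_ ?_ ?_
    · exact (hs.left.reach' (by clear * -; intro; simp; tauto)).snoc (by simp) hz
    · refine (A.seq.reach_symm (Nat.zero_le i) (by omega) fun k h1 h2 => ?_).cons (by simp) hci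
      by_cases hk0 : k = 0
      · subst hk0; simp
      · exact .inr (.inr ⟨k, ⟨by omega, by omega⟩, rfl⟩)
    · exact (((A.seq.reach hjl.le le_rfl
        fun k h1 h2 => .inr (.inr (.inl ⟨k, ⟨h1, h2⟩, rfl⟩))).snoc
          (by simp) A.vl.symm).cons (by simp) hcj).snoc (by simp) A.v0
    · exact (A.anti_seg (by omega) (by omega)).mono hSF' subset_rfl
    · refine anti_union ?_ (A.anti_v.mono hSF' subset_rfl)
      rintro y ⟨hy, hyc⟩ _ ⟨k, ⟨h1, h2⟩, rfl⟩
      by_cases hkl : k = l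
      · subst hkl
        refine ⟨fun h => hbl (h ▸ hy), fun e => ?_⟩
        by_cases hyz : y = z
        · exact hzl (hyz ▸ e)
        · exact (hs.cross y hy _ hs.right.right_mem hyz hzbl).2 e
      · exact A.anti_seg (i := j) (j := l - 1) (by omega) (by omega) y (hSF y hy hyc) _
          ⟨k, ⟨h1, by omega⟩, rfl⟩
    · exact anti_union (A.anti_segs (by omega) (by omega))
        (A.anti_seg_v (by omega) fun k h1 h2 => hno' k h1 (by omega))
  · push Not at h0
    have hLF : L \ {c, b l} ⊆ F := by
      rintro y ⟨hy, hyc⟩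
      rcases hLm y hy with rfl | rfl | h
      · simp at hyc
      · simp at hyc
      · exact h
    have hanti : Anti G (L \ {c, b l}) (b '' Set.Icc 0 i) := by
      rintro y hy _ ⟨k, ⟨h1, h2⟩, rfl⟩
      by_cases hk0 : k = 0
      · subst hk0; exact ⟨(A.Fb y (hLF hy) _ (by omega)).symm, h0 y hy.1⟩
      · exact A.anti_seg (i := 1) (j := l - 1) (by omega) (by omega) y (hLF hy) _
          ⟨k, ⟨by omega, by omega⟩, rfl⟩
    refine theta_free' hG (a := c) (b := b l) (X := L \ {c, b l}) (Y := b '' Set.Icc j (l - 1))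
      (Z := b '' Set.Icc 0 i ∪ {v}) (A.bc l le_rfl).symm hcl ?_ ?_ ?_ ?_ ?_ ?_
    · exact hLp.reach' (by clear * -; intro; simp; tauto)
    · refine (A.seq.reach hjl.le le_rfl fun k h1 h2 => ?_).cons (by simp) hcj
      by_cases hkl : k = l
      · subst hkl; simp
      · exact .inr (.inr ⟨k, ⟨h1, by omega⟩, rfl⟩)
    · exact (((A.seq.reach_symm (Nat.zero_le i) (by omega)
        fun k h1 h2 => .inr (.inr (.inl ⟨k, ⟨h1, h2⟩, rfl⟩))).snoc
          (by simp) A.v0.symm).cons (by simp) hci).snoc (by simp) A.vl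
    · exact (A.anti_seg (by omega) (by omega)).mono hLF subset_rfl
    · exact anti_union hanti (A.anti_v.mono hLF subset_rfl)
    · exact anti_union (A.anti_segs (by omega) (by omega)).symm
        (A.anti_seg_v (by omega) fun k h1 h2 => hno k h1 (by omega))

end Att

end

section

open SimpleGraph

variable {V : Type*} {G : SimpleGraph V}

theorem ncard_mirror (P : ℕ → Prop) {i l : ℕ} (hi : i ≤ l) :
    {k | (i ≤ k ∧ k ≤ l) ∧ P (l - k)}.ncard = {k | k ≤ l - i ∧ P k}.ncard := by
  rw [← Set.InjOn.ncard_image (s := {k | k ≤ l - i ∧ P k}) (f := fun k => l - k)]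
  · congr 1
    ext k
    simp only [Set.mem_ofPred_eq, Set.mem_image]
    constructor
    · rintro ⟨⟨h1, h2⟩, h⟩
      exact ⟨l - k, ⟨by omega, h⟩, by omega⟩
    · rintro ⟨k, ⟨h1, h⟩, rfl⟩
      have : l - (l - k) = k := by omega
      exact ⟨⟨by omega, by omega⟩, by rwa [this]⟩
  · rintro j ⟨hj, -⟩ k ⟨hk, -⟩ e
    simp only at e
    omega

namespace Att

variable {v c : V} {b : ℕ → V} {l : ℕ} {F : Set V}
variable [Finite V]
variable (hG : IsC4FreeOddSignable G)

include hG

/-- This is the exceptional alternative of `odd_or` at the lower end. By `near_spoke`, the inner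
neighbours of `c` are among `b 1` and `b (l - 1)`. Here `b 1` alone contradicts the total parity or
the spoke `b m`, and both together give a theta with ends `c` and `b l`. -/
theorem adj_case (A : Att G v b l c F) {m : ℕ} (hm : 2 ≤ m) (hml : m + 2 ≤ l)
    (hvm : G.Adj v (b m)) (hodd : Odd {k | k ≤ l ∧ G.Adj v (b k)}.ncard) {i j : ℕ}
    (hi : 0 < i) (hij : i ≤ j) (hjl : j < l) (hci : G.Adj c (b i)) (hcj : G.Adj c (b j))
    (hmax : ∀ k, j < k → k < l → ¬ G.Adj c (b k))
    (hv1 : G.Adj v (b 1)) (hno : ∀ k, 2 ≤ k → k ≤ i → ¬ G.Adj v (b k)) : False := by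
  by_cases ht : ∃ t, 2 ≤ t ∧ t + 2 ≤ l ∧ G.Adj c (b t)
  · obtain ⟨t, h1, h2, h3⟩ := ht
    exact A.near_spoke hG hv1 hi hci hno h1 h2 h3 hm hml hvm
  push Not at ht
  have hmi : i < m := by
    by_contra h
    exact hno m hm (by omega) hvm
  have hi1 : i = 1 := by
    by_contra h
    exact ht i (by omega) (by omega) hci
  subst hi1
  by_cases hj1 : j = 1
  · subst hj1
    rcases A.odd_or hG hi hjl hcj hmax with h | ⟨-, h⟩
    · have e : {k | k ≤ l ∧ G.Adj v (b k)} = insert 0 {k | (1 ≤ k ∧ k ≤ l) ∧ G.Adj v (b k)} := by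
        ext k
        simp only [Set.mem_ofPred_eq, Set.mem_insert_iff]
        constructor
        · rintro ⟨h1, h2⟩
          by_cases hk : k = 0
          · exact .inl hk
          · exact .inr ⟨⟨by omega, h1⟩, h2⟩
        · rintro (rfl | ⟨⟨h1, h2⟩, h3⟩)
          · exact ⟨by omega, A.v0⟩
          · exact ⟨h2, h3⟩
      rw [e, Set.ncard_insert_of_notMem (by simp)
        ((Set.finite_le_nat l).subset fun k hk => hk.1.2)] at hodd
      rw [Nat.odd_iff] at h hodd
      omega
    · exact h m (by omega) (by omega) hvm
  have hjl1 : j = l - 1 := by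
    by_contra h
    exact ht j (by omega) (by omega) hcj
  subst hjl1
  have hvl1 : ¬ G.Adj v (b (l - 1)) := fun h =>
    A.clique hG A.cv A.nvc (i := 1) (j := l - 1) (by omega) (by omega) (by omega) hv1 h hci hcj
  have hcl : ¬ G.Adj c (b l) := A.clique hG A.cv A.nvc (i := 1) (j := l) (by omega) le_rfl
    (by omega) hv1 A.vl hci
  refine theta_free' hG (a := c) (b := b l) (X := F) (Y := b '' Set.Icc (l - 1) (l - 1))
      (Z := b '' Set.Icc 1 1 ∪ {v}) (A.bc l le_rfl).symm hcl A.reachl ?_ ?_ ?_ ?_ ?_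
  · refine (A.seq.reach (i := l - 1) (by omega) le_rfl fun k h1 h2 => ?_).cons (by simp) hcj
    by_cases hkl : k = l
    · subst hkl; simp
    · exact .inr (.inr ⟨k, ⟨h1, by omega⟩, rfl⟩)
  · exact (((Reach.refl (by simp)).cons (by simp) hv1.symm).cons (by simp) hci).snoc (by simp) A.vl
  · exact A.anti_seg (by omega) (by omega)
  · exact anti_union (A.anti_seg (by omega) (by omega)) A.anti_v
  · refine anti_union (A.anti_segs (by omega) (by omega)).symm
      (A.anti_seg_v (by omega) fun k h1 h2 => ?_)
    have : k = l - 1 := by omega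
    rwa [this]

/-- Let `b i` and `b j` be the first and last inner neighbours of `c`. Outside the exceptional case
both end segments carry an odd number of spokes. As the total is odd, some spoke lies strictly
between `b i` and `b j`; and, again by parity, an end segment with a spoke besides the end of `b`
has one at distance at least two from that end. The four combinations are `no_both`, `no_lower` in
both directions, and `no_none`. -/
theorem contra (A : Att G v b l c F) {m : ℕ} (hm : 2 ≤ m) (hml : m + 2 ≤ l)
    (hvm : G.Adj v (b m)) (hodd : Odd {k | k ≤ l ∧ G.Adj v (b k)}.ncard) {t : ℕ}
    (ht : 0 < t) (htl : t < l) (hct : G.Adj c (b t))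
    (hpar : G.Adj v (b t) → Even {k | k ≤ t ∧ G.Adj v (b k)}.ncard) : False := by
  classical
  have fin : ∀ {P : ℕ → Prop}, {k | k ≤ l ∧ P k}.Finite :=
    (Set.finite_le_nat l).subset fun k hk => hk.1
  obtain ⟨i, ⟨hi, hil, hci⟩, hmin⟩ : ∃ i, (0 < i ∧ i < l ∧ G.Adj c (b i)) ∧
      ∀ k, k < i → ¬ (0 < k ∧ k < l ∧ G.Adj c (b k)) :=
    have h : ∃ i, 0 < i ∧ i < l ∧ G.Adj c (b i) := ⟨t, ht, htl, hct⟩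
    ⟨Nat.find h, Nat.find_spec h, fun k => Nat.find_min h⟩
  -- The last inner neighbour is obtained as the first one of the reversed sequence.
  obtain ⟨j', ⟨hj', hjl', hcj'⟩, hmax'⟩ : ∃ i, (0 < i ∧ i < l ∧ G.Adj c (b (l - i))) ∧
      ∀ k, k < i → ¬ (0 < k ∧ k < l ∧ G.Adj c (b (l - k))) :=
    have h : ∃ i, 0 < i ∧ i < l ∧ G.Adj c (b (l - i)) :=
      ⟨l - t, by omega, by omega, by rwa [show l - (l - t) = t by omega]⟩
    ⟨Nat.find h, Nat.find_spec h, fun k => Nat.find_min h⟩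
  obtain ⟨j, rfl⟩ : ∃ j, j' = l - j := ⟨l - j', by omega⟩
  have ej : l - (l - j) = j := by omega
  have ei : l - (l - i) = i := by omega
  rw [ej] at hcj'
  have hjl : j < l := by omega
  have hmin : ∀ k, 0 < k → k < i → ¬ G.Adj c (b k) := fun k h1 h2 h3 =>
    hmin k h2 ⟨h1, by omega, h3⟩
  have hmax : ∀ k, j < k → k < l → ¬ G.Adj c (b k) := fun k h1 h2 h3 =>
    hmax' (l - k) (by omega) ⟨by omega, by omega, by rwa [show l - (l - k) = k by omega]⟩
  have hit : i ≤ t := by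
    by_contra h
    exact hmin t ht (by omega) hct
  have htj : t ≤ j := by
    by_contra h
    exact hmax t (by omega) htl hct
  have hodd' : Odd {k | k ≤ l ∧ G.Adj v (b (l - k))}.ncard := by
    have := ncard_mirror (fun k => G.Adj v (b k)) (Nat.zero_le l)
    simp only [Nat.zero_le, true_and, Nat.sub_zero] at this
    rwa [this]
  have hmin' : ∀ k, l - i < k → k < l → ¬ G.Adj c (b (l - k)) := fun k h1 h2 =>
    hmin _ (by omega) (by omega)
  have case1 := A.odd_or hG (by omega) hjl hcj' hmax
  have case2 := A.mirror.odd_or hG (i := l - i) (by omega) (by omega) (by rwa [ei]) hmin'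
  rw [ncard_mirror (fun k => G.Adj v (b k)) (by omega : l - i ≤ l), ei] at case2
  rcases case2 with o2 | ⟨h1, h2⟩
  swap
  · refine A.adj_case hG hm hml hvm hodd hi (by omega) hjl hci hcj' hmax ?_ ?_
    · rwa [show l - (l - 1) = 1 by omega] at h1
    · intro k hk hki
      have := h2 (l - k) (by omega) (by omega)
      rwa [show l - (l - k) = k by omega] at this
  rcases case1 with o1 | ⟨h1, h2⟩
  swap
  · refine A.mirror.adj_case hG (m := l - m) (by omega) (by omega)
      (by rwa [show l - (l - m) = m by omega]) hodd' (i := l - j) (j := l - i) (by omega) (by omega)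
      (by omega) (by rwa [ej]) (by rwa [ei]) hmin' h1 ?_
    intro k hk hki
    exact h2 (l - k) (by omega) (by omega)
  obtain ⟨k, hik, hkj, hvk⟩ : ∃ k, i < k ∧ k < j ∧ G.Adj v (b k) := by
    by_contra hno
    push Not at hno
    -- If the two end segments share a spoke, it is `b t`, and its even rank contradicts `o2`.
    -- Otherwise the spokes fall into two disjoint odd classes, against the odd total.
    by_cases hvt : i = j ∧ G.Adj v (b t)
    · obtain rfl : i = t := by omega
      have := hpar hvt.2
      exact (Nat.not_odd_iff_even.2 this) o2
    · have e : {k | k ≤ l ∧ G.Adj v (b k)} =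
          {k | k ≤ i ∧ G.Adj v (b k)} ∪ {k | (j ≤ k ∧ k ≤ l) ∧ G.Adj v (b k)} := by
        ext k
        simp only [Set.mem_ofPred_eq, Set.mem_union]
        have := hno k
        constructor
        · rintro ⟨h1, h2⟩
          by_cases hki : k ≤ i
          · exact .inl ⟨hki, h2⟩
          · refine .inr ⟨⟨?_, h1⟩, h2⟩
            by_contra hkj
            exact hno k (by omega) (by omega) h2
        · rintro (⟨h1, h2⟩ | ⟨⟨_, h1⟩, h2⟩)
          · exact ⟨by omega, h2⟩
          · exact ⟨h1, h2⟩
      rw [e, Set.ncard_union_eq ?_ (fin.subset fun k hk => ⟨by have := hk.1; omega, hk.2⟩)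
        (fin.subset fun k hk => ⟨hk.1.2, hk.2⟩)] at hodd
      · exact (Nat.not_odd_iff_even.2 (o2.add_odd o1)) hodd
      · rw [Set.disjoint_left]
        rintro k ⟨h1, h2⟩ ⟨⟨h3, _⟩, _⟩
        apply hvt
        obtain rfl : i = j := by omega
        obtain rfl : k = i := by omega
        obtain rfl : k = t := by omega
        exact ⟨rfl, h2⟩
  have up : (∃ s, j ≤ s ∧ s + 2 ≤ l ∧ G.Adj v (b s)) ∨ ∀ k, j ≤ k → k < l → ¬ G.Adj v (b k) := by
    by_contra! hc
    obtain ⟨hc, q, hjq, hql, hvq⟩ := hc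
    have hq : q = l - 1 := by
      by_contra h
      exact hc q hjq (by omega) hvq
    have e : {k | (j ≤ k ∧ k ≤ l) ∧ G.Adj v (b k)} = {q, l} := by
      ext k
      simp only [Set.mem_ofPred_eq, Set.mem_insert_iff, Set.mem_singleton_iff]
      constructor
      · rintro ⟨⟨h1, h2⟩, h3⟩
        by_contra hne
        exact hc k h1 (by omega) h3
      · rintro (rfl | rfl)
        · exact ⟨⟨hjq, hql.le⟩, hvq⟩
        · exact ⟨⟨by omega, le_rfl⟩, A.vl⟩
    rw [e, Set.ncard_pair (by omega)] at o1
    revert o1; decide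
  have down : (∃ r, 2 ≤ r ∧ r ≤ i ∧ G.Adj v (b r)) ∨ ∀ k, 0 < k → k ≤ i → ¬ G.Adj v (b k) := by
    by_contra! hc
    obtain ⟨hc, q, hjq, hql, hvq⟩ := hc
    have hq : q = 1 := by
      by_contra h
      exact hc q (by omega) (by omega) hvq
    have e : {k | k ≤ i ∧ G.Adj v (b k)} = {0, q} := by
      ext k
      simp only [Set.mem_ofPred_eq, Set.mem_insert_iff, Set.mem_singleton_iff]
      constructor
      · rintro ⟨h1, h3⟩
        by_contra hne
        exact hc k (by omega) h1 h3
      · rintro (rfl | rfl)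
        · exact ⟨by omega, A.v0⟩
        · exact ⟨hql, hvq⟩
    rw [e, Set.ncard_pair (by omega)] at o2
    revert o2; decide
  rcases up with ⟨s, hs, hsl, hvs⟩ | up <;> rcases down with ⟨r, hr, hri, hvr⟩ | down
  · exact A.no_both hG (by omega) hci hcj' hr hri hvr hs hsl hvs
  · exact A.mirror.no_lower hG (i := l - j) (j := l - i) (r := l - s) (k := l - k) (by omega)
      (by omega) (by omega) (by rwa [show l - (l - k) = k by omega]) (by rwa [ej]) (by rwa [ei])
      (by omega) (by omega) (by rwa [show l - (l - s) = s by omega])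
      (fun q h1 h2 => hmax _ (by omega) (by omega)) fun q h1 h2 => down _ (by omega) (by omega)
  · exact A.no_lower hG hik hkj hjl hvk hci hcj' hr hri hvr hmin up
  · exact A.no_none hG hi hik hkj hjl hvk hci hcj' hmin hmax down up

end Att

end

/-! ### Spoke ranks, rings, and paths leading to a target. -/

section

open SimpleGraph

variable {V : Type*} {G : SimpleGraph V}

/-- The number of neighbours of `v` among `b 0, …, b j`. -/
noncomputable def cnt (G : SimpleGraph V) (v : V) (b : ℕ → V) (j : ℕ) : ℕ :=
  {k | k ≤ j ∧ G.Adj v (b k)}.ncard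

theorem cnt_zero {v : V} {b : ℕ → V} (h : G.Adj v (b 0)) : cnt G v b 0 = 1 := by
  rw [cnt, Set.ncard_eq_one]
  refine ⟨0, ?_⟩
  ext k
  simp only [Set.mem_ofPred_eq, Set.mem_singleton_iff]
  constructor
  · rintro ⟨h, -⟩; omega
  · rintro rfl; exact ⟨le_rfl, h⟩

theorem cnt_succ {v : V} {b : ℕ → V} {j : ℕ} (h : G.Adj v (b (j + 1))) :
    cnt G v b (j + 1) = cnt G v b j + 1 := by
  rw [cnt, cnt, ← Set.ncard_insert_of_notMem (a := j + 1) (by simp)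
    ((Set.finite_le_nat j).subset fun k hk => hk.1)]
  congr 1
  ext k
  simp only [Set.mem_ofPred_eq, Set.mem_insert_iff]
  constructor
  · rintro ⟨h1, h2⟩
    by_cases hk : k = j + 1
    · exact .inl hk
    · exact .inr ⟨by omega, h2⟩
  · rintro (rfl | ⟨h1, h2⟩)
    · exact ⟨le_rfl, h⟩
    · exact ⟨by omega, h2⟩

/-- The spoke `b i` is counted twice on the left. -/
theorem cnt_interval {v : V} {b : ℕ → V} {i j : ℕ} (hij : i ≤ j) (h : G.Adj v (b i)) :
    {k | (i ≤ k ∧ k ≤ j) ∧ G.Adj v (b k)}.ncard + cnt G v b i = cnt G v b j + 1 := by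
  rw [cnt, cnt, ← Set.ncard_union_add_ncard_inter _ _
    ((Set.finite_le_nat j).subset fun k hk => hk.1.2)
    ((Set.finite_le_nat i).subset fun k hk => hk.1)]
  congr 1
  · congr 1
    ext k
    simp only [Set.mem_ofPred_eq, Set.mem_union]
    constructor
    · rintro (⟨⟨_, h1⟩, h2⟩ | ⟨h1, h2⟩)
      · exact ⟨h1, h2⟩
      · exact ⟨by omega, h2⟩
    · rintro ⟨h1, h2⟩
      by_cases hk : i ≤ k
      · exact .inl ⟨⟨hk, h1⟩, h2⟩
      · exact .inr ⟨by omega, h2⟩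
  · rw [Set.ncard_eq_one]
    refine ⟨i, ?_⟩
    ext k
    simp only [Set.mem_ofPred_eq, Set.mem_inter_iff, Set.mem_singleton_iff]
    constructor
    · rintro ⟨⟨⟨h1, _⟩, _⟩, h2, _⟩; omega
    · rintro rfl; exact ⟨⟨⟨le_rfl, hij⟩, h⟩, le_rfl, h⟩

theorem cnt_shift {v : V} {b : ℕ → V} (i j : ℕ) :
    {k | (i ≤ k ∧ k ≤ i + j) ∧ G.Adj v (b k)}.ncard = cnt G v (fun k => b (i + k)) j := by
  rw [cnt, ← Set.InjOn.ncard_image (s := {k | k ≤ j ∧ G.Adj v (b (i + k))}) (f := fun k => i + k)]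
  · congr 1
    ext k
    simp only [Set.mem_ofPred_eq, Set.mem_image]
    constructor
    · rintro ⟨⟨h1, h2⟩, h⟩
      exact ⟨k - i, ⟨by omega, by rwa [show i + (k - i) = k by omega]⟩, by omega⟩
    · rintro ⟨k, ⟨h1, h⟩, rfl⟩
      exact ⟨⟨by omega, by omega⟩, h⟩
  · intro x _ y _ e
    simpa using e

theorem cnt_mirror {v : V} {b : ℕ → V} {l j : ℕ} (hj : j ≤ l) (h : G.Adj v (b (l - j))) :
    cnt G v (fun k => b (l - k)) j + cnt G v b (l - j) = cnt G v b l + 1 := by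
  rw [← cnt_interval (by omega : l - j ≤ l) h]
  congr 1
  have e : (fun k => G.Adj v (b k)) = fun k => G.Adj v (b k) := rfl
  have := ncard_mirror (fun k => G.Adj v (b (l - k))) (by omega : l - j ≤ l)
  rw [show l - (l - j) = j by omega] at this
  rw [cnt, ← this]
  congr 1
  ext k
  simp only [Set.mem_ofPred_eq]
  refine and_congr_right fun h => ?_
  rw [show l - (l - k) = k by omega]

/-- Index of an inner vertex of `b` that is not a spoke or is a spoke of even rank. -/
def Tgt (G : SimpleGraph V) (v : V) (b : ℕ → V) (l j : ℕ) : Prop :=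
  0 < j ∧ j < l ∧ (G.Adj v (b j) → Even (cnt G v b j))

/-- A hole consisting of a path `b` whose ends are spokes and a path `Q` without spokes. -/
structure HubRing (G : SimpleGraph V) (v : V) (b : ℕ → V) (l : ℕ) (Q : Set V) (q₁ q₂ : V) :
    Prop where
  seq : ISeq G b l
  bv : ∀ i ≤ l, b i ≠ v
  v0 : G.Adj v (b 0)
  vl : G.Adj v (b l)
  path : IPath G Q q₁ q₂
  Qv : ∀ y ∈ Q, y ≠ v ∧ ¬ G.Adj v y
  Qb : ∀ y ∈ Q, ∀ i ≤ l, b i ≠ y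
  Qadj : ∀ y ∈ Q, ∀ i ≤ l, G.Adj (b i) y → i = 0 ∧ y = q₂ ∨ i = l ∧ y = q₁
  a0 : G.Adj (b 0) q₂
  al : G.Adj (b l) q₁
  two : 4 ≤ l

theorem HubRing.mirror {v q₁ q₂ : V} {b : ℕ → V} {l : ℕ} {Q : Set V} (R : HubRing G v b l Q q₁ q₂) :
    HubRing G v (fun i => b (l - i)) l Q q₂ q₁ where
  seq := R.seq.mirror
  bv i hi := R.bv _ (by omega)
  v0 := R.vl
  vl := by simpa using R.v0
  path := R.path.symm
  Qv := R.Qv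
  Qb y hy i hi := R.Qb y hy _ (by omega)
  Qadj y hy i hi e := by
    rcases R.Qadj y hy _ (by omega) e with ⟨h1, h2⟩ | ⟨h1, h2⟩
    · exact .inr ⟨by omega, h2⟩
    · exact .inl ⟨by omega, h2⟩
  a0 := R.al
  al := by simpa using R.a0
  two := R.two

theorem HubRing.isHole {v q₁ q₂ : V} {b : ℕ → V} {l : ℕ} {Q : Set V} (R : HubRing G v b l Q q₁ q₂) :
    IsHole G (b '' Set.Icc 0 l ∪ Q) := by
  have hp := R.seq.iPath (Nat.zero_le l) le_rfl
  have h4 := R.two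
  by_cases h : q₁ = q₂
  · have hQ := R.path
    subst h
    rw [hQ.eq_singleton, Set.union_singleton]
    refine hp.isHole ?_ R.a0.symm R.al.symm ?_ (R.seq.ne (by omega) le_rfl (by omega))
      (R.seq.far (by omega) le_rfl (by omega)).2
    · rintro ⟨k, ⟨_, h⟩, e⟩; exact R.Qb q₁ hQ.left_mem k h e
    · rintro _ ⟨k, ⟨_, h⟩, rfl⟩ e
      rcases R.Qadj q₁ hQ.left_mem k h e.symm with ⟨rfl, -⟩ | ⟨rfl, -⟩
      · exact .inl rfl
      · exact .inr rfl
  · refine hp.isHole_union R.path.symm R.a0 R.al (R.seq.ne (by omega) le_rfl (by omega))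
      (Ne.symm h) ?_
    rintro _ ⟨k, ⟨_, hk⟩, rfl⟩ y hy
    refine ⟨R.Qb y hy k hk, fun e => ?_⟩
    rcases R.Qadj y hy k hk e with ⟨rfl, h⟩ | ⟨rfl, h⟩
    · exact .inl ⟨rfl, h⟩
    · exact .inr ⟨rfl, h⟩

theorem HubRing.odd [Finite V] (hG : IsC4FreeOddSignable G) {v q₁ q₂ : V} {b : ℕ → V} {l : ℕ}
    {Q : Set V} (R : HubRing G v b l Q q₁ q₂) : Odd (cnt G v b l) := by
  have h4 := R.two
  have o := R.isHole.odd hG (z := v) (x := b 0) (y := b l) ?_ (.inl ⟨0, by simp, rfl⟩)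
    (.inl ⟨l, by simp, rfl⟩) R.v0 R.vl (R.seq.far (by omega) le_rfl (by omega)).1
    (R.seq.far (by omega) le_rfl (by omega)).2
  · have e : G.neighborSet v ∩ (b '' Set.Icc 0 l ∪ Q) = b '' {k | k ≤ l ∧ G.Adj v (b k)} := by
      ext x
      constructor
      · rintro ⟨h, ⟨k, ⟨_, hk⟩, rfl⟩ | hx⟩
        · exact ⟨k, ⟨hk, h⟩, rfl⟩
        · exact absurd h (R.Qv x hx).2
      · rintro ⟨k, ⟨hk, h⟩, rfl⟩
        exact ⟨h, .inl ⟨k, ⟨by omega, hk⟩, rfl⟩⟩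
    rw [e] at o
    rwa [Set.InjOn.ncard_image] at o
    rintro j ⟨hj, -⟩ k ⟨hk, -⟩ e
    exact R.seq.inj j hj k hk e
  · rintro (⟨k, ⟨_, hk⟩, e⟩ | h)
    · exact R.bv k hk e
    · exact (R.Qv v h).1 rfl

/-- A ring with a path `p` joining the part `Q` to the targets of `b`. -/
structure Conf (G : SimpleGraph V) (v : V) (b : ℕ → V) (l : ℕ) (Q : Set V) (q₁ q₂ : V)
    (p : ℕ → V) (n : ℕ) : Prop extends HubRing G v b l Q q₁ q₂ where
  hodd : Odd (cnt G v b l)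
  pseq : ISeq G p n
  pv : ∀ i ≤ n, p i ≠ v ∧ ¬ G.Adj v (p i)
  pb : ∀ i ≤ n, ∀ j ≤ l, b j ≠ p i
  pQ : ∀ i ≤ n, ∀ y ∈ Q, p i ≠ y ∧ (G.Adj (p i) y → i = 0)
  p0 : ∃ y ∈ Q, G.Adj (p 0) y
  ntgt : ∀ i < n, ∀ j, Tgt G v b l j → ¬ G.Adj (p i) (b j)

/-- With an odd total, the ranks of a spoke counted from the two ends have the same parity, so
targets survive the reversal of `b`. -/
theorem Tgt.mirror {v : V} {b : ℕ → V} {l j : ℕ} (hodd : Odd (cnt G v b l))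
    (h : Tgt G v (fun i => b (l - i)) l j) : Tgt G v b l (l - j) := by
  obtain ⟨h1, h2, h3⟩ := h
  refine ⟨by omega, by omega, fun hv => ?_⟩
  have h4 := h3 hv
  have h5 := cnt_mirror (by omega : j ≤ l) hv
  rw [Nat.even_iff] at *
  rw [Nat.odd_iff] at *
  omega

namespace Conf

variable {v q₁ q₂ : V} {b p : ℕ → V} {l n : ℕ} {Q : Set V}

theorem mirror (C : Conf G v b l Q q₁ q₂ p n) : Conf G v (fun i => b (l - i)) l Q q₂ q₁ p n where
  toHubRing := C.toHubRing.mirror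
  hodd := by
    have h : G.Adj v (b (l - l)) := by simpa using C.v0
    have := cnt_mirror le_rfl h
    have h0 := cnt_zero C.v0
    have h1 := C.hodd
    rw [Nat.sub_self, h0] at this
    simp only [Nat.add_right_cancel_iff] at this
    rwa [this]
  pseq := C.pseq
  pv := C.pv
  pb i hi j hj := C.pb i hi _ (by omega)
  pQ := C.pQ
  p0 := C.p0
  ntgt i hi j hj := C.ntgt i hi _ (hj.mirror C.hodd)

/-- The inner vertices of the path `p` are adjacent to spokes of odd rank only. -/
theorem odd_of_adj (C : Conf G v b l Q q₁ q₂ p n) {i j : ℕ} (hi : i < n) (hj : j ≤ l)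
    (h : G.Adj (p i) (b j)) : G.Adj v (b j) ∧ Odd (cnt G v b j) := by
  by_cases h0 : j = 0
  · subst h0
    exact ⟨C.v0, by rw [cnt_zero C.v0]; decide⟩
  by_cases hl : j = l
  · subst hl
    exact ⟨C.vl, C.hodd⟩
  by_contra hno
  refine C.ntgt i hi j ⟨by omega, by omega, fun hv => ?_⟩ h
  by_contra ho
  exact hno ⟨hv, Nat.not_even_iff_odd.1 ho⟩

/-- Spokes that are neighbours on `b` have consecutive ranks, so equal parity forces a gap. -/
theorem far_of_odd {i j : ℕ} (hij : i ≠ j)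
    (hi : G.Adj v (b i) ∧ Odd (cnt G v b i)) (hj : G.Adj v (b j) ∧ Odd (cnt G v b j)) :
    i + 1 < j ∨ j + 1 < i := by
  by_contra hno
  rcases (by omega : i + 1 = j ∨ j + 1 = i) with rfl | rfl
  · have h1 := hi.2; have h2 := hj.2
    rw [cnt_succ hj.1] at h2
    rw [Nat.odd_iff] at h1 h2
    omega
  · have h1 := hi.2; have h2 := hj.2
    rw [cnt_succ hi.1] at h1
    rw [Nat.odd_iff] at h1 h2
    omega

variable (hG : IsC4FreeOddSignable G)

include hG

/-- A vertex not adjacent to `v` is adjacent to at most one spoke of odd rank. -/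
theorem clique (C : Conf G v b l Q q₁ q₂ p n) {y : V} (hyv : y ≠ v) (hvy : ¬ G.Adj v y) {i j : ℕ}
    (hi : i ≤ l) (hj : j ≤ l) (hij : i + 1 < j ∨ j + 1 < i) (vi : G.Adj v (b i))
    (vj : G.Adj v (b j)) (ci : G.Adj y (b i)) : ¬ G.Adj y (b j) := fun cj =>
  (C.seq.far hi hj hij).2 (square_free hG vi ci.symm cj vj.symm hyv.symm hvy (C.seq.far hi hj hij).1)

/-- Two neighbours of `p i` on `b` would be spokes of odd rank, hence nonadjacent, while the absence
of squares makes them adjacent. -/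
theorem clique_p (C : Conf G v b l Q q₁ q₂ p n) {i j k : ℕ} (hi : i < n) (hj : j ≤ l) (hk : k ≤ l)
    (h : G.Adj (p i) (b j)) (h' : G.Adj (p i) (b k)) : j = k := by
  by_contra hjk
  have h1 := C.odd_of_adj hi hj h
  have h2 := C.odd_of_adj hi hk h'
  exact C.clique hG (C.pv i hi.le).1 (C.pv i hi.le).2 hj hk (far_of_odd hjk h1 h2) h1.1 h2.1 h h'

variable [Finite V]

/-- No path away from `Q` joins two spokes of odd rank. -/
theorem no_chord (C : Conf G v b l Q q₁ q₂ p n) {X : Set V} {e f : V} (hX : IPath G X e f)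
    (hef : e ≠ f) {s t : ℕ} (hst : s < t) (ht : t ≤ l) (hs1 : G.Adj v (b s) ∧ Odd (cnt G v b s))
    (ht1 : G.Adj v (b t) ∧ Odd (cnt G v b t)) (hes : G.Adj e (b s)) (hft : G.Adj f (b t))
    (hXv : ∀ y ∈ X, y ≠ v ∧ ¬ G.Adj v y) (hXQ : Anti G X Q)
    (hXb : ∀ y ∈ X, ∀ k ≤ l, b k ≠ y ∧ (G.Adj y (b k) → k = s ∧ y = e ∨ k = t ∧ y = f)) :
    False := by
  have h4 := C.two
  have far := far_of_odd hst.ne hs1 ht1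
  have hT : IPath G (b '' Set.Icc 0 s ∪ Q ∪ b '' Set.Icc t l) (b s) (b t) := by
    refine ((C.seq.iPath (Nat.zero_le s) (by omega)).symm.append C.path.symm C.a0 ?_).append
      (C.seq.iPath ht le_rfl).symm C.al.symm ?_
    · rintro _ ⟨k, ⟨_, hk⟩, rfl⟩ y hy
      refine ⟨C.Qb y hy k (by omega), fun h => ?_⟩
      rcases C.Qadj y hy k (by omega) h with ⟨rfl, h'⟩ | ⟨rfl, h'⟩
      · exact ⟨rfl, h'⟩
      · omega
    · rintro y (⟨k, ⟨_, hk⟩, rfl⟩ | hy) _ ⟨j, ⟨hj, hj'⟩, rfl⟩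
      · have := C.seq.far (by omega : k ≤ l) hj' (by omega)
        exact ⟨this.1, fun h => absurd h this.2⟩
      · refine ⟨(C.Qb y hy j (by omega)).symm, fun h => ?_⟩
        rcases C.Qadj y hy j (by omega) h.symm with ⟨rfl, h⟩ | ⟨rfl, h⟩
        · omega
        · exact ⟨h, rfl⟩
  have hole := hX.isHole_union hT hes hft hef (C.seq.ne (by omega) ht hst.ne) (by
    rintro y hy z ((⟨k, ⟨_, hk⟩, rfl⟩ | hz) | ⟨k, ⟨hk, hk'⟩, rfl⟩)
    · refine ⟨(hXb y hy k (by omega)).1.symm, fun h => ?_⟩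
      rcases (hXb y hy k (by omega)).2 h with ⟨rfl, h⟩ | ⟨rfl, h⟩
      · exact .inl ⟨h, rfl⟩
      · exact .inr ⟨h, rfl⟩
    · exact ⟨(hXQ y hy z hz).1, fun h => absurd h (hXQ y hy z hz).2⟩
    · refine ⟨(hXb y hy k (by omega)).1.symm, fun h => ?_⟩
      rcases (hXb y hy k (by omega)).2 h with ⟨rfl, h⟩ | ⟨rfl, h⟩
      · exact .inl ⟨h, rfl⟩
      · exact .inr ⟨h, rfl⟩)
  have o := hole.odd hG (z := v) (x := b s) (y := b t) ?_ (.inr hT.left_mem) (.inr hT.right_mem)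
    hs1.1 ht1.1 (C.seq.far (by omega) ht far).1 (C.seq.far (by omega) ht far).2
  · have e : G.neighborSet v ∩ (X ∪ (b '' Set.Icc 0 s ∪ Q ∪ b '' Set.Icc t l)) =
        b '' ({k | k ≤ s ∧ G.Adj v (b k)} ∪ {k | (t ≤ k ∧ k ≤ l) ∧ G.Adj v (b k)}) := by
      ext x
      constructor
      · rintro ⟨h, hx | (⟨k, ⟨_, hk⟩, rfl⟩ | hx) | ⟨k, ⟨hk, hk'⟩, rfl⟩⟩
        · exact absurd h (hXv x hx).2
        · exact ⟨k, .inl ⟨hk, h⟩, rfl⟩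
        · exact absurd h (C.Qv x hx).2
        · exact ⟨k, .inr ⟨⟨hk, hk'⟩, h⟩, rfl⟩
      · rintro ⟨k, ⟨hk, h⟩ | ⟨⟨hk, hk'⟩, h⟩, rfl⟩
        · exact ⟨h, .inr (.inl (.inl ⟨k, ⟨by omega, hk⟩, rfl⟩))⟩
        · exact ⟨h, .inr (.inr ⟨k, ⟨hk, hk'⟩, rfl⟩)⟩
    rw [e, Set.InjOn.ncard_image, Set.ncard_union_eq ?_
      ((Set.finite_le_nat s).subset fun k hk => hk.1)
      ((Set.finite_le_nat l).subset fun k hk => hk.1.2)] at o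
    -- The hole bypasses the part of `b` between `b s` and `b t`. As the ranks of `b s`, `b t` and
    -- `b l` are odd, an even number of spokes remains on it.
    · have h1 := cnt_interval ht ht1.1
      have h2 := hs1.2; have h3 := ht1.2; have h5 := C.hodd
      rw [cnt] at h2
      rw [Nat.odd_iff] at h2 h3 h5 o
      omega
    · rw [Set.disjoint_left]
      rintro k ⟨h1, _⟩ ⟨⟨h2, _⟩, _⟩
      omega
    · rintro j hj k hk
      have hj' : j ≤ l := by rcases hj with h | h; exacts [by have := h.1; omega, h.1.2]
      have hk' : k ≤ l := by rcases hk with h | h; exacts [by have := h.1; omega, h.1.2]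
      exact C.seq.inj j hj' k hk'
  · rintro (h | (⟨k, ⟨_, hk⟩, h⟩ | h) | ⟨k, ⟨_, hk⟩, h⟩)
    · exact (hXv v h).1 rfl
    · exact C.bv k (by omega) h
    · exact (C.Qv v h).1 rfl
    · exact C.bv k (by omega) h

/-- The vertices `p i` with `0 < i < n` have at most one common neighbour on `b`. -/
theorem unique_attach (C : Conf G v b l Q q₁ q₂ p n) (d : ℕ) : ∀ {i s t : ℕ}, 0 < i → i + d < n →
    s ≤ l → t ≤ l → G.Adj (p i) (b s) → G.Adj (p (i + d)) (b t) → s = t := by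
  induction d using Nat.strong_induction_on with
  | _ d ih =>
    intro i s t hi hd hs ht his hit
    by_contra hne
    have hd0 : d ≠ 0 := by
      rintro rfl
      exact hne (C.clique_p hG hd hs ht his hit)
    -- By induction an attachment in between would agree with both `s` and `t`.
    have hmid : ∀ j, i < j → j < i + d → ∀ k ≤ l, ¬ G.Adj (p j) (b k) := by
      intro j hij hjd k hk h
      have e1 := ih (j - i) (by omega) hi (by omega) hs hk his
        (by rwa [show i + (j - i) = j by omega])
      have e2 := ih (i + d - j) (by omega) (i := j) (by omega) (by omega) hk ht h
        (by rwa [show j + (i + d - j) = i + d by omega])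
      exact hne (e1.trans e2)
    have hX := C.pseq.iPath (i := i) (j := i + d) (by omega) (by omega)
    have hXv : ∀ y ∈ p '' Set.Icc i (i + d), y ≠ v ∧ ¬ G.Adj v y := by
      rintro _ ⟨j, ⟨h1, h2⟩, rfl⟩
      exact C.pv j (by omega)
    have hXQ : Anti G (p '' Set.Icc i (i + d)) Q := by
      rintro _ ⟨j, ⟨h1, h2⟩, rfl⟩ y hy
      have := C.pQ j (by omega) y hy
      exact ⟨this.1, fun h => by have := this.2 h; omega⟩
    have hXb : ∀ y ∈ p '' Set.Icc i (i + d), ∀ k ≤ l, b k ≠ y ∧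
        (G.Adj y (b k) → k = s ∧ y = p i ∨ k = t ∧ y = p (i + d)) := by
      rintro _ ⟨j, ⟨h1, h2⟩, rfl⟩ k hk
      refine ⟨C.pb j (by omega) k hk, fun h => ?_⟩
      by_cases hji : j = i
      · subst hji
        exact .inl ⟨C.clique_p hG (by omega) hk hs h his, rfl⟩
      by_cases hjd : j = i + d
      · subst hjd
        exact .inr ⟨C.clique_p hG (by omega) hk ht h hit, rfl⟩
      exact absurd h (hmid j (by omega) (by omega) k hk)
    have o1 := C.odd_of_adj (by omega) hs his
    have o2 := C.odd_of_adj (by omega) ht hit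
    have hpe : p i ≠ p (i + d) := C.pseq.ne (by omega) (by omega) (by omega)
    rcases lt_or_gt_of_ne hne with h | h
    · exact C.no_chord hG hX hpe h ht o1 o2 his hit hXv hXQ hXb
    · exact C.no_chord hG hX.symm hpe.symm h hs o2 o1 hit his hXv hXQ
        fun y hy k hk => ⟨(hXb y hy k hk).1, fun h => ((hXb y hy k hk).2 h).symm⟩

end Conf

end

/-! ### Where the path can attach to the ring. -/

section

open SimpleGraph

variable {V : Type*} {G : SimpleGraph V}

namespace Conf

variable {v q₁ q₂ : V} {b p : ℕ → V} {l n : ℕ} {Q : Set V}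

theorem reach_p (C : Conf G v b l Q q₁ q₂ p n) {i j : ℕ} (hi : i ≤ n) (hj : j ≤ n) {X : Set V}
    (hX : ∀ k, k ≤ n → (min i j ≤ k ∧ k ≤ max i j) → p k ∈ X) : Reach G X (p i) (p j) := by
  rcases le_total i j with h | h
  · exact C.pseq.reach h hj fun k h1 h2 => hX k (by omega) (by omega)
  · exact C.pseq.reach_symm h hi fun k h1 h2 => hX k (by omega) (by omega)

/-- The vertex `p n` and the part of `b` between two consecutive attachments. -/
theorem att (C : Conf G v b l Q q₁ q₂ p n) {α ω : ℕ} (hαω : α < ω) (hω : ω ≤ l)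
    (vα : G.Adj v (b α)) (vω : G.Adj v (b ω))
    (hα : α = 0 ∨ ∃ i < n, G.Adj (p i) (b α)) (hω' : ω = l ∨ ∃ i < n, G.Adj (p i) (b ω))
    (hno : ∀ k, α < k → k < ω → ∀ i < n, ¬ G.Adj (p i) (b k)) :
    Att G v (fun i => b (α + i)) (ω - α) (p n) (Q ∪ p '' {i | i < n}) where
  seq := C.seq.shift (by omega)
  bv i hi := C.bv _ (by omega)
  v0 := vα
  vl := by rwa [show α + (ω - α) = ω by omega]
  cv := (C.pv n le_rfl).1
  nvc := (C.pv n le_rfl).2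
  bc i hi := C.pb n le_rfl _ (by omega)
  Fv := by
    rintro y (hy | ⟨i, hi, rfl⟩)
    · exact C.Qv y hy
    · exact C.pv i (le_of_lt hi)
  Fb := by
    rintro y (hy | ⟨i, hi, rfl⟩) k hk
    · exact C.Qb y hy _ (by omega)
    · exact C.pb i (le_of_lt hi) _ (by omega)
  Fb' := by
    rintro y (hy | ⟨i, hi, rfl⟩) k hk hk' h
    · rcases C.Qadj y hy _ (by omega) h with ⟨h, _⟩ | ⟨h, _⟩ <;> omega
    · exact hno _ (by omega) (by omega) i hi h.symm
  reachl := by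
    rw [show α + (ω - α) = ω by omega]
    have hp : ∀ k, k ≤ n → p k ∈ insert (p n) (insert (b ω) (Q ∪ p '' {i | i < n})) := by
      intro k hk
      by_cases h : k = n
      · rw [h]; simp
      · exact .inr (.inr (.inr ⟨k, by simp; omega, rfl⟩))
    rcases hω' with rfl | ⟨i, hi, h⟩
    · obtain ⟨y, hy, hpy⟩ := C.p0
      refine (C.reach_p (j := 0) le_rfl (by omega) fun k hk _ => hp k hk).trans ?_
      refine Reach.cons (b := y) ?_ (hp 0 (by omega)) hpy
      exact ((C.path.reach_mem hy C.path.left_mem).mono fun z hz => .inr (.inr (.inl hz))).snoc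
        (by simp) C.al.symm
    · exact (C.reach_p le_rfl hi.le fun k hk _ => hp k hk).snoc (by simp) h
  reach0 := by
    simp only [Nat.add_zero]
    have hp : ∀ k, k ≤ n → p k ∈ insert (p n) (insert (b α) (Q ∪ p '' {i | i < n})) := by
      intro k hk
      by_cases h : k = n
      · rw [h]; simp
      · exact .inr (.inr (.inr ⟨k, by simp; omega, rfl⟩))
    rcases hα with rfl | ⟨i, hi, h⟩
    · obtain ⟨y, hy, hpy⟩ := C.p0
      refine (C.reach_p (j := 0) le_rfl (by omega) fun k hk _ => hp k hk).trans ?_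
      refine Reach.cons (b := y) ?_ (hp 0 (by omega)) hpy
      exact ((C.path.reach_mem hy C.path.right_mem).mono fun z hz => .inr (.inr (.inl hz))).snoc
        (by simp) C.a0.symm
    · exact (C.reach_p le_rfl hi.le fun k hk _ => hp k hk).snoc (by simp) h

variable [Finite V]
variable (hG : IsC4FreeOddSignable G)

include hG

/-- `no_chord` does not cover paths starting at `p 0`, which touches `Q`. If `s ≠ t`, a theta joins
`p 0` to `v`: through `b t`, along `p` to its first attachment at `b s`, and through `Q` and `b 0`.
This fails only when `s = l` and `q₁` is the sole neighbour of `p 0` in `Q`; then `b l` sees exactly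
`v` and `q₁` on the hole formed by `v`, `b 0`, `Q`, `p 0` and `b t`. -/
theorem attach_eq_aux (C : Conf G v b l Q q₁ q₂ p n) {t s i : ℕ} (ht : 0 < t) (htl : t < l)
    (h0t : G.Adj (p 0) (b t)) (hi : 0 < i) (hin : i < n) (hs0 : s ≠ 0) (hs : s ≤ l)
    (his : G.Adj (p i) (b s)) : s = t := by
  classical
  by_contra hst
  have hp0 := C.pv 0 (by omega)
  obtain ⟨i, ⟨hi, hin, his⟩, hmin⟩ : ∃ i, (0 < i ∧ i < n ∧ G.Adj (p i) (b s)) ∧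
      ∀ k, k < i → ¬ (0 < k ∧ k < n ∧ G.Adj (p k) (b s)) :=
    have h : ∃ i, 0 < i ∧ i < n ∧ G.Adj (p i) (b s) := ⟨i, hi, hin, his⟩
    ⟨Nat.find h, Nat.find_spec h, fun k => Nat.find_min h⟩
  have hall : ∀ j, 0 < j → j ≤ i → ∀ k ≤ l, G.Adj (p j) (b k) → k = s ∧ j = i := by
    intro j hj hji k hk h
    have := C.unique_attach hG (i - j) hj (by omega) hk hs h
      (by rwa [show j + (i - j) = i by omega])
    subst this
    refine ⟨rfl, ?_⟩
    by_contra hne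
    exact hmin j (by omega) ⟨hj, by omega, h⟩
  have ot := C.odd_of_adj (by omega : 0 < n) htl.le h0t
  have os := C.odd_of_adj hin hs his
  have o0 : G.Adj v (b 0) ∧ Odd (cnt G v b 0) := ⟨C.v0, by rw [cnt_zero C.v0]; decide⟩
  have fst := far_of_odd hst os ot
  have ft0 := far_of_odd (by omega : t ≠ 0) ot o0
  have ftl := far_of_odd (by omega : t ≠ l) ot ⟨C.vl, C.hodd⟩
  have fs0 := far_of_odd (by omega : s ≠ 0) os o0
  have hp0k : ∀ k ≤ l, G.Adj (p 0) (b k) → k = t := fun k hk h =>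
    C.clique_p hG (by omega) hk htl.le h h0t
  by_cases hB : ∃ y ∈ Q, G.Adj (p 0) y ∧ (s = l → y ≠ q₁)
  · obtain ⟨y, hy, hpy, hyl⟩ := hB
    refine theta_free' hG (a := p 0) (b := v) (X := {b t}) (Y := insert (b s) (p '' Set.Icc 1 i))
      (Z := insert (b 0) {z | z ∈ Q ∧ (s = l → z ≠ q₁)}) hp0.1 (fun h => hp0.2 h.symm)
      ?_ ?_ ?_ ?_ ?_ ?_
    · exact ((Reach.refl (by simp)).cons (by simp) ot.1.symm).cons (by simp) h0t
    · refine ((C.reach_p (i := 0) (j := i) (by omega) (by omega) fun k hk h => ?_).snoc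
        (by simp) his).snoc (by simp) os.1.symm
      by_cases hk0 : k = 0
      · subst hk0; simp
      · exact .inr (.inr (.inr ⟨k, ⟨by omega, by omega⟩, rfl⟩))
    · refine Reach.cons (b := y) (((?_ : Reach G {z | z ∈ Q ∧ (s = l → z ≠ q₁)} y q₂).mono
        (by clear * -; intro; simp; tauto)).snoc (by simp) C.a0.symm |>.snoc (by simp) C.v0.symm)
        (by simp) hpy
      -- For `s = l` the third path must avoid `q₁`, a neighbour of `b l`; removing this end of `Q`
      -- leaves a path.
      by_cases hsl : s = l
      · have hne : q₁ ≠ q₂ := by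
          intro h
          have hQ := C.path
          rw [← h] at hQ
          rw [hQ.eq_singleton] at hy
          exact hyl hsl hy
        obtain ⟨q', -, hq, -⟩ := C.path.tail hne
        refine (hq.reach_mem ⟨hy, hyl hsl⟩ hq.right_mem).mono ?_
        rintro z ⟨h1, h2⟩
        exact ⟨h1, fun _ => h2⟩
      · exact (C.path.reach_mem hy C.path.right_mem).mono fun z hz => ⟨hz, fun h => absurd h hsl⟩
    · rintro _ rfl z (rfl | ⟨j, ⟨h1, h2⟩, rfl⟩)
      · exact C.seq.far (by omega) hs (by omega)
      · exact ⟨C.pb j (by omega) t htl.le, fun h => by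
          have := (hall j h1 h2 t htl.le h.symm).1; omega⟩
    · rintro _ rfl z (rfl | ⟨hz, _⟩)
      · exact C.seq.far (by omega) (by omega) (by omega)
      · exact ⟨C.Qb z hz t htl.le, fun h => by
          rcases C.Qadj z hz t htl.le h with ⟨h, _⟩ | ⟨h, _⟩ <;> omega⟩
    · rintro _ (rfl | ⟨j, ⟨h1, h2⟩, rfl⟩) z (rfl | ⟨hz, hz'⟩)
      · exact C.seq.far (by omega) (by omega) (by omega)
      · refine ⟨C.Qb z hz s hs, fun h => ?_⟩
        rcases C.Qadj z hz s hs h with ⟨h, _⟩ | ⟨h, h'⟩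
        · omega
        · exact hz' h h'
      · exact ⟨(C.pb j (by omega) 0 (by omega)).symm, fun h => by
          have := (hall j h1 h2 0 (by omega) h).1; omega⟩
      · exact ⟨(C.pQ j (by omega) z hz).1, fun h => by
          have := (C.pQ j (by omega) z hz).2 h; omega⟩
  · push Not at hB
    obtain ⟨y, hy, hpy⟩ := C.p0
    obtain ⟨hsl, rfl⟩ := hB y hy hpy
    subst hsl
    have hQ : ∀ z ∈ Q, p 0 ≠ z ∧ (G.Adj (p 0) z → z = y) := fun z hz =>
      ⟨(C.pQ 0 (by omega) z hz).1, fun h => (hB z hz h).2⟩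
    have h1 : IPath G (insert (b t) (insert (p 0) Q)) (b t) q₂ := by
      refine (C.path.cons' hpy fun z hz => ⟨(hQ z hz).1.symm, (hQ z hz).2⟩).cons' h0t.symm ?_
      rintro z (rfl | hz)
      · exact ⟨(C.pb 0 (by omega) t htl.le).symm, fun _ => rfl⟩
      · exact ⟨(C.Qb z hz t htl.le).symm, fun h => by
          rcases C.Qadj z hz t htl.le h with ⟨h, _⟩ | ⟨h, _⟩ <;> omega⟩
    have h2 : IPath G (insert (b 0) (insert (b t) (insert (p 0) Q))) (b 0) (b t) := by
      refine h1.symm.cons' C.a0 ?_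
      rintro z (rfl | rfl | hz)
      · have := C.seq.far (by omega : 0 ≤ s) htl.le (by omega)
        exact ⟨this.1.symm, fun h => absurd h this.2⟩
      · exact ⟨(C.pb 0 (by omega) 0 (by omega)).symm, fun h => by
          have := hp0k 0 (by omega) h.symm; omega⟩
      · refine ⟨(C.Qb z hz 0 (by omega)).symm, fun h => ?_⟩
        rcases C.Qadj z hz 0 (by omega) h with ⟨_, h⟩ | ⟨h, _⟩
        · exact h
        · omega
    have far0t := C.seq.far (by omega : 0 ≤ s) htl.le (by omega)
    have hole := h2.isHole (w := v) (by
        rintro (h | h | h | h)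
        · exact C.bv 0 (by omega) h.symm
        · exact C.bv t (by omega) h.symm
        · exact hp0.1 h.symm
        · exact (C.Qv v h).1 rfl) C.v0 ot.1 (by
        rintro z (rfl | rfl | rfl | hz) h
        · exact .inl rfl
        · exact .inr rfl
        · exact absurd h hp0.2
        · exact absurd h (C.Qv z hz).2) far0t.1 far0t.2
    have hbl : ∀ z ∈ insert v (insert (b 0) (insert (b t) (insert (p 0) Q))),
        b s ≠ z ∧ (G.Adj (b s) z → z = v ∨ z = y) := by
      rintro z (rfl | rfl | rfl | rfl | hz)
      · exact ⟨C.bv s le_rfl, fun _ => .inl rfl⟩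
      · have := C.seq.far (le_refl s) (by omega : 0 ≤ s) (by omega)
        exact ⟨this.1, fun h => absurd h this.2⟩
      · have := C.seq.far (le_refl s) htl.le (by omega)
        exact ⟨this.1, fun h => absurd h this.2⟩
      · exact ⟨C.pb 0 (by omega) s le_rfl, fun h => by
          have := hp0k s le_rfl h.symm; omega⟩
      · refine ⟨C.Qb z hz s le_rfl, fun h => ?_⟩
        rcases C.Qadj z hz s le_rfl h with ⟨h, _⟩ | ⟨_, h⟩
        · omega
        · exact .inr h
    have hyv := C.Qv y hy
    have o := hole.odd hG (z := b s) (x := v) (y := y) (fun h => (hbl _ h).1 rfl) (by simp)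
      (by simp [hy]) C.vl.symm C.al hyv.1.symm hyv.2
    have e : G.neighborSet (b s) ∩ insert v (insert (b 0) (insert (b t) (insert (p 0) Q))) =
        {v, y} := by
      ext z
      constructor
      · rintro ⟨h, hz⟩
        exact (hbl z hz).2 h
      · rintro (rfl | rfl)
        · exact ⟨C.vl.symm, by simp⟩
        · exact ⟨C.al, by simp [hy]⟩
    rw [e, Set.ncard_pair hyv.1.symm] at o
    revert o; decide

/-- The remaining value `s = 0` becomes `l` when `b` is reversed. -/
theorem attach_eq (C : Conf G v b l Q q₁ q₂ p n) {t s i : ℕ} (ht : 0 < t) (htl : t < l)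
    (h0t : G.Adj (p 0) (b t)) (hi : 0 < i) (hin : i < n) (hs : s ≤ l)
    (his : G.Adj (p i) (b s)) : s = t := by
  by_cases hs0 : s = 0
  · subst hs0
    have := C.mirror.attach_eq_aux hG (t := l - t) (s := l) (by omega) (by omega)
      (by rwa [show l - (l - t) = t by omega]) hi hin (by omega) le_rfl (by simpa using his)
    omega
  · exact C.attach_eq_aux hG ht htl h0t hi hin hs0 hs his

end Conf

end

/-! ### The configuration with one spoke between `b 0` and the next attachment. -/

section

open SimpleGraph

variable {V : Type*} {G : SimpleGraph V}

/-- The configuration in which `b 0` and an inner spoke `b t` attached to the path `p` are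
separated by a single spoke `b s`. -/
structure Short (G : SimpleGraph V) (v : V) (b : ℕ → V) (l : ℕ) (Q : Set V) (q₁ q₂ : V)
    (p : ℕ → V) (n t s m : ℕ) : Prop extends Conf G v b l Q q₁ q₂ p n where
  mn : m < n
  mt : G.Adj (p m) (b t)
  vt : G.Adj v (b t)
  vs : G.Adj v (b s)
  st : s < t
  tl : t + 2 ≤ l
  uniq : ∀ k, 0 < k → k < t → G.Adj v (b k) → k = s
  att1 : ∀ j, 0 < j → j < n → ∀ k ≤ l, G.Adj (p j) (b k) → k = t
  att0 : ∀ k ≤ l, G.Adj (p 0) (b k) → k = t ∨ k = 0 ∨ k = l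
  attm : ∀ j, m ≤ j → j < n → ∀ k ≤ l, G.Adj (p j) (b k) → k = t
  nbr : ∃ k, 0 < k ∧ k < t ∧ G.Adj (p n) (b k)

namespace Short

variable {v q₁ q₂ : V} {b p : ℕ → V} {l n t s m : ℕ} {Q : Set V}

theorem toAtt (S : Short G v b l Q q₁ q₂ p n t s m) :
    Att G v b t (p n) (Q ∪ p '' {i | i < n}) := by
  have h4 := S.two
  have ht := S.tl
  have hs := S.st
  have := S.toConf.att (α := 0) (ω := t) (by omega) (by omega) S.v0 S.vt (.inl rfl)
    (.inr ⟨m, S.mn, S.mt⟩) (by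
      intro k h1 h2 i hi h
      by_cases hi0 : i = 0
      · subst hi0
        have := S.att0 k (by omega) h
        omega
      · have := S.att1 i (by omega) hi k (by omega) h
        omega)
  simpa using this

/-- The part of `p` after its vertex `p m`. -/
theorem reach_t (S : Short G v b l Q q₁ q₂ p n t s m) :
    Reach G (insert (p n) (insert (b t) (p '' Set.Icc m (n - 1)))) (p n) (b t) := by
  have hm := S.mn
  refine (S.reach_p le_rfl hm.le fun k hk h => ?_).snoc (by simp) S.mt
  by_cases hkn : k = n
  · subst hkn; simp
  · exact .inr (.inr ⟨k, ⟨by omega, by omega⟩, rfl⟩)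

theorem late (S : Short G v b l Q q₁ q₂ p n t s m) : ∀ y ∈ p '' Set.Icc m (n - 1),
    y ≠ v ∧ ¬ G.Adj v y ∧ ∀ k ≤ l, b k ≠ y ∧ (G.Adj y (b k) → k = t) := by
  have hm := S.mn
  rintro _ ⟨j, ⟨h1, h2⟩, rfl⟩
  exact ⟨(S.pv j (by omega)).1, (S.pv j (by omega)).2, fun k hk =>
    ⟨S.pb j (by omega) k hk, S.attm j h1 (by omega) k hk⟩⟩

variable [Finite V]
variable (hG : IsC4FreeOddSignable G)

include hG

/-- First and last neighbour of `p n` between `b 0` and `b t`. -/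
theorem exists_nbrs (S : Short G v b l Q q₁ q₂ p n t s m) : ∃ i j, 0 < i ∧ i ≤ j ∧ j < t ∧
    G.Adj (p n) (b i) ∧ G.Adj (p n) (b j) ∧ (∀ k, 0 < k → k < t → G.Adj (p n) (b k) → i ≤ k ∧ k ≤ j) ∧
    (s = 1 → 3 ≤ t → 2 ≤ j) ∧ (s + 1 = t → 2 ≤ s → i < s) := by
  classical
  obtain ⟨k₀, h0, h1, h2⟩ := S.nbr
  obtain ⟨i, ⟨hi, hit, hci⟩, hmin⟩ : ∃ i, (0 < i ∧ i < t ∧ G.Adj (p n) (b i)) ∧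
      ∀ k, k < i → ¬ (0 < k ∧ k < t ∧ G.Adj (p n) (b k)) :=
    have h : ∃ i, 0 < i ∧ i < t ∧ G.Adj (p n) (b i) := ⟨k₀, h0, h1, h2⟩
    ⟨Nat.find h, Nat.find_spec h, fun k => Nat.find_min h⟩
  obtain ⟨j', ⟨hj', hjl', hcj'⟩, hmax'⟩ : ∃ i, (0 < i ∧ i < t ∧ G.Adj (p n) (b (t - i))) ∧
      ∀ k, k < i → ¬ (0 < k ∧ k < t ∧ G.Adj (p n) (b (t - k))) :=
    have h : ∃ i, 0 < i ∧ i < t ∧ G.Adj (p n) (b (t - i)) :=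
      ⟨t - i, by omega, by omega, by rwa [show t - (t - i) = i by omega]⟩
    ⟨Nat.find h, Nat.find_spec h, fun k => Nat.find_min h⟩
  have hmax : ∀ k, t - j' < k → k < t → ¬ G.Adj (p n) (b k) := fun k h1 h2 h3 =>
    hmax' (t - k) (by omega) ⟨by omega, by omega, by rwa [show t - (t - k) = k by omega]⟩
  have ei : t - (t - i) = i := by omega
  have hij : i ≤ t - j' := by
    by_contra h
    exact hmax i (by omega) hit hci
  refine ⟨i, t - j', hi, hij, by omega, hci, hcj', ?_, ?_, ?_⟩
  · intro k h1 h2 h3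
    refine ⟨?_, ?_⟩ <;> by_contra h
    · exact hmin k (by omega) ⟨h1, h2, h3⟩
    · exact hmax k (by omega) h2 h3
  -- If `b 1` were the last inner neighbour, `odd_or` would apply to the segment from `b 1` to `b
  -- t`, which has exactly two spokes, its ends. The last claim is the mirror image.
  · intro hs1 ht3
    by_contra hj2
    have hj1 : t - j' = 1 := by omega
    rcases S.toAtt.odd_or hG (i := t - j') (by omega) (by omega) hcj' hmax with h | ⟨h, -⟩
    · have e : {k | (t - j' ≤ k ∧ k ≤ t) ∧ G.Adj v (b k)} = {1, t} := by
        ext k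
        simp only [Set.mem_ofPred_eq, Set.mem_insert_iff, Set.mem_singleton_iff]
        constructor
        · rintro ⟨⟨h1, h2⟩, h3⟩
          by_cases hkt : k = t
          · exact .inr hkt
          · have := S.uniq k (by omega) (by omega) h3
            omega
        · rintro (rfl | rfl)
          · exact ⟨⟨by omega, by omega⟩, hs1 ▸ S.vs⟩
          · exact ⟨⟨by omega, le_rfl⟩, S.vt⟩
      rw [e, Set.ncard_pair (by omega)] at h
      revert h; decide
    · have := S.uniq _ (by omega) (by omega) h
      omega
  · intro hst hs2
    by_contra his
    rcases S.toAtt.mirror.odd_or hG (i := t - i) (by omega) (by omega) (by rwa [ei])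
      (fun k h1 h2 h3 => hmin (t - k) (by omega) ⟨by omega, by omega, h3⟩) with h | ⟨h, -⟩
    · have e : {k | (t - i ≤ k ∧ k ≤ t) ∧ G.Adj v (b (t - k))} = {t, t - s} := by
        ext k
        simp only [Set.mem_ofPred_eq, Set.mem_insert_iff, Set.mem_singleton_iff]
        constructor
        · rintro ⟨⟨h1, h2⟩, h3⟩
          by_cases hkt : k = t
          · exact .inl hkt
          · have := S.uniq _ (by omega) (by omega) h3
            omega
        · rintro (rfl | rfl)
          · exact ⟨⟨by omega, by omega⟩, by simpa using S.v0⟩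
          · refine ⟨⟨by omega, by omega⟩, ?_⟩
            rw [show t - (t - s) = s by omega]
            exact S.vs
      rw [e, Set.ncard_pair (by omega)] at h
      revert h; decide
    · have := S.uniq _ (by omega) (by omega) h
      omega

/-- `no_four_spokes` at `p 0`: the spokes `b 0` and `b l` are reached through `Q`, the spoke `b 1`
along all of `p` and down `b`, and `b t` along `p` as far as `p m`. -/
theorem false_of_near (S : Short G v b l Q q₁ q₂ p n t s m) (hs : s = 1)
    (hc0 : ¬ G.Adj (p n) (b 0)) (hcl : ¬ G.Adj (p n) (b l)) : False := by
  subst hs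
  have ht := S.tl; have hs := S.st; have hm := S.mn
  obtain ⟨y, hy, hpy⟩ := S.p0
  obtain ⟨k₀, hk0, hkt, hck⟩ := S.nbr
  obtain ⟨L, hL, hLp⟩ : Reach G (insert (p 0) (insert (b 0) Q)) (p 0) (b 0) :=
    (((S.path.reach_mem hy S.path.right_mem).mono (by clear * -; intro; simp; tauto)).snoc (by simp)
      S.a0.symm).cons (by simp) hpy
  obtain ⟨L', hL', hLp'⟩ : Reach G (insert (p 0) (insert (b l) Q)) (p 0) (b l) :=
    (((S.path.reach_mem hy S.path.left_mem).mono (by clear * -; intro; simp; tauto)).snoc (by simp)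
      S.al.symm).cons (by simp) hpy
  obtain ⟨T, hT, hTp⟩ : Reach G (insert (p 0) (p '' Set.Icc 1 n ∪ b '' Set.Icc 1 (t - 1)))
      (p 0) (b 1) := by
    refine (S.reach_p (j := n) (by omega) le_rfl fun k hk _ => ?_).trans (Reach.cons (b := b k₀)
      (S.seq.reach_symm (i := 1) (j := k₀) (by omega) (by omega)
        fun k h1 h2 => .inr (.inr ⟨k, ⟨h1, by omega⟩, rfl⟩)) ?_ hck)
    · by_cases hk0 : k = 0
      · subst hk0; simp
      · exact .inr (.inl ⟨k, ⟨by omega, hk⟩, rfl⟩)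
    · exact .inr (.inl ⟨n, ⟨by omega, le_rfl⟩, rfl⟩)
  obtain ⟨R, hR, hRp⟩ : Reach G (insert (p 0) (insert (b t) (p '' Set.Icc 1 m))) (p 0) (b t) := by
    refine (S.reach_p (j := m) (by omega) (by omega) fun k hk h => ?_).snoc (by simp) S.mt
    by_cases hk0 : k = 0
    · subst hk0; simp
    · exact .inr (.inr ⟨k, ⟨by omega, by omega⟩, rfl⟩)
  have hp0 := S.pv 0 (by omega)
  have hLQ : ∀ y ∈ L, y = p 0 ∨ y = b 0 ∨ y ∈ Q := fun y hy => hL hy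
  have hLQ' : ∀ y ∈ L', y = p 0 ∨ y = b l ∨ y ∈ Q := fun y hy => hL' hy
  have hTm : ∀ y ∈ T, y ≠ p 0 → (∃ k, 1 ≤ k ∧ k ≤ n ∧ y = p k) ∨ ∃ k, 1 ≤ k ∧ k < t ∧ y = b k := by
    intro y hy hyc
    rcases hT hy with h | ⟨k, ⟨h1, h2⟩, rfl⟩ | ⟨k, ⟨h1, h2⟩, rfl⟩
    · exact absurd h hyc
    · exact .inl ⟨k, h1, h2, rfl⟩
    · exact .inr ⟨k, h1, by omega, rfl⟩
  have hRm : ∀ y ∈ R, y ≠ p 0 → (∃ k, 1 ≤ k ∧ k < n ∧ y = p k) ∨ y = b t := by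
    intro y hy hyc
    rcases hR hy with h | h | ⟨k, ⟨h1, h2⟩, rfl⟩
    · exact absurd h hyc
    · exact .inr h
    · exact .inl ⟨k, h1, by omega, rfl⟩
  have hQp : ∀ y ∈ Q, ∀ k, 1 ≤ k → k ≤ n → y ≠ p k ∧ ¬ G.Adj y (p k) := by
    intro y hy k h1 h2
    have := S.pQ k h2 y hy
    exact ⟨this.1.symm, fun h => by have := this.2 h.symm; omega⟩
  have hQb : ∀ y ∈ Q, ∀ k, 1 ≤ k → k ≤ t → y ≠ b k ∧ ¬ G.Adj y (b k) := by
    intro y hy k h1 h2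
    refine ⟨(S.Qb y hy k (by omega)).symm, fun h => ?_⟩
    rcases S.Qadj y hy k (by omega) h.symm with ⟨h, _⟩ | ⟨h, _⟩ <;> omega
  have h0p : ∀ k, 1 ≤ k → k ≤ n → b 0 ≠ p k ∧ ¬ G.Adj (b 0) (p k) := by
    intro k h1 h2
    refine ⟨S.pb k h2 0 (by omega), fun h => ?_⟩
    by_cases hkn : k = n
    · subst hkn; exact hc0 h.symm
    · have := S.att1 k h1 (by omega) 0 (by omega) h.symm
      omega
  have hlp : ∀ k, 1 ≤ k → k ≤ n → b l ≠ p k ∧ ¬ G.Adj (b l) (p k) := by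
    intro k h1 h2
    refine ⟨S.pb k h2 l le_rfl, fun h => ?_⟩
    by_cases hkn : k = n
    · subst hkn; exact hcl h.symm
    · have := S.att1 k h1 (by omega) l le_rfl h.symm
      omega
  refine no_four_spokes hG hLp hLp' hTp hRp hp0.2 S.v0 S.vl S.vs S.vt ?_ ?_ ?_ ?_
    (S.seq.far (by omega) (by omega) (by omega)).2 (S.seq.ne (by omega) (by omega) (by omega))
    ((S.seq.adj _ (by omega) _ (by omega)).2 (.inr rfl))
    (S.seq.far (by omega) (by omega) (by omega)).2
    (S.seq.far (by omega) (by omega) (by omega)).2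
    (S.seq.far (by omega) (by omega) (by omega)).2 ?_ ?_ ?_ ?_
  · intro y hy
    rcases hLQ y hy with rfl | rfl | hy
    · exact ⟨hp0.1, fun e => absurd e hp0.2⟩
    · exact ⟨S.bv _ (by omega), fun _ => rfl⟩
    · exact ⟨(S.Qv y hy).1, fun e => absurd e (S.Qv y hy).2⟩
  · intro y hy
    rcases hLQ' y hy with rfl | rfl | hy
    · exact ⟨hp0.1, fun e => absurd e hp0.2⟩
    · exact ⟨S.bv _ (by omega), fun _ => rfl⟩
    · exact ⟨(S.Qv y hy).1, fun e => absurd e (S.Qv y hy).2⟩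
  · intro y hy
    by_cases hyc : y = p 0
    · subst hyc; exact ⟨hp0.1, fun e => absurd e hp0.2⟩
    rcases hTm y hy hyc with ⟨k, h1, h2, rfl⟩ | ⟨k, h1, h2, rfl⟩
    · exact ⟨(S.pv k h2).1, fun e => absurd e (S.pv k h2).2⟩
    · exact ⟨S.bv _ (by omega), fun e => by rw [S.uniq k h1 h2 e]⟩
  · intro y hy
    by_cases hyc : y = p 0
    · subst hyc; exact ⟨hp0.1, fun e => absurd e hp0.2⟩
    rcases hRm y hy hyc with ⟨k, h1, h2, rfl⟩ | rfl
    · exact ⟨(S.pv k h2.le).1, fun e => absurd e (S.pv k h2.le).2⟩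
    · exact ⟨S.bv _ (by omega), fun _ => rfl⟩
  · intro y hy z hz hyc hzc
    rcases hTm z hz hzc with ⟨k, h1, h2, rfl⟩ | ⟨k, h1, h2, rfl⟩ <;>
      rcases hLQ y hy with rfl | rfl | hy
    · exact absurd rfl hyc
    · exact ⟨(h0p k h1 h2).1, fun h => absurd h (h0p k h1 h2).2⟩
    · exact ⟨(hQp y hy k h1 h2).1, fun h => absurd h (hQp y hy k h1 h2).2⟩
    · exact absurd rfl hyc
    · refine ⟨S.seq.ne (by omega) (by omega) (by omega), fun h => ⟨rfl, ?_⟩⟩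
      rw [S.seq.adj _ (by omega) _ (by omega)] at h
      have : k = 1 := by omega
      rw [this]
    · exact ⟨(hQb y hy k h1 h2.le).1, fun h => absurd h (hQb y hy k h1 h2.le).2⟩
  · intro y hy z hz hyc hzc
    rcases hRm z hz hzc with ⟨k, h1, h2, rfl⟩ | rfl <;> rcases hLQ y hy with rfl | rfl | hy
    · exact absurd rfl hyc
    · exact h0p k h1 h2.le
    · exact hQp y hy k h1 h2.le
    · exact absurd rfl hyc
    · exact S.seq.far (by omega) (by omega) (by omega)
    · exact hQb y hy t (by omega) le_rfl
  · intro y hy z hz hyc hzc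
    rcases hTm z hz hzc with ⟨k, h1, h2, rfl⟩ | ⟨k, h1, h2, rfl⟩ <;>
      rcases hLQ' y hy with rfl | rfl | hy
    · exact absurd rfl hyc
    · exact hlp k h1 h2
    · exact hQp y hy k h1 h2
    · exact absurd rfl hyc
    · exact S.seq.far (by omega) (by omega) (by omega)
    · exact hQb y hy k h1 h2.le
  · intro y hy z hz hyc hzc
    rcases hRm z hz hzc with ⟨k, h1, h2, rfl⟩ | rfl <;> rcases hLQ' y hy with rfl | rfl | hy
    · exact absurd rfl hyc
    · exact hlp k h1 h2.le
    · exact hQp y hy k h1 h2.le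
    · exact absurd rfl hyc
    · exact S.seq.far (by omega) (by omega) (by omega)
    · exact hQb y hy t (by omega) le_rfl

/-- The vertex `p n` is joined to `b t` by its path, by `b`, and through a spoke and `v`. -/
theorem false_of_end (S : Short G v b l Q q₁ q₂ p n t s m) (hs : s = 1) (ht3 : 3 ≤ t) {e : ℕ}
    (he : e = 0 ∨ e = l) (hce : G.Adj (p n) (b e)) : False := by
  have ht := S.tl; have hst := S.st; have hm := S.mn
  obtain ⟨i, j, hi, hij, hjt, hci, hcj, hu, h2j, -⟩ := S.exists_nbrs hG
  -- This keeps the segment from `b j` to `b (t - 1)` away from `b 0` and free of the spoke `b 1`.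
  have hj2 := h2j hs ht3
  have hc := S.pv n le_rfl
  have ve : G.Adj v (b e) := by rcases he with rfl | rfl; exacts [S.v0, S.vl]
  have hel : e ≤ l := by omega
  have hct : ¬ G.Adj (p n) (b t) := S.clique hG hc.1 hc.2 hel (by omega) (by omega) ve S.vt hce
  refine theta_free' hG (a := p n) (b := b t) (X := p '' Set.Icc m (n - 1))
    (Y := b '' Set.Icc j (t - 1)) (Z := {b e, v}) (S.pb n le_rfl t (by omega)).symm hct S.reach_t
    ?_ ?_ ?_ ?_ ?_
  · refine (S.seq.reach hjt.le (by omega) fun k h1 h2 => ?_).cons (by simp) hcj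
    by_cases hkt : k = t
    · subst hkt; simp
    · exact .inr (.inr ⟨k, ⟨h1, by omega⟩, rfl⟩)
  · exact (((Reach.refl (by simp)).cons (by simp) S.vt).cons (by simp) ve.symm).cons (by simp) hce
  · rintro y hy _ ⟨k, ⟨h1, h2⟩, rfl⟩
    have := (S.late y hy).2.2 k (by omega)
    exact ⟨this.1.symm, fun h => by have := this.2 h; omega⟩
  · rintro y hy z (rfl | rfl)
    · have := (S.late y hy).2.2 e hel
      exact ⟨this.1.symm, fun h => by have := this.2 h; omega⟩
    · have := S.late y hy
      exact ⟨this.1, fun h => this.2.1 h.symm⟩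
  · rintro _ ⟨k, ⟨h1, h2⟩, rfl⟩ z (rfl | rfl)
    · exact S.seq.far (by omega) hel (by omega)
    · exact ⟨S.bv k (by omega), fun h => by
        have := S.uniq k (by omega) (by omega) h.symm
        omega⟩

/-- An even wheel centred at the spoke next to `b t`. -/
theorem false_of_wheel (S : Short G v b l Q q₁ q₂ p n t s m) (hs : s + 1 = t) {i : ℕ}
    (hci : G.Adj (p n) (b i)) (his : i + 1 = s) (hcs : G.Adj (p n) (b s))
    (hmin : ∀ k, k < i → ¬ G.Adj (p n) (b k)) : False := by
  have ht := S.tl; have hst := S.st; have hm := S.mn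
  have hc := S.pv n le_rfl
  obtain ⟨L, hL, hLp⟩ := S.reach_t
  have hLm : ∀ y ∈ L, y = p n ∨ y = b t ∨ y ∈ p '' Set.Icc m (n - 1) := fun y hy => hL hy
  have hT : IPath G (insert v (b '' Set.Icc 0 i)) (b i) v := by
    refine ((S.seq.iPath (Nat.zero_le i) (by omega)).cons' S.v0 ?_).symm
    rintro _ ⟨k, ⟨_, hk⟩, rfl⟩
    refine ⟨S.bv k (by omega), fun h => ?_⟩
    by_cases hk0 : k = 0
    · rw [hk0]
    · have := S.uniq k (by omega) (by omega) h
      omega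
  -- The hole runs from `p n` along `p` to `b t`, then by `v` to `b 0` and up to `b i`. The spoke `b
  -- s` sees exactly `p n`, `b t`, `v` and `b i` on it.
  have hole := hLp.isHole_union hT hci S.vt.symm (S.pb n le_rfl t (by omega)).symm
    (S.bv i (by omega)) (by
    rintro y hy z (rfl | ⟨k, ⟨_, hk⟩, rfl⟩)
    · rcases hLm y hy with rfl | rfl | hy
      · exact ⟨hc.1, fun h => absurd h.symm hc.2⟩
      · exact ⟨S.bv t (by omega), fun h => .inr ⟨rfl, rfl⟩⟩
      · exact ⟨(S.late y hy).1, fun h => absurd h.symm (S.late y hy).2.1⟩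
    · rcases hLm y hy with rfl | rfl | hy
      · refine ⟨(S.pb n le_rfl k (by omega)).symm, fun h => .inl ⟨rfl, ?_⟩⟩
        by_cases hki : k = i
        · rw [hki]
        · exact absurd h (hmin k (by omega))
      · have := S.seq.far (by omega : t ≤ l) (by omega : k ≤ l) (by omega)
        exact ⟨this.1, fun h => absurd h this.2⟩
      · have := (S.late y hy).2.2 k (by omega)
        exact ⟨this.1.symm, fun h => by have := this.2 h; omega⟩)
  have hbs : ∀ y ∈ L ∪ insert v (b '' Set.Icc 0 i), b s ≠ y ∧
      (G.Adj (b s) y → y = p n ∨ y = b t ∨ y = v ∨ y = b i) := by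
    rintro y (hy | (rfl | ⟨k, ⟨_, hk⟩, rfl⟩))
    · rcases hLm y hy with rfl | rfl | hy
      · exact ⟨S.pb n le_rfl s (by omega), fun _ => .inl rfl⟩
      · exact ⟨S.seq.ne (by omega) (by omega) (by omega), fun _ => .inr (.inl rfl)⟩
      · have := (S.late y hy).2.2 s (by omega)
        exact ⟨this.1, fun h => by have := this.2 h.symm; omega⟩
    · exact ⟨S.bv s (by omega), fun _ => .inr (.inr (.inl rfl))⟩
    · refine ⟨S.seq.ne (by omega) (by omega) (by omega), fun h => ?_⟩
      rw [S.seq.adj _ (by omega) _ (by omega)] at h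
      have : k = i := by omega
      rw [this]; simp
  have ast : G.Adj (b s) (b t) := (S.seq.adj _ (by omega) _ (by omega)).2 (.inl hs)
  have asi : G.Adj (b s) (b i) := (S.seq.adj _ (by omega) _ (by omega)).2 (.inr his)
  have o := hole.odd hG (z := b s) (x := p n) (y := v) (fun h => (hbs _ h).1 rfl)
    (.inl hLp.left_mem) (by simp) hcs.symm S.vs.symm hc.1 (fun h => hc.2 h.symm)
  have e : G.neighborSet (b s) ∩ (L ∪ insert v (b '' Set.Icc 0 i)) = {p n, b t, v, b i} := by
    ext y
    constructor
    · rintro ⟨h, hy⟩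
      exact (hbs y hy).2 h
    · rintro (rfl | rfl | rfl | rfl)
      · exact ⟨hcs.symm, .inl hLp.left_mem⟩
      · exact ⟨ast, .inl hLp.right_mem⟩
      · exact ⟨S.vs.symm, by simp⟩
      · exact ⟨asi, .inr hT.left_mem⟩
  rw [e, Set.ncard_insert_of_notMem, Set.ncard_insert_of_notMem, Set.ncard_pair] at o
  · revert o; decide
  · exact (S.bv i (by omega)).symm
  · rintro (h | h)
    · exact S.bv t (by omega) h
    · exact S.seq.ne (by omega : t ≤ l) (by omega : i ≤ l) (by omega) h
  · rintro (h | h | h)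
    · exact S.pb n le_rfl t (by omega) h.symm
    · exact hc.1 h
    · exact S.pb n le_rfl i (by omega) h.symm

/-- Only `t = 2` needs more than the preceding lemmas. Then `p n` sees `b 1`, so by `clique` it
misses `b l`; if it also sees `b 0`, there is the even wheel with `i = 0`, and if not,
`false_of_near` applies. -/
theorem false_of_one (S : Short G v b l Q q₁ q₂ p n t s m) (hs : s = 1) : False := by
  subst hs
  have ht := S.tl; have hst := S.st; have hm := S.mn
  have hc := S.pv n le_rfl
  by_cases ht3 : 3 ≤ t
  · by_cases hc0 : G.Adj (p n) (b 0)
    · exact S.false_of_end hG rfl ht3 (.inl rfl) hc0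
    by_cases hcl : G.Adj (p n) (b l)
    · exact S.false_of_end hG rfl ht3 (.inr rfl) hcl
    exact S.false_of_near hG rfl hc0 hcl
  · have ht2 : t = 2 := by omega
    subst ht2
    obtain ⟨k, h1, h2, hck⟩ := S.nbr
    have hk : k = 1 := by omega
    subst hk
    by_cases hc0 : G.Adj (p n) (b 0)
    · exact S.false_of_wheel hG rfl hc0 rfl hck (by intros; omega)
    · refine S.false_of_near hG rfl hc0 ?_
      exact S.clique hG hc.1 hc.2 (by omega) le_rfl (by omega) S.vs S.vl hck

end Short

end

section

open SimpleGraph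

variable {V : Type*} {G : SimpleGraph V}

namespace Short

variable {v q₁ q₂ : V} {b p : ℕ → V} {l n t s m : ℕ} {Q : Set V}
variable [Finite V]
variable (hG : IsC4FreeOddSignable G)

include hG

/-- The case in which `b 0` has exactly one neighbour `z` among `p n` and `b j, …, b s`. -/
theorem false_of_single (S : Short G v b l Q q₁ q₂ p n t s m) (hs : s + 1 = t) {j : ℕ} {z : V}
    (hj : 0 < j) (hjs : j ≤ s) (hcj : G.Adj (p n) (b j))
    (hmax : ∀ k, j < k → k < t → ¬ G.Adj (p n) (b k))
    (hz : z = p n ∧ G.Adj (p n) (b 0) ∧ 2 ≤ j ∨ z = b 1 ∧ ¬ G.Adj (p n) (b 0) ∧ j = 1 ∧ 2 ≤ s) :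
    False := by
  classical
  have ht := S.tl; have hst := S.st; have hm := S.mn
  have hc := S.pv n le_rfl
  have hzv : ¬ G.Adj v z ∧ z ≠ v := by
    rcases hz with ⟨rfl, -, -⟩ | ⟨rfl, -, h, h2⟩
    · exact ⟨hc.2, hc.1⟩
    · exact ⟨fun h => by have := S.uniq 1 (by omega) (by omega) h; omega, S.bv 1 (by omega)⟩
  have hz0 : G.Adj (b 0) z := by
    rcases hz with ⟨rfl, h, -⟩ | ⟨rfl, -, -⟩
    · exact h.symm
    · exact (S.seq.adj _ (by omega) _ (by omega)).2 (.inl rfl)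
  -- the path `b s, …, b j, p n`
  have hA : IPath G (insert (p n) (b '' Set.Icc j s)) (b s) (p n) := by
    refine ((S.seq.iPath hjs (by omega)).cons' hcj ?_).symm
    rintro _ ⟨k, ⟨h1, h2⟩, rfl⟩
    refine ⟨S.pb n le_rfl k (by omega), fun h => ?_⟩
    by_cases hkj : k = j
    · rw [hkj]
    · exact absurd h (hmax k (by omega) (by omega))
  have hA0 : ∀ y ∈ insert (p n) (b '' Set.Icc j s), b 0 ≠ y ∧ (G.Adj (b 0) y → y = z) := by
    rintro y (rfl | ⟨k, ⟨h1, h2⟩, rfl⟩)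
    · refine ⟨S.pb n le_rfl 0 (by omega), fun h => ?_⟩
      rcases hz with ⟨h', -⟩ | ⟨-, h', -⟩
      · exact h'.symm
      · exact absurd h.symm h'
    · refine ⟨S.seq.ne (by omega) (by omega) (by omega), fun h => ?_⟩
      rw [S.seq.adj _ (by omega) _ (by omega)] at h
      rcases hz with ⟨_, _, h'⟩ | ⟨rfl, _, h'⟩
      · omega
      · have : k = 1 := by omega
        rw [this]
  have hAz : z ∈ insert (p n) (b '' Set.Icc j s) := by
    rcases hz with ⟨rfl, -⟩ | ⟨rfl, -, rfl, _⟩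
    · simp
    · exact .inr ⟨1, ⟨le_rfl, hjs⟩, rfl⟩
  have hAv : ∀ y ∈ insert (p n) (b '' Set.Icc j s), y ≠ v ∧ (G.Adj v y → y = b s) := by
    rintro y (rfl | ⟨k, ⟨h1, h2⟩, rfl⟩)
    · exact ⟨hc.1, fun h => absurd h hc.2⟩
    · exact ⟨S.bv k (by omega), fun h => by rw [S.uniq k (by omega) (by omega) h]⟩
  have far0l := S.seq.far (by omega : s ≤ l) (le_refl l) (by omega)
  -- In this case the path `b s, …, b j`, `p n` closes up through `b l` and `v`, and `b 0` sees
  -- exactly `v` and `z` on the hole.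
  by_cases hcl : G.Adj (p n) (b l)
  · have hp : IPath G (insert (b l) (insert (p n) (b '' Set.Icc j s))) (b l) (b s) := by
      refine hA.symm.cons' hcl.symm ?_
      rintro y (rfl | ⟨k, ⟨h1, h2⟩, rfl⟩)
      · exact ⟨(S.pb n le_rfl l le_rfl).symm, fun _ => rfl⟩
      · have := S.seq.far (by omega : k ≤ l) (le_refl l) (by omega)
        exact ⟨this.1, fun h => absurd h.symm this.2⟩
    have hole := hp.isHole (w := v) (by
        rintro (h | h)
        · exact S.bv l le_rfl h.symm
        · exact (hAv v h).1 rfl) S.vl S.vs (by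
        rintro y (rfl | hy) h
        · exact .inl rfl
        · exact .inr ((hAv y hy).2 h)) far0l.1.symm fun h => far0l.2 h.symm
    have hb0 : ∀ y ∈ insert v (insert (b l) (insert (p n) (b '' Set.Icc j s))), b 0 ≠ y ∧
        (G.Adj (b 0) y → y = v ∨ y = z) := by
      rintro y (rfl | rfl | hy)
      · exact ⟨S.bv 0 (by omega), fun _ => .inl rfl⟩
      · have := S.seq.far (by omega : 0 ≤ l) (le_refl l) (by omega)
        exact ⟨this.1, fun h => absurd h this.2⟩
      · exact ⟨(hA0 y hy).1, fun h => .inr ((hA0 y hy).2 h)⟩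
    have o := hole.odd hG (z := b 0) (x := v) (y := z) (fun h => (hb0 _ h).1 rfl) (by simp)
      (.inr (.inr hAz)) S.v0.symm hz0 hzv.2.symm hzv.1
    have e : G.neighborSet (b 0) ∩ insert v (insert (b l) (insert (p n) (b '' Set.Icc j s))) =
        {v, z} := by
      ext y
      constructor
      · rintro ⟨h, hy⟩
        exact (hb0 y hy).2 h
      · rintro (rfl | rfl)
        · exact ⟨S.v0.symm, by simp⟩
        · exact ⟨hz0, .inr (.inr hAz)⟩
    rw [e, Set.ncard_pair hzv.2.symm] at o
    revert o; decide
  -- a path from `p 0` to `b l`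
  obtain ⟨y₀, hy₀, hpy₀⟩ := S.p0
  have hp0 := S.pv 0 (by omega)
  obtain ⟨Y, hY, hYp⟩ : Reach G (insert (p 0) (insert (b l) Q)) (p 0) (b l) :=
    (((S.path.reach_mem hy₀ S.path.left_mem).mono (by clear * -; intro; simp; tauto)).snoc (by simp)
      S.al.symm).cons (by simp) hpy₀
  have hYm : ∀ y ∈ Y, y = p 0 ∨ y = b l ∨ y ∈ Q := fun y hy => hY hy
  have mY := hYp.left_mem
  have nY := hYp.right_mem
  have hYv : ∀ y ∈ Y, y ≠ v ∧ (G.Adj v y → y = b l) := by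
    intro y hy
    rcases hYm y hy with rfl | rfl | hy
    · exact ⟨hp0.1, fun h => absurd h hp0.2⟩
    · exact ⟨S.bv l le_rfl, fun _ => rfl⟩
    · exact ⟨(S.Qv y hy).1, fun h => absurd h (S.Qv y hy).2⟩
  have hY0 : ∀ y ∈ Y, b 0 ≠ y := by
    intro y hy
    rcases hYm y hy with rfl | rfl | hy
    · exact S.pb 0 (by omega) 0 (by omega)
    · exact S.seq.ne (by omega) le_rfl (by omega)
    · exact S.Qb y hy 0 (by omega)
  have hYp' : ∀ k, 1 ≤ k → k ≤ n → ∀ y ∈ Y, y ≠ p 0 → p k ≠ y ∧ ¬ G.Adj (p k) y := by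
    intro k h1 h2 y hy hy0
    rcases hYm y hy with rfl | rfl | hy
    · exact absurd rfl hy0
    · refine ⟨(S.pb k h2 l le_rfl).symm, fun h => ?_⟩
      by_cases hkn : k = n
      · subst hkn; exact hcl h
      · have := S.att1 k h1 (by omega) l le_rfl h
        omega
    · have := S.pQ k h2 y hy
      exact ⟨this.1, fun h => by have := this.2 h; omega⟩
  have hYt : ∀ k, 0 < k → k ≤ t → ∀ y ∈ Y, y ≠ p 0 → b k ≠ y ∧ ¬ G.Adj (b k) y := by
    intro k h1 h2 y hy hy0
    rcases hYm y hy with rfl | rfl | hy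
    · exact absurd rfl hy0
    · exact S.seq.far (by omega) le_rfl (by omega)
    · refine ⟨S.Qb y hy k (by omega), fun h => ?_⟩
      rcases S.Qadj y hy k (by omega) h with ⟨h, _⟩ | ⟨h, _⟩ <;> omega
  have hfin := Set.toFinite (G.neighborSet (b 0) ∩ Y)
  have hvY : v ∉ Y := fun h => (hYv v h).1 rfl
  -- first hole
  have even : Even (G.neighborSet (b 0) ∩ Y).ncard := by
    obtain ⟨j₀, ⟨hj₀, hpj⟩, hmin⟩ : ∃ i, (i < n ∧ G.Adj (p i) (b t)) ∧
        ∀ k, k < i → ¬ (k < n ∧ G.Adj (p k) (b t)) :=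
      have h : ∃ i, i < n ∧ G.Adj (p i) (b t) := ⟨m, hm, S.mt⟩
      ⟨Nat.find h, Nat.find_spec h, fun k => Nat.find_min h⟩
    have hg : IPath G (p '' Set.Icc 0 j₀ ∪ Y) (p j₀) (b l) := by
      refine (S.pseq.iPath (Nat.zero_le j₀) (by omega)).symm.glue hYp ?_
      rintro _ ⟨⟨k, ⟨_, hk⟩, rfl⟩, hk0⟩ y ⟨hy, hy0⟩
      have hk0 : k ≠ 0 := fun h => hk0 (by rw [h]; rfl)
      exact hYp' k (by omega) (by omega) y hy hy0
    have hg' : IPath G (insert (b t) (p '' Set.Icc 0 j₀ ∪ Y)) (b t) (b l) := by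
      refine hg.cons' hpj.symm ?_
      have key : ∀ k ≤ j₀, p k ≠ b t ∧ (G.Adj (b t) (p k) → p k = p j₀) := by
        intro k hk
        refine ⟨(S.pb k (by omega) t (by omega)).symm, fun h => ?_⟩
        by_cases hkj : k = j₀
        · rw [hkj]
        · exact absurd ⟨by omega, h.symm⟩ (hmin k (by omega))
      rintro y (⟨k, ⟨_, hk⟩, rfl⟩ | hy)
      · exact key k hk
      · by_cases hy0 : y = p 0
        · rw [hy0]; exact key 0 (by omega)
        · have := hYt t (by omega) le_rfl y hy hy0
          exact ⟨this.1.symm, fun h => absurd h this.2⟩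
    have fartl := S.seq.far (by omega : t ≤ l) (le_refl l) (by omega)
    have hole := hg'.isHole (w := v) (by
        rintro (h | ⟨k, ⟨_, hk⟩, h⟩ | h)
        · exact S.bv t (by omega) h.symm
        · exact (S.pv k (by omega)).1 h
        · exact hvY h) S.vt S.vl (by
        rintro y (rfl | ⟨k, ⟨_, hk⟩, rfl⟩ | hy) h
        · exact .inl rfl
        · exact absurd h (S.pv k (by omega)).2
        · exact .inr ((hYv y hy).2 h)) fartl.1 fartl.2
    have hb0 : ∀ y ∈ insert v (insert (b t) (p '' Set.Icc 0 j₀ ∪ Y)), b 0 ≠ y ∧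
        (G.Adj (b 0) y → y = v ∨ y ∈ Y) := by
      rintro y (rfl | rfl | ⟨k, ⟨_, hk⟩, rfl⟩ | hy)
      · exact ⟨S.bv 0 (by omega), fun _ => .inl rfl⟩
      · have := S.seq.far (by omega : 0 ≤ l) (by omega : t ≤ l) (by omega)
        exact ⟨this.1, fun h => absurd h this.2⟩
      · refine ⟨S.pb k (by omega) 0 (by omega), fun h => ?_⟩
        by_cases hk0 : k = 0
        · rw [hk0]; exact .inr mY
        · have := S.att1 k (by omega) (by omega) 0 (by omega) h.symm
          omega
      · exact ⟨hY0 y hy, fun _ => .inr hy⟩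
    -- An odd number of neighbours of `b 0` in `Y` becomes even with `v`, although `v` is
    -- nonadjacent to the neighbours in `Y`.
    by_contra hodd
    rw [Nat.not_even_iff_odd] at hodd
    obtain ⟨y, h0y, hy⟩ : (G.neighborSet (b 0) ∩ Y).Nonempty := by
      by_contra h
      rw [Set.not_nonempty_iff_eq_empty] at h
      rw [h] at hodd
      revert hodd; simp
    have o := hole.odd hG (z := b 0) (x := v) (y := y) (fun h => (hb0 _ h).1 rfl) (by simp)
      (.inr (.inr (.inr hy))) S.v0.symm h0y (hYv y hy).1.symm (fun h => by
        have := (hYv y hy).2 h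
        rw [this] at h0y
        exact (S.seq.far (by omega : 0 ≤ l) (le_refl l) (by omega)).2 h0y)
    have e : G.neighborSet (b 0) ∩ insert v (insert (b t) (p '' Set.Icc 0 j₀ ∪ Y)) =
        insert v (G.neighborSet (b 0) ∩ Y) := by
      ext y
      constructor
      · rintro ⟨h, hy⟩
        rcases (hb0 y hy).2 h with rfl | hy
        · exact .inl rfl
        · exact .inr ⟨h, hy⟩
      · rintro (rfl | ⟨h, hy⟩)
        · exact ⟨S.v0.symm, by simp⟩
        · exact ⟨h, .inr (.inr (.inr hy))⟩
    rw [e, Set.ncard_insert_of_notMem (fun h => hvY h.2)] at o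
    exact Nat.not_even_iff_odd.2 o (hodd.add_one)
  -- second hole
  have hg : IPath G (p '' Set.Icc 0 n ∪ Y) (p n) (b l) := by
    refine (S.pseq.iPath (Nat.zero_le n) le_rfl).symm.glue hYp ?_
    rintro _ ⟨⟨k, ⟨_, hk⟩, rfl⟩, hk0⟩ y ⟨hy, hy0⟩
    have hk0 : k ≠ 0 := fun h => hk0 (by rw [h]; rfl)
    exact hYp' k (by omega) hk y hy hy0
  have hg' : IPath G (insert (p n) (b '' Set.Icc j s) ∪ (p '' Set.Icc 0 n ∪ Y)) (b s) (b l) := by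
    refine hA.glue hg ?_
    rintro y ⟨(rfl | ⟨k, ⟨h1, h2⟩, rfl⟩), hyn⟩ x ⟨hx, hxn⟩
    · exact absurd rfl hyn
    have key : ∀ i < n, b k ≠ p i ∧ ¬ G.Adj (b k) (p i) := by
      intro i hi
      refine ⟨S.pb i hi.le k (by omega), fun h => ?_⟩
      by_cases hi0 : i = 0
      · subst hi0
        have := S.att0 k (by omega) h.symm
        omega
      · have := S.att1 i (by omega) hi k (by omega) h.symm
        omega
    rcases hx with ⟨i, ⟨_, hi⟩, rfl⟩ | hx
    · have : i ≠ n := fun h => hxn (by rw [h]; rfl)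
      exact key i (by omega)
    · by_cases hx0 : x = p 0
      · rw [hx0]; exact key 0 (by omega)
      · exact hYt k (by omega) (by omega) x hx hx0
  have hole := hg'.isHole (w := v) (by
      rintro (h | ⟨k, ⟨_, hk⟩, h⟩ | h)
      · exact (hAv v h).1 rfl
      · exact (S.pv k hk).1 h
      · exact hvY h) S.vs S.vl (by
      rintro y (hy | ⟨k, ⟨_, hk⟩, rfl⟩ | hy) h
      · exact .inl ((hAv y hy).2 h)
      · exact absurd h (S.pv k hk).2
      · exact .inr ((hYv y hy).2 h)) far0l.1 far0l.2
  have hb0 : ∀ y ∈ insert v (insert (p n) (b '' Set.Icc j s) ∪ (p '' Set.Icc 0 n ∪ Y)), b 0 ≠ y ∧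
      (G.Adj (b 0) y → y = v ∨ y = z ∨ y ∈ Y) := by
    rintro y (rfl | hy | ⟨k, ⟨_, hk⟩, rfl⟩ | hy)
    · exact ⟨S.bv 0 (by omega), fun _ => .inl rfl⟩
    · exact ⟨(hA0 y hy).1, fun h => .inr (.inl ((hA0 y hy).2 h))⟩
    · by_cases hkn : k = n
      · rw [hkn]
        exact ⟨S.pb n le_rfl 0 (by omega), fun h => .inr (.inl ((hA0 _ (by simp)).2 h))⟩
      · refine ⟨S.pb k (by omega) 0 (by omega), fun h => ?_⟩
        by_cases hk0 : k = 0
        · rw [hk0]; exact .inr (.inr mY)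
        · have := S.att1 k (by omega) (by omega) 0 (by omega) h.symm
          omega
    · exact ⟨hY0 y hy, fun _ => .inr (.inr hy)⟩
  -- On this hole `b 0` sees `v`, `z` and an even number of vertices of `Y`.
  have o := hole.odd hG (z := b 0) (x := v) (y := z) (fun h => (hb0 _ h).1 rfl) (by simp)
    (.inr (.inl hAz)) S.v0.symm hz0 hzv.2.symm hzv.1
  have hzY : z ∉ Y := by
    intro h
    rcases hz with ⟨rfl, -⟩ | ⟨rfl, -, -, -⟩
    · rcases hYm _ h with h | h | h
      · exact S.pseq.ne le_rfl (by omega) (by omega) h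
      · exact S.pb n le_rfl l le_rfl h.symm
      · exact (S.pQ n le_rfl _ h).1 rfl
    · rcases hYm _ h with h | h | h
      · exact S.pb 0 (by omega) 1 (by omega) h
      · exact S.seq.ne (by omega : 1 ≤ l) le_rfl (by omega) h
      · exact S.Qb _ h 1 (by omega) rfl
  have e : G.neighborSet (b 0) ∩ insert v (insert (p n) (b '' Set.Icc j s) ∪
      (p '' Set.Icc 0 n ∪ Y)) = insert v (insert z (G.neighborSet (b 0) ∩ Y)) := by
    ext y
    constructor
    · rintro ⟨h, hy⟩
      rcases (hb0 y hy).2 h with rfl | rfl | hy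
      · exact .inl rfl
      · exact .inr (.inl rfl)
      · exact .inr (.inr ⟨h, hy⟩)
    · rintro (rfl | rfl | ⟨h, hy⟩)
      · exact ⟨S.v0.symm, by simp⟩
      · exact ⟨hz0, .inr (.inl hAz)⟩
      · exact ⟨h, .inr (.inr (.inr hy))⟩
  rw [e, Set.ncard_insert_of_notMem, Set.ncard_insert_of_notMem (fun h => hzY h.2)] at o
  · rw [Nat.odd_iff] at o
    rw [Nat.even_iff] at even
    omega
  · rintro (h | h)
    · exact hzv.2 h.symm
    · exact hvY h.2

/-- The case in which `b 0` has no neighbour among `p n` and `b j, …, b s`, or is adjacent to both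
`p n` and `b j`. -/
theorem false_of_last (S : Short G v b l Q q₁ q₂ p n t s m) (hs : s + 1 = t) (hs2 : 2 ≤ s) :
    False := by
  have ht := S.tl; have hst := S.st; have hm := S.mn
  obtain ⟨i, j, hi, hij, hjt, hci, hcj, hu, -, his⟩ := S.exists_nbrs hG
  have his := his hs hs2
  have hjs : j ≤ s := by omega
  have hc := S.pv n le_rfl
  have hmax : ∀ k, j < k → k < t → ¬ G.Adj (p n) (b k) := fun k h1 h2 h =>
    absurd (hu k (by omega) h2 h).2 (by omega)
  have A := S.toAtt
  have hsp : ∀ k, 0 < k → k < s → ¬ G.Adj v (b k) := fun k h1 h2 h => by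
    have := S.uniq k h1 (by omega) h
    omega
  -- the set `p m, …, p n, b t` against the others
  have hpv : ∀ y ∈ insert (p n) (insert (b t) (p '' Set.Icc m (n - 1))),
      y ≠ v ∧ (G.Adj y v → y = b t) := by
    rintro y (rfl | rfl | hy)
    · exact ⟨hc.1, fun h => absurd h.symm hc.2⟩
    · exact ⟨S.bv t (by omega), fun _ => rfl⟩
    · exact ⟨(S.late y hy).1, fun h => absurd h.symm (S.late y hy).2.1⟩
  have hpb : ∀ y ∈ insert (p n) (insert (b t) (p '' Set.Icc m (n - 1))), ∀ k < t,
      y ≠ b k ∧ (G.Adj y (b k) → y = p n ∨ y = b t ∧ k = s) := by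
    rintro y (rfl | rfl | hy) k hk
    · exact ⟨(S.pb n le_rfl k (by omega)).symm, fun _ => .inl rfl⟩
    · refine ⟨S.seq.ne (by omega) (by omega) (by omega), fun h => .inr ⟨rfl, ?_⟩⟩
      rw [S.seq.adj _ (by omega) _ (by omega)] at h
      omega
    · have := (S.late y hy).2.2 k (by omega)
      exact ⟨this.1.symm, fun h => by have := this.2 h; omega⟩
  by_cases hc0 : G.Adj (p n) (b 0)
  -- For `j = 1` there is a prism with triangles `p n`, `b 0`, `b 1` and `b t`, `v`, `b s`.
  · by_cases hj1 : j = 1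
    · subst hj1
      have hi1 : i = 1 := by omega
      subst hi1
      refine prism_free hG (X := insert (p n) (insert (b t) (p '' Set.Icc m (n - 1))))
        (Y := {b 0, v}) (Z := b '' Set.Icc 1 s) hc0 hcj
        ((S.seq.adj 0 (by omega) 1 (by omega)).2 (.inl rfl)) S.vt.symm
        ((S.seq.adj t (by omega) s (by omega)).2 (.inr hs)) S.vs
        (S.pb n le_rfl t (by omega)).symm (S.bv 0 (by omega))
        (S.seq.ne (by omega) (by omega) (by omega)) S.reach_t
        (Reach.edge (by simp) (by simp) S.v0.symm)
        (S.seq.reach (by omega) (by omega) fun k h1 h2 => ⟨k, ⟨h1, h2⟩, rfl⟩) ?_ ?_ ?_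
      · rintro y hy z (rfl | rfl)
        · refine ⟨(hpb y hy 0 (by omega)).1, fun h => ?_⟩
          rcases (hpb y hy 0 (by omega)).2 h with h | ⟨_, h⟩
          · exact .inl ⟨h, rfl⟩
          · omega
        · exact ⟨(hpv y hy).1, fun h => .inr ⟨(hpv y hy).2 h, rfl⟩⟩
      · rintro y hy _ ⟨k, ⟨h1, h2⟩, rfl⟩
        refine ⟨(hpb y hy k (by omega)).1, fun h => ?_⟩
        rcases (hpb y hy k (by omega)).2 h with rfl | ⟨rfl, rfl⟩
        · have : k = 1 := by
            have := hu k (by omega) (by omega) h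
            omega
          exact .inl ⟨rfl, by rw [this]⟩
        · exact .inr ⟨rfl, rfl⟩
      · rintro y (rfl | rfl) _ ⟨k, ⟨h1, h2⟩, rfl⟩
        · refine ⟨S.seq.ne (by omega) (by omega) (by omega), fun h => .inl ⟨rfl, ?_⟩⟩
          rw [S.seq.adj _ (by omega) _ (by omega)] at h
          have : k = 1 := by omega
          rw [this]
        · exact ⟨(S.bv k (by omega)).symm, fun h => .inr ⟨rfl, by
            rw [S.uniq k (by omega) (by omega) h]⟩⟩
    · exact S.false_of_single hG hs (by omega) hjs hcj hmax (.inl ⟨rfl, hc0, by omega⟩)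
  by_cases hj1 : j = 1
  · exact S.false_of_single hG hs (by omega) hjs hcj hmax (.inr ⟨rfl, hc0, hj1, hs2⟩)
  -- From here `p n` misses `b 0` and its last neighbour is beyond `b 1`. A single neighbour gives a
  -- theta with ends `b i` and `b 0`; two consecutive ones give an even wheel if `j = s` and a prism
  -- otherwise; nonconsecutive extremes give a theta with ends `p n` and `b 0`.
  by_cases hij' : i = j
  · subst hij'
    refine theta_free' hG (a := b i) (b := b 0) (X := b '' Set.Icc 1 (i - 1))
      (Y := insert (p n) (Q ∪ p '' {i | i < n})) (Z := b '' Set.Icc (i + 1) s ∪ {v})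
      (S.seq.ne (by omega) (by omega) (by omega)) (S.seq.far (by omega) (by omega) (by omega)).2
      ?_ ?_ ?_ ?_ ?_ ?_
    · refine S.seq.reach_symm (i := 0) (j := i) (by omega) (by omega) fun k h1 h2 => ?_
      by_cases hk0 : k = 0
      · subst hk0; simp
      by_cases hki : k = i
      · subst hki; simp
      exact .inr (.inr ⟨k, ⟨by omega, by omega⟩, rfl⟩)
    · exact (A.reach0.mono (by clear * -; intro; simp; tauto)).cons (by simp) hci.symm
    · refine ((S.seq.reach (i := i) (j := s) (by omega) (by omega) fun k h1 h2 => ?_).snoc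
        (by simp) S.vs.symm).snoc (by simp) S.v0
      by_cases hki : k = i
      · subst hki; simp
      exact .inr (.inr (.inl ⟨k, ⟨by omega, by omega⟩, rfl⟩))
    · rintro _ ⟨k, ⟨h1, h2⟩, rfl⟩ y (rfl | hy)
      · exact ⟨S.pb n le_rfl k (by omega), fun h => by
          have := hu k (by omega) (by omega) h.symm; omega⟩
      · have := A.anti_seg (i := 1) (j := i - 1) (by omega) (by omega) y hy _ ⟨k, ⟨h1, h2⟩, rfl⟩
        exact ⟨this.1.symm, fun h => this.2 h.symm⟩
    · exact Att.anti_union (A.anti_segs (by omega) (by omega))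
        (A.anti_seg_v (by omega) fun k h1 h2 => hsp k (by omega) (by omega))
    · rintro y (rfl | hy)
      · rintro z (⟨k, ⟨h1, h2⟩, rfl⟩ | rfl)
        · exact ⟨(S.pb n le_rfl k (by omega)).symm, fun h => by
            have := hu k (by omega) (by omega) h; omega⟩
        · exact ⟨hc.1, fun h => hc.2 h.symm⟩
      · exact Att.anti_union (A.anti_seg (by omega) (by omega)) A.anti_v y hy
  by_cases hij2 : i + 1 = j
  · by_cases hjs' : j = s
    · subst hjs'
      refine S.false_of_wheel hG hs hci hij2 hcj fun k hk h => ?_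
      by_cases hk0 : k = 0
      · subst hk0; exact hc0 h
      · have := hu k (by omega) (by omega) h; omega
    · refine prism_free hG (X := insert (p n) (insert (b t) (p '' Set.Icc m (n - 1))))
        (Y := insert v (b '' Set.Icc 0 i)) (Z := b '' Set.Icc j s) hci hcj
        ((S.seq.adj i (by omega) j (by omega)).2 (.inl hij2)) S.vt.symm
        ((S.seq.adj t (by omega) s (by omega)).2 (.inr hs)) S.vs
        (S.pb n le_rfl t (by omega)).symm (S.bv i (by omega))
        (S.seq.ne (by omega) (by omega) hjs') S.reach_t
        ((S.seq.reach_symm (Nat.zero_le i) (by omega)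
          fun k h1 h2 => .inr ⟨k, ⟨h1, h2⟩, rfl⟩).snoc (by simp) S.v0.symm)
        (S.seq.reach hjs (by omega) fun k h1 h2 => ⟨k, ⟨h1, h2⟩, rfl⟩) ?_ ?_ ?_
      · rintro y hy z (rfl | ⟨k, ⟨_, hk⟩, rfl⟩)
        · exact ⟨(hpv y hy).1, fun h => .inr ⟨(hpv y hy).2 h, rfl⟩⟩
        · refine ⟨(hpb y hy k (by omega)).1, fun h => ?_⟩
          rcases (hpb y hy k (by omega)).2 h with rfl | ⟨_, h⟩
          · have : k = i := by
              by_cases hk0 : k = 0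
              · subst hk0; exact absurd h hc0
              · have := hu k (by omega) (by omega) h; omega
            exact .inl ⟨rfl, by rw [this]⟩
          · omega
      · rintro y hy _ ⟨k, ⟨h1, h2⟩, rfl⟩
        refine ⟨(hpb y hy k (by omega)).1, fun h => ?_⟩
        rcases (hpb y hy k (by omega)).2 h with rfl | ⟨rfl, rfl⟩
        · have : k = j := by
            have := hu k (by omega) (by omega) h
            omega
          exact .inl ⟨rfl, by rw [this]⟩
        · exact .inr ⟨rfl, rfl⟩
      · rintro y (rfl | ⟨k', ⟨_, hk'⟩, rfl⟩) _ ⟨k, ⟨h1, h2⟩, rfl⟩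
        · exact ⟨(S.bv k (by omega)).symm, fun h => .inr ⟨rfl, by
            rw [S.uniq k (by omega) (by omega) h]⟩⟩
        · refine ⟨S.seq.ne (by omega) (by omega) (by omega), fun h => .inl ?_⟩
          rw [S.seq.adj _ (by omega) _ (by omega)] at h
          have : k = j := by omega
          have : k' = i := by omega
          exact ⟨by congr, by congr⟩
  · refine theta_free' hG (a := p n) (b := b 0) (X := Q ∪ p '' {i | i < n})
      (Y := b '' Set.Icc 1 i) (Z := b '' Set.Icc j s ∪ {v}) (S.pb n le_rfl 0 (by omega)).symm hc0
      A.reach0 ?_ ?_ ?_ ?_ ?_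
    · refine (S.seq.reach_symm (Nat.zero_le i) (by omega) fun k h1 h2 => ?_).cons (by simp) hci
      by_cases hk0 : k = 0
      · subst hk0; simp
      · exact .inr (.inr ⟨k, ⟨by omega, by omega⟩, rfl⟩)
    · exact (((S.seq.reach hjs (by omega)
        fun k h1 h2 => .inr (.inr (.inl ⟨k, ⟨h1, h2⟩, rfl⟩))).snoc
          (by simp) S.vs.symm).cons (by simp) hcj).snoc (by simp) S.v0
    · exact A.anti_seg (by omega) (by omega)
    · exact Att.anti_union (A.anti_seg (by omega) (by omega)) A.anti_v
    · exact Att.anti_union (A.anti_segs (by omega) (by omega))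
        (A.anti_seg_v (by omega) fun k h1 h2 => hsp k (by omega) (by omega))

end Short

end

/-! ### Eliminating every path from `Q` to a target. -/

section

open SimpleGraph

variable {V : Type*} {G : SimpleGraph V}

/-- By `hmid`, only `α + 1` and `ω - 1` can satisfy `P` strictly inside. Together with the two ends,
an odd count leaves exactly one value there. -/
theorem exists_single_of_odd {P : ℕ → Prop} {α ω : ℕ} (h : α < ω) (hα : P α) (hω : P ω)
    (hmid : ∀ k, α + 2 ≤ k → k + 2 ≤ ω → ¬ P k)
    (hodd : Odd {k | (α ≤ k ∧ k ≤ ω) ∧ P k}.ncard) :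
    ∃ s, α < s ∧ s < ω ∧ P s ∧ (s = α + 1 ∨ s + 1 = ω) ∧ ∀ k, α < k → k < ω → P k → k = s := by
  have hin : ∀ k, α < k → k < ω → P k → k = α + 1 ∨ k + 1 = ω := by
    intro k h1 h2 hk
    by_contra hno
    exact hmid k (by omega) (by omega) hk
  by_cases hs : α + 1 < ω ∧ P (α + 1)
  · refine ⟨α + 1, by omega, hs.1, hs.2, .inl rfl, fun k h1 h2 hk => ?_⟩
    by_contra hne
    have hkω : k + 1 = ω := by
      rcases hin k h1 h2 hk with h | h
      · exact absurd h hne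
      · exact h
    have : {k | (α ≤ k ∧ k ≤ ω) ∧ P k} = (({α, α + 1, k, ω} : Finset ℕ) : Set ℕ) := by
      ext j
      simp only [Set.mem_ofPred_eq, Finset.coe_insert, Finset.coe_singleton, Set.mem_insert_iff,
        Set.mem_singleton_iff]
      constructor
      · rintro ⟨⟨h3, h4⟩, hj⟩
        by_contra hno
        have := hin j (by omega) (by omega) hj
        omega
      · rintro (rfl | rfl | rfl | rfl)
        · exact ⟨⟨by omega, by omega⟩, hα⟩
        · exact ⟨⟨by omega, by omega⟩, hs.2⟩
        · exact ⟨⟨by omega, by omega⟩, hk⟩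
        · exact ⟨⟨by omega, by omega⟩, hω⟩
    rw [this, Set.ncard_coe_finset, Finset.card_insert_of_notMem (by simp; omega),
      Finset.card_insert_of_notMem (by simp; omega),
      Finset.card_pair (by omega)] at hodd
    revert hodd; decide
  · by_cases hs' : α < ω - 1 ∧ P (ω - 1)
    · refine ⟨ω - 1, hs'.1, by omega, hs'.2, .inr (by omega), fun k h1 h2 hk => ?_⟩
      rcases hin k h1 h2 hk with rfl | h
      · exact absurd ⟨h2, hk⟩ hs
      · omega
    · have : {k | (α ≤ k ∧ k ≤ ω) ∧ P k} = {α, ω} := by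
        ext j
        simp only [Set.mem_ofPred_eq, Set.mem_insert_iff, Set.mem_singleton_iff]
        constructor
        · rintro ⟨⟨h3, h4⟩, hj⟩
          by_contra hno
          rcases hin j (by omega) (by omega) hj with rfl | h
          · exact hs ⟨by omega, hj⟩
          · exact hs' ⟨by omega, by rwa [show ω - 1 = j by omega]⟩
        · rintro (rfl | rfl)
          · exact ⟨⟨by omega, by omega⟩, hα⟩
          · exact ⟨⟨by omega, by omega⟩, hω⟩
      rw [this, Set.ncard_pair (by omega)] at hodd
      exact absurd hodd (by decide)

namespace Conf

variable {v q₁ q₂ : V} {b p : ℕ → V} {l n : ℕ} {Q : Set V}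

/-- The last attachment before and the first attachment after a target. -/
theorem exists_anchors (C : Conf G v b l Q q₁ q₂ p n) {τ : ℕ} (hτ : Tgt G v b l τ) :
    ∃ α ω, α < τ ∧ τ < ω ∧ ω ≤ l ∧ (α = 0 ∨ ∃ i < n, G.Adj (p i) (b α)) ∧
      (ω = l ∨ ∃ i < n, G.Adj (p i) (b ω)) ∧
      ∀ k, α < k → k < ω → ∀ i < n, ¬ G.Adj (p i) (b k) := by
  classical
  have h1 := hτ.1; have h2 := hτ.2.1
  let A : ℕ → Prop := fun k => k = 0 ∨ ∃ i < n, G.Adj (p i) (b k)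
  have hα : A (Nat.findGreatest A (τ - 1)) :=
    Nat.findGreatest_spec (m := 0) (by omega) (.inl rfl)
  have hαm : ∀ k, Nat.findGreatest A (τ - 1) < k → k ≤ τ - 1 → ¬ A k :=
    fun k h1 h2 => Nat.findGreatest_is_greatest h1 h2
  have hαl := Nat.findGreatest_le (P := A) (τ - 1)
  have hex : ∃ k, τ < k ∧ (k = l ∨ ∃ i < n, G.Adj (p i) (b k)) := ⟨l, h2, .inl rfl⟩
  obtain ⟨hω1, hω2⟩ := Nat.find_spec hex
  refine ⟨_, Nat.find hex, hαl.trans_lt (Nat.sub_lt h1 Nat.one_pos), hω1, Nat.find_min' hex ⟨h2, .inl rfl⟩, hα, hω2, ?_⟩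
  intro k hk1 hk2 i hi h
  rcases lt_trichotomy k τ with hk | rfl | hk
  · exact hαm k hk1 (Nat.le_sub_one_of_lt hk) (.inr ⟨i, hi, h⟩)
  · exact C.ntgt i hi k hτ h
  · exact Nat.find_min hex hk2 ⟨hk, .inr ⟨i, hi, h⟩⟩

variable [Finite V]
variable (hG : IsC4FreeOddSignable G)

include hG

/-- Between consecutive attachments around the neighbour of `p n` there is a single spoke. -/
theorem exists_single (C : Conf G v b l Q q₁ q₂ p n) {τ α ω : ℕ} (hτ : Tgt G v b l τ)
    (hpτ : G.Adj (p n) (b τ)) (hατ : α < τ) (hτω : τ < ω) (hωl : ω ≤ l)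
    (hα : α = 0 ∨ ∃ i < n, G.Adj (p i) (b α)) (hω : ω = l ∨ ∃ i < n, G.Adj (p i) (b ω))
    (hno : ∀ k, α < k → k < ω → ∀ i < n, ¬ G.Adj (p i) (b k)) :
    (∀ k, α + 2 ≤ k → k + 2 ≤ ω → ¬ G.Adj v (b k)) ∧
    ∃ s, α < s ∧ s < ω ∧ G.Adj v (b s) ∧ (s = α + 1 ∨ s + 1 = ω) ∧
      ∀ k, α < k → k < ω → G.Adj v (b k) → k = s := by
  have oα : G.Adj v (b α) ∧ Odd (cnt G v b α) := by
    rcases hα with rfl | ⟨i, hi, h⟩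
    · exact ⟨C.v0, by rw [cnt_zero C.v0]; decide⟩
    · exact C.odd_of_adj hi (by omega) h
  have oω : G.Adj v (b ω) ∧ Odd (cnt G v b ω) := by
    rcases hω with rfl | ⟨i, hi, h⟩
    · exact ⟨C.vl, C.hodd⟩
    · exact C.odd_of_adj hi (by omega) h
  have hodd : Odd {k | (α ≤ k ∧ k ≤ ω) ∧ G.Adj v (b k)}.ncard := by
    have h1 := cnt_interval (by omega : α ≤ ω) oα.1
    have h2 := oα.2; have h3 := oω.2
    rw [Nat.odd_iff] at *
    omega
  have hmid : ∀ k, α + 2 ≤ k → k + 2 ≤ ω → ¬ G.Adj v (b k) := by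
    intro k h1 h2 hk
    -- The vertex `p n` plays the part of `c`. Since the rank of `b α` is odd, counting from `b α`
    -- does not change the parity of the rank of `b τ`.
    have A := C.att (by omega) hωl oα.1 oω.1 hα hω hno
    refine A.contra hG (m := k - α) (by omega) (by omega)
      (by rwa [show α + (k - α) = k by omega]) ?_ (t := τ - α) (by omega) (by omega)
      (by rwa [show α + (τ - α) = τ by omega]) ?_
    · rw [← show α + (ω - α) = ω by omega, cnt_shift] at hodd
      exact hodd
    · rw [show α + (τ - α) = τ by omega]
      intro hv
      have h3 := hτ.2.2 hv
      have h4 := cnt_interval hατ.le oα.1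
      rw [show {k | (α ≤ k ∧ k ≤ τ) ∧ G.Adj v (b k)} =
        {k | (α ≤ k ∧ k ≤ α + (τ - α)) ∧ G.Adj v (b k)} by
          rw [show α + (τ - α) = τ by omega], cnt_shift, cnt] at h4
      have h5 := oα.2
      rw [Nat.even_iff] at *
      rw [Nat.odd_iff] at h5
      omega
  exact ⟨hmid, exists_single_of_odd (by omega) oα.1 oω.1 hmid hodd⟩

/-- The end of `p` has no neighbour that is a target, when the next attachment is inner. -/
theorem contra_aux (C : Conf G v b l Q q₁ q₂ p n) {τ α ω : ℕ} (hτ : Tgt G v b l τ)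
    (hpτ : G.Adj (p n) (b τ)) (hατ : α < τ) (hτω : τ < ω) (hωl : ω < l)
    (hα : α = 0 ∨ ∃ i < n, G.Adj (p i) (b α)) (hω : ∃ i < n, G.Adj (p i) (b ω))
    (hno : ∀ k, α < k → k < ω → ∀ i < n, ¬ G.Adj (p i) (b k)) : False := by
  obtain ⟨-, s, hαs, hsω, hvs, hs, huniq⟩ :=
    C.exists_single hG hτ hpτ hατ hτω hωl.le hα (.inr hω) hno
  obtain ⟨m, hm, hmω⟩ := hω
  have oω := C.odd_of_adj hm hωl.le hmω
  have hfar := far_of_odd hωl.ne oω ⟨C.vl, C.hodd⟩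
  have htl : ω + 2 ≤ l := by clear hα; omega
  -- By `unique_attach` and `attach_eq`, the vertices of `p` strictly between its ends attach to `b
  -- ω` only, and `p 0` at most to `b ω`, `b 0` or `b l`. Hence `α = 0`.
  have att1 : ∀ j, 0 < j → j < n → ∀ k ≤ l, G.Adj (p j) (b k) → k = ω := by
    intro j hj hjn k hk h
    by_cases hm0 : m = 0
    · subst hm0
      exact C.attach_eq hG (by omega) hωl hmω hj hjn hk h
    · rcases le_total j m with hjm | hjm
      · exact C.unique_attach hG (m - j) hj (by omega) hk hωl.le h
          (by rwa [show j + (m - j) = m by omega])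
      · exact (C.unique_attach hG (j - m) (by omega) (by omega) hωl.le hk hmω
          (by rwa [show m + (j - m) = j by omega])).symm
  have att0 : ∀ k ≤ l, G.Adj (p 0) (b k) → k = ω ∨ k = 0 ∨ k = l := by
    intro k hk h
    by_contra hno'
    have hm0 : m ≠ 0 := by
      rintro rfl
      exact hno' (.inl (C.clique_p hG hm hk hωl.le h hmω))
    have := C.attach_eq hG (by omega) (by omega) h (by omega) hm hωl.le hmω
    omega
  have attm : ∀ j, m ≤ j → j < n → ∀ k ≤ l, G.Adj (p j) (b k) → k = ω := by
    intro j hmj hj k hk h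
    by_cases hj0 : j = 0
    · obtain rfl : m = 0 := by omega
      subst hj0
      exact C.clique_p hG hj hk hωl.le h hmω
    · exact att1 j (by omega) hj k hk h
  obtain rfl : α = 0 := by
    rcases hα with h | ⟨i, hi, h⟩
    · exact h
    · by_cases hi0 : i = 0
      · subst hi0
        have := att0 α (by omega) h
        omega
      · have := att1 i (by omega) hi α (by omega) h
        omega
  have S : Short G v b l Q q₁ q₂ p n ω s m :=
    ⟨C, hm, hmω, oω.1, hvs, hsω, htl, huniq, att1, att0, attm, τ, hατ, hτω, hpτ⟩
  by_cases hs1 : s = 1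
  · exact S.false_of_one hG hs1
  · exact S.false_of_last hG (by omega) (by omega)

/-- If the anchors around the target are `0` and `l`, then `exists_single` excludes the spoke `b m`.
Otherwise one anchor is inner, and it is the upper one after reversing `b` if necessary. -/
theorem contra (C : Conf G v b l Q q₁ q₂ p n) {m : ℕ} (hm : 2 ≤ m) (hml : m + 2 ≤ l)
    (hvm : G.Adj v (b m)) {τ : ℕ} (hτ : Tgt G v b l τ) (hpτ : G.Adj (p n) (b τ)) : False := by
  obtain ⟨α, ω, hατ, hτω, hωl, hα, hω, hno⟩ := C.exists_anchors hτ
  by_cases hω' : ω = l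
  · by_cases hα' : α = 0
    · subst hα' hω'
      exact (C.exists_single hG hτ hpτ hατ hτω hωl hα hω hno).1 m (by omega) hml hvm
    · have h1 : l - (l - α) = α := by omega
      have h2 : l - (l - ω) = ω := by omega
      have h3 : l - (l - τ) = τ := by omega
      refine C.mirror.contra_aux hG (τ := l - τ) (α := l - ω) (ω := l - α) ?_ (by rwa [h3])
        (by omega) (by omega) (by omega) ?_ ?_ ?_
      · have := C.mirror.hodd
        -- Reversing twice restores `b` only at indices up to `l`, so the counts are compared index
        -- by index.
        refine Tgt.mirror (b := fun i => b (l - i)) this ?_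
        refine ⟨hτ.1, hτ.2.1, fun h => ?_⟩
        have h4 : ∀ k ≤ τ, l - (l - k) = k := fun k hk => by have := hτ.2.1; omega
        simp only [h4 τ le_rfl] at h
        have h5 := hτ.2.2 h
        rw [cnt] at h5 ⊢
        convert h5 using 3
        ext k
        refine and_congr_right fun hk => ?_
        rw [h4 k hk]
      · left; omega
      · rw [h1]
        exact hα.resolve_left hα'
      · intro k h4 h5 i hi
        exact hno (l - k) (by omega) (by omega) i hi
  · exact C.contra_aux hG hτ hpτ hατ hτω (by omega) hα (hω.resolve_left hω') hno

end Conf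

end

/-! ### Rings dominated by a connected set. -/

section

open SimpleGraph

variable {V : Type*} {G : SimpleGraph V}

/-- Starting `W` at its last vertex with a neighbour in `Q` and stopping at the next vertex with a
target neighbour leaves contact with `Q` at the first vertex only and contact with targets at the
last only. Vertices of `W` avoid all of `b`: inner non-spokes are targets, and the vertices of `W`
are not spokes. -/
theorem Conf.exists_of_iPath [Finite V] (hG : IsC4FreeOddSignable G) {v q₁ q₂ : V} {b : ℕ → V}
    {l : ℕ} {Q : Set V} (R : HubRing G v b l Q q₁ q₂) {W : Set V} {c d : V} (hW : IPath G W c d)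
    (hWv : ∀ y ∈ W, y ≠ v ∧ ¬ G.Adj v y) (hWQ : ∀ y ∈ W, y ∉ Q)
    (hWb : ∀ y ∈ W, ∀ j, Tgt G v b l j → b j ≠ y) (hc : ∃ y ∈ Q, G.Adj c y)
    (hd : ∃ j, Tgt G v b l j ∧ G.Adj d (b j)) :
    ∃ p n τ, Conf G v b l Q q₁ q₂ p n ∧ Tgt G v b l τ ∧ G.Adj (p n) (b τ) := by
  obtain ⟨z, S₁, S₂, hs, hz, hzl⟩ :=
    hW.exists_last (p := fun x => ∃ y ∈ Q, G.Adj x y) ⟨c, hW.left_mem, hc⟩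
  obtain ⟨u, T₁, T₂, ht, ⟨τ, hτ, hu⟩, hul⟩ := hs.right.exists_first
    (p := fun x => ∃ j, Tgt G v b l j ∧ G.Adj x (b j)) ⟨d, hs.right.right_mem, hd⟩
  obtain ⟨p, n, hp, h0, hn, hT⟩ := ht.left.exists_iSeq
  have hpW : ∀ i ≤ n, p i ∈ T₁ := fun i hi => hT ▸ ⟨i, ⟨i.zero_le, hi⟩, rfl⟩
  have hpS : ∀ i ≤ n, p i ∈ S₂ := fun i hi => ht.subset_left (hpW i hi)
  have hpw : ∀ i ≤ n, p i ∈ W := fun i hi => hs.subset_right (hpS i hi)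
  refine ⟨p, n, τ, ⟨R, R.odd hG, hp, fun i hi => hWv _ (hpw i hi), ?_, ?_, ?_, ?_⟩, hτ, hn ▸ hu⟩
  · intro i hi j hj e
    have hv := (hWv _ (hpw i hi)).2
    rw [← e] at hv
    refine hWb _ (hpw i hi) j ⟨?_, ?_, fun h => absurd h hv⟩ e
    · by_contra h
      obtain rfl : j = 0 := by omega
      exact hv R.v0
    · by_contra h
      obtain rfl : j = l := by omega
      exact hv R.vl
  · intro i hi y hy
    refine ⟨fun e => hWQ _ (hpw i hi) (e ▸ hy), fun e => ?_⟩
    have := hzl _ (hpS i hi) ⟨y, hy, e⟩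
    exact hp.inj i hi 0 (by omega) (this.trans h0.symm)
  · exact h0 ▸ hz
  · intro i hi j hj e
    have := hul _ (hpW i hi.le) ⟨j, hj, e⟩
    have := hp.inj i hi.le n le_rfl (this.trans hn.symm)
    omega

/-- A ring with an inner spoke far from both ends is not in the closed neighbourhood of a connected
set avoiding the neighbours of the hub. -/
theorem HubRing.contra [Finite V] (hG : IsC4FreeOddSignable G) {v q₁ q₂ : V} {b : ℕ → V}
    {l : ℕ} {Q : Set V} (R : HubRing G v b l Q q₁ q₂) {D : Set V}
    (hD : ∀ x ∈ D, ∀ y ∈ D, Reach G D x y) (hDv : ∀ y ∈ D, y ≠ v ∧ ¬ G.Adj v y) (hQ : Q ⊆ D)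
    (hb : ∀ i ≤ l, ¬ G.Adj v (b i) → b i ∈ D) (hb' : ∀ i ≤ l, G.Adj v (b i) → ∃ y ∈ D, G.Adj y (b i))
    {m : ℕ} (hm : 2 ≤ m) (hml : m + 2 ≤ l) (hvm : G.Adj v (b m)) : False := by
  obtain ⟨τ, hτ⟩ : ∃ τ, Tgt G v b l τ := by
    by_cases h : Tgt G v b l m
    · exact ⟨m, h⟩
    -- If `b m` is no target, its rank is odd, so the preceding vertex, should it be a spoke, has
    -- even rank.
    · refine ⟨m - 1, by omega, by omega, fun hv => ?_⟩
      have h1 : ¬ Even (cnt G v b m) := fun h' => h ⟨by omega, by omega, fun _ => h'⟩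
      have h2 := cnt_succ (G := G) (v := v) (b := b) (j := m - 1)
        (by rwa [show m - 1 + 1 = m by omega])
      rw [show m - 1 + 1 = m by omega] at h2
      rw [Nat.even_iff] at *
      omega
  have hr : Reach G (insert (b τ) D) q₁ (b τ) := by
    by_cases hv : G.Adj v (b τ)
    · obtain ⟨y, hy, e⟩ := hb' τ hτ.2.1.le hv
      exact ((hD q₁ (hQ R.path.left_mem) y hy).mono (Set.subset_insert _ _)).snoc (by simp) e
    · exact (hD q₁ (hQ R.path.left_mem) _ (hb τ hτ.2.1.le hv)).mono (Set.subset_insert _ _)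
  obtain ⟨S, hSD, hS⟩ := hr
  obtain ⟨x, S₁, S₂, hs, ⟨j, hj, hx⟩, hxl⟩ := hS.exists_first
    (p := fun x => ∃ j, Tgt G v b l j ∧ b j = x) ⟨_, hS.right_mem, τ, hτ, rfl⟩
  obtain ⟨y, T₁, T₂, ht, hy, hyl⟩ := hs.left.exists_last (p := fun x => x ∈ Q)
    ⟨_, hs.left.left_mem, R.path.left_mem⟩
  have hyx : y ≠ x := fun e => R.Qb y hy j hj.2.1.le (hx.trans e.symm)
  obtain ⟨y', hyy', hT', -⟩ := ht.right.tail hyx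
  -- Vertices of `Q` see only the two ends of `b`, and targets are inner, so at least one vertex
  -- remains between `y` and the target `x`.
  have hyx' : y' ≠ x := by
    rintro rfl
    have := hj.1; have := hj.2.1
    rw [← hx] at hyy'
    rcases R.Qadj y hy j hj.2.1.le hyy'.symm with h | h
    · have := h.1; omega
    · have := h.1; omega
  obtain ⟨x', hxx', hT'', -⟩ := hT'.symm.tail hyx'.symm
  have hmem : ∀ z ∈ (T₂ \ {y}) \ {x}, z ∈ T₂ ∧ z ∈ S₁ ∧ z ≠ y ∧ z ≠ x := fun z hz =>
    ⟨hz.1.1, ht.subset_right hz.1.1, hz.1.2, hz.2⟩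
  have htgt : ∀ z ∈ (T₂ \ {y}) \ {x}, ∀ j, Tgt G v b l j → b j ≠ z := fun z hz j hj e =>
    (hmem z hz).2.2.2 (hxl z (hmem z hz).2.1 ⟨j, hj, e⟩)
  obtain ⟨p, n, τ', C, hτ', hpτ⟩ := Conf.exists_of_iPath hG R hT''.symm
    (fun z hz => by
      rcases hSD (hs.subset_left (hmem z hz).2.1) with h | h
      · exact absurd h.symm (htgt z hz τ hτ)
      · exact hDv z h)
    (fun z hz h => (hmem z hz).2.2.1 (hyl z (hmem z hz).1 h)) htgt ⟨y, hy, hyy'.symm⟩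
    ⟨j, hj, hx ▸ hxx'.symm⟩
  exact C.contra hG hm hml hvm hτ' hpτ

end

/-! ### Components of the complement of `N[v]`, and the ring of a wheel with a non-spoke. -/

section

open SimpleGraph

variable {V : Type*} {G : SimpleGraph V}

/-- A connected set `D` avoiding the closed neighbourhood of `v`, closed under adjacency outside
that neighbourhood. -/
structure Comp (G : SimpleGraph V) (v : V) (D : Set V) : Prop where
  conn : ∀ x ∈ D, ∀ y ∈ D, Reach G D x y
  avoid : ∀ y ∈ D, y ≠ v ∧ ¬ G.Adj v y
  closed : ∀ x ∈ D, ∀ y, G.Adj x y → y ≠ v → ¬ G.Adj v y → y ∈ D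

theorem IsComponentOfDelete.comp {v : V} {D : Set V}
    (h : IsComponentOfDelete G (closedNbhd G {v}) D) : Comp G v D := by
  obtain ⟨C, rfl⟩ := h
  have key : ∀ x y : ((closedNbhd G {v})ᶜ : Set V), (G.induce (closedNbhd G {v})ᶜ).Walk x y →
      x ∈ C.supp → Reach G (Subtype.val '' C.supp) x y := by
    intro x y p
    induction p with
    | nil => exact fun hx => .refl ⟨_, hx, rfl⟩
    | cons hab p ih =>
      intro hx
      refine (ih ?_).cons ⟨_, hx, rfl⟩ hab
      rw [ConnectedComponent.mem_supp_iff] at hx ⊢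
      rw [← hx]
      exact (ConnectedComponent.connectedComponentMk_eq_of_adj hab).symm
  refine ⟨?_, ?_, ?_⟩
  · rintro _ ⟨x, hx, rfl⟩ _ ⟨y, hy, rfl⟩
    obtain ⟨p⟩ := C.reachable_of_mem_supp hx hy
    exact key x y p hx
  · rintro _ ⟨x, hx, rfl⟩
    have := x.2
    simp only [closedNbhd, Set.mem_compl_iff, Set.mem_union, Set.mem_singleton_iff,
      Set.mem_ofPred_eq, exists_eq_left, not_or] at this
    exact this
  · rintro _ ⟨x, hx, rfl⟩ y hxy hyv hvy
    refine ⟨⟨y, ?_⟩, ?_, rfl⟩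
    · simp [closedNbhd, hyv, hvy]
    · rw [ConnectedComponent.mem_supp_iff] at hx ⊢
      rw [← hx]
      refine (ConnectedComponent.connectedComponentMk_eq_of_adj ?_).symm
      exact hxy

namespace Comp

variable {v : V} {D : Set V}

theorem mem (C : Comp G v D) {w : V} (hw : w ∈ closedNbhd G D) (hwv : w ≠ v)
    (hvw : ¬ G.Adj v w) : w ∈ D := by
  rcases hw with h | ⟨x, hx, h⟩
  · exact h
  · exact C.closed x hx w h hwv hvw

theorem exists_nbr (C : Comp G v D) {w : V} (hw : w ∈ closedNbhd G D) (hvw : G.Adj v w) :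
    ∃ y ∈ D, G.Adj y w := by
  rcases hw with h | ⟨x, hx, h⟩
  · exact absurd hvw (C.avoid w h).2
  · exact ⟨x, hx, h⟩

theorem hub_notMem (C : Comp G v D) : v ∉ closedNbhd G D := by
  rintro (h | ⟨x, hx, h⟩)
  · exact (C.avoid v h).1 rfl
  · exact (C.avoid x hx).2 h.symm

end Comp

theorem IsProperWheel.exists_indep [Finite V] {H : Set V} {v : V} (h : IsProperWheel G H v) :
    ∃ x y z, (x ∈ H ∧ y ∈ H ∧ z ∈ H) ∧ (G.Adj v x ∧ G.Adj v y ∧ G.Adj v z) ∧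
      (x ≠ y ∧ x ≠ z ∧ y ≠ z) ∧ ¬ G.Adj x y ∧ ¬ G.Adj x z ∧ ¬ G.Adj y z := by
  classical
  have := Fintype.ofFinite V
  obtain ⟨s, hs⟩ := (G.induce (G.neighborSet v ∩ H)).exists_isNIndepSet_indepNum
  have h3 : 2 < s.card := by
    have := h.2
    rw [hs.card_eq]
    exact this
  obtain ⟨x, y, z, hx, hy, hz, hxy, hxz, hyz⟩ := Finset.two_lt_card_iff.1 h3
  have hi := hs.isIndepSet
  refine ⟨x, y, z, ⟨x.2.2, y.2.2, z.2.2⟩, ⟨x.2.1, y.2.1, z.2.1⟩, ⟨?_, ?_, ?_⟩,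
    hi hx hy hxy, hi hx hz hxz, hi hy hz hyz⟩
  · exact fun e => hxy (Subtype.ext e)
  · exact fun e => hxz (Subtype.ext e)
  · exact fun e => hyz (Subtype.ext e)

/-- In a hole `w, f 0, …, f r`, the path from `w` to the vertex before `f i`. -/
theorem ISeq.exists_arm {f : ℕ → V} {r i : ℕ} {w : V} (hf : ISeq G f r)
    (hw : ∀ k ≤ r, f k ≠ w ∧ (G.Adj w (f k) → k = 0 ∨ k = r)) (h0 : G.Adj w (f 0)) (hi : i ≤ r) :
    ∃ q, IPath G (insert w (f '' {k | k < i})) w q ∧ G.Adj q (f i) ∧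
      ∀ k, i ≤ k → k ≤ r → ∀ y ∈ insert w (f '' {k | k < i}), f k ≠ y ∧
        (G.Adj (f k) y → k = i ∧ y = q ∨ k = r ∧ y = w) := by
  by_cases hi0 : i = 0
  · subst hi0
    refine ⟨w, by simpa using IPath.refl w, h0, fun k h1 h2 y hy => ?_⟩
    obtain rfl : y = w := by simpa using hy
    refine ⟨(hw k h2).1, fun e => ?_⟩
    rcases (hw k h2).2 e.symm with h | h
    · exact .inl ⟨h, rfl⟩
    · exact .inr ⟨h, rfl⟩
  · refine ⟨f (i - 1), ?_, (hf.adj _ (by omega) _ hi).2 (by omega), ?_⟩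
    · have := hf.iPath (Nat.zero_le (i - 1)) (by omega)
      rw [show {k | k < i} = Set.Icc 0 (i - 1) by
        ext k; simp only [Set.mem_ofPred_eq, Set.mem_Icc]; omega]
      refine this.cons' h0 ?_
      rintro _ ⟨k, ⟨h1, h2⟩, rfl⟩
      refine ⟨(hw k (by omega)).1, fun e => ?_⟩
      have := (hw k (by omega)).2 e
      rw [show k = 0 by omega]
    · rintro k h1 h2 y (rfl | ⟨j, hj, rfl⟩)
      · refine ⟨(hw k h2).1, fun e => ?_⟩
        have := (hw k h2).2 e.symm
        exact .inr ⟨by omega, rfl⟩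
      · have hj' : j < i := hj
        refine ⟨hf.ne h2 (by omega) (by omega), fun e => ?_⟩
        have := (hf.adj _ h2 _ (by omega)).1 e
        exact .inl ⟨by omega, by rw [show j = i - 1 by omega]⟩

/-- A hole with a vertex not adjacent to the hub, divided at its outermost spokes. -/
theorem IsHole.exists_ring {H : Set V} (hH : IsHole G H) {v w : V} (hv : v ∉ H) (hw : w ∈ H)
    (hvw : ¬ G.Adj v w) {x y z : V} (hm : x ∈ H ∧ y ∈ H ∧ z ∈ H)
    (ha : G.Adj v x ∧ G.Adj v y ∧ G.Adj v z) (hne : x ≠ y ∧ x ≠ z ∧ y ≠ z)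
    (hxy : ¬ G.Adj x y) (hxz : ¬ G.Adj x z) (hyz : ¬ G.Adj y z) :
    ∃ b l Q q₁ q₂ m, HubRing G v b l Q q₁ q₂ ∧ (∀ i ≤ l, b i ∈ H) ∧ Q ⊆ H ∧ 2 ≤ m ∧ m + 2 ≤ l ∧
      G.Adj v (b m) := by
  classical
  obtain ⟨a, c, hac, hnac, hwa, hwc, hp, hu⟩ := hH.open_at hw
  obtain ⟨f, r, hf, h0, hr, hS⟩ := hp.exists_iSeq
  have hfH : ∀ k ≤ r, f k ∈ H \ {w} := fun k hk => hS ▸ ⟨k, ⟨k.zero_le, hk⟩, rfl⟩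
  have hfw : ∀ k ≤ r, f k ≠ w ∧ (G.Adj w (f k) → k = 0 ∨ k = r) := by
    intro k hk
    refine ⟨(hfH k hk).2, fun e => ?_⟩
    rcases hu _ (hfH k hk).1 e with h | h
    · exact .inl (hf.inj k hk 0 (by omega) (h.trans h0.symm))
    · exact .inr (hf.inj k hk r le_rfl (h.trans hr.symm))
  have hidx : ∀ y ∈ H, G.Adj v y → ∃ k ≤ r, f k = y := by
    intro y hy hvy
    have : y ∈ H \ {w} := ⟨hy, fun e => hvw (e ▸ hvy)⟩
    rw [hS] at this
    obtain ⟨k, ⟨_, hk⟩, e⟩ := this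
    exact ⟨k, hk, e⟩
  obtain ⟨k₁, hk₁, rfl⟩ := hidx x hm.1 ha.1
  obtain ⟨k₂, hk₂, rfl⟩ := hidx y hm.2.1 ha.2.1
  obtain ⟨k₃, hk₃, rfl⟩ := hidx z hm.2.2 ha.2.2
  have far : ∀ j k, j ≤ r → k ≤ r → f j ≠ f k → ¬ G.Adj (f j) (f k) → j + 1 < k ∨ k + 1 < j := by
    intro j k hj hk h1 h2
    rw [hf.adj j hj k hk] at h2
    by_contra hno
    exact h1 (by rw [show j = k by omega])
  have f₁₂ := far _ _ hk₁ hk₂ hne.1 hxy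
  have f₁₃ := far _ _ hk₁ hk₃ hne.2.1 hxz
  have f₂₃ := far _ _ hk₂ hk₃ hne.2.2 hyz
  -- The first and last spokes met when leaving and re-entering `w` bound the path `b`; the rest of
  -- the hole, containing `w`, becomes `Q`.
  obtain ⟨i, ⟨hir, hvi⟩, hmin⟩ : ∃ i, (i ≤ r ∧ G.Adj v (f i)) ∧ ∀ k ≤ r, G.Adj v (f k) → i ≤ k :=
    have h : ∃ i, i ≤ r ∧ G.Adj v (f i) := ⟨k₁, hk₁, ha.1⟩
    ⟨Nat.find h, Nat.find_spec h, fun k hk e => Nat.find_min' h ⟨hk, e⟩⟩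
  obtain ⟨j, ⟨hjr, hvj⟩, hmax⟩ : ∃ j, (j ≤ r ∧ G.Adj v (f (r - j))) ∧
      ∀ k ≤ r, G.Adj v (f k) → j ≤ r - k :=
    have h : ∃ j, j ≤ r ∧ G.Adj v (f (r - j)) :=
      ⟨r - k₁, by omega, by rw [show r - (r - k₁) = k₁ by omega]; exact ha.1⟩
    ⟨Nat.find h, Nat.find_spec h, fun k hk e => Nat.find_min' h
      ⟨by omega, by rwa [show r - (r - k) = k by omega]⟩⟩
  have b₁ := hmin _ hk₁ ha.1; have b₂ := hmin _ hk₂ ha.2.1; have b₃ := hmin _ hk₃ ha.2.2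
  have c₁ := hmax _ hk₁ ha.1; have c₂ := hmax _ hk₂ ha.2.1; have c₃ := hmax _ hk₃ ha.2.2
  obtain ⟨q₂, hq₂, hq₂i, hq₂u⟩ := hf.exists_arm hfw (h0 ▸ hwa) hir
  obtain ⟨q₁, hq₁, hq₁i, hq₁u⟩ := hf.mirror.exists_arm (w := w) (i := j)
    (fun k hk => ⟨(hfw _ (by omega)).1, fun e => by have := (hfw _ (by omega)).2 e; omega⟩)
    (by rw [Nat.sub_zero, hr]; exact hwc) hjr
  set A := insert w (f '' {k | k < i}) with hA
  set B := insert w ((fun k => f (r - k)) '' {k | k < j}) with hB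
  have hAB : ∀ y ∈ B ∪ A, y = w ∨ ∃ k ≤ r, (k < i ∨ r - j < k) ∧ y = f k := by
    rintro y ((h | ⟨k, hk, rfl⟩) | (h | ⟨k, hk, rfl⟩))
    · exact .inl h
    · have hk' : k < j := hk
      exact .inr ⟨r - k, by omega, by omega, rfl⟩
    · exact .inl h
    · have hk' : k < i := hk
      exact .inr ⟨k, by omega, by omega, rfl⟩
  have hpath : IPath G (B ∪ A) q₁ q₂ := by
    refine hq₁.symm.glue hq₂ ?_
    rintro _ ⟨rfl | ⟨k, hk, rfl⟩, h1⟩ _ ⟨rfl | ⟨k', hk', rfl⟩, h2⟩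
    · exact absurd rfl h1
    · exact absurd rfl h1
    · exact absurd rfl h2
    · have e1 : k < j := hk
      have e2 : k' < i := hk'
      exact hf.far (by omega) (by omega) (by omega)
  have hmem : ∀ k, k ≤ r - j - i → f (i + k) ∈ H := fun k hk => (hfH _ (by omega)).1
  have hsub : B ∪ A ⊆ H := by
    intro y hy
    rcases hAB y hy with rfl | ⟨k, hk, -, rfl⟩
    · exact hw
    · exact (hfH k hk).1
  have R : HubRing G v (fun k => f (i + k)) (r - j - i) (B ∪ A) q₁ q₂ := by
    refine ⟨hf.shift (by omega), fun k hk e => hv (e ▸ hmem k hk), hvi, ?_, hpath, ?_, ?_, ?_,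
      hq₂i.symm, ?_, by omega⟩
    · rwa [show i + (r - j - i) = r - j by omega]
    · intro y hy
      refine ⟨fun e => hv (e ▸ hsub hy), fun e => ?_⟩
      rcases hAB y hy with rfl | ⟨k, hk, h, rfl⟩
      · exact hvw e
      · have := hmin k hk e; have := hmax k hk e
        omega
    · intro y hy k hk
      rcases hAB y hy with rfl | ⟨k', hk', h, rfl⟩
      · exact (hfw _ (by omega)).1
      · exact hf.ne (by omega) hk' (by omega)
    · intro y hy k hk e
      have hA' := fun hyA : y ∈ A => (hq₂u (i + k) (by omega) (by omega) y hyA).2 e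
      have hB' := fun hyB : y ∈ B => (hq₁u (r - (i + k)) (by omega) (by omega) y hyB).2
        (by rwa [show r - (r - (i + k)) = i + k by omega])
      have hwA : w ∈ A := Set.mem_insert _ _
      have hwB : w ∈ B := Set.mem_insert _ _
      rcases hy with hy | hy
      · rcases hB' hy with ⟨h1, h2⟩ | ⟨h1, h2⟩
        · exact .inr ⟨by omega, h2⟩
        · rcases hA' (h2 ▸ hwA) with ⟨h3, h4⟩ | ⟨h3, h4⟩
          · exact .inl ⟨by omega, h4⟩
          · omega
      · rcases hA' hy with ⟨h1, h2⟩ | ⟨h1, h2⟩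
        · exact .inl ⟨by omega, h2⟩
        · rcases hB' (h2 ▸ hwB) with ⟨h3, h4⟩ | ⟨h3, h4⟩
          · exact .inr ⟨by omega, h4⟩
          · omega
    · rw [show i + (r - j - i) = r - j by omega]; exact hq₁i.symm
  -- Of three pairwise nonadjacent spokes, the middle one is at distance at least two from both
  -- outermost spokes.
  have hex : ∃ k, (k = k₁ ∨ k = k₂ ∨ k = k₃) ∧ i + 2 ≤ k ∧ k + 2 ≤ r - j := by
    by_cases h1 : i + 2 ≤ k₁ ∧ k₁ + 2 ≤ r - j
    · exact ⟨k₁, .inl rfl, h1⟩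
    by_cases h2 : i + 2 ≤ k₂ ∧ k₂ + 2 ≤ r - j
    · exact ⟨k₂, .inr (.inl rfl), h2⟩
    exact ⟨k₃, .inr (.inr rfl), by omega⟩
  obtain ⟨k, hk, hk1, hk2⟩ := hex
  refine ⟨_, _, _, _, _, k - i, R, hmem, hsub, by omega, by omega, ?_⟩
  show G.Adj v (f (i + (k - i)))
  rw [show i + (k - i) = k by omega]
  rcases hk with rfl | rfl | rfl
  exacts [ha.1, ha.2.1, ha.2.2]

end

/-! ### Wheels whose hub is adjacent to the whole rim. -/

section

open SimpleGraph

variable {V : Type*} {G : SimpleGraph V}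

/-- `b 0, …, b (n - 1), b n = b 0` is an induced cycle. -/
structure Cyc (G : SimpleGraph V) (b : ℕ → V) (n : ℕ) : Prop where
  wrap : b n = b 0
  inj : ∀ i < n, ∀ j < n, b i = b j → i = j
  adj : ∀ i j, i < j → j < n → (G.Adj (b i) (b j) ↔ i + 1 = j ∨ i = 0 ∧ j + 1 = n)

namespace Cyc

variable {b : ℕ → V} {n : ℕ}

theorem adj' (h : Cyc G b n) (hn : 3 ≤ n) {i j : ℕ} (hij : i < j) (hj : j ≤ n) :
    G.Adj (b i) (b j) ↔ i + 1 = j ∨ i = 0 ∧ j + 1 = n ∨ i = 1 ∧ j = n := by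
  rcases Nat.lt_or_eq_of_le hj with hj | rfl
  · rw [h.adj i j hij hj]; omega
  · rw [h.wrap, G.adj_comm]
    rcases Nat.eq_zero_or_pos i with rfl | hi
    · simp only [SimpleGraph.irrefl, false_iff]; omega
    · rw [h.adj 0 i hi hij]; omega

theorem eq_iff (h : Cyc G b n) {i j : ℕ} (hij : i < j) (hj : j ≤ n) :
    b i = b j ↔ i = 0 ∧ j = n := by
  rcases Nat.lt_or_eq_of_le hj with hj | rfl
  · refine ⟨fun e => ?_, fun e => by omega⟩
    have := h.inj i (by omega) j hj e
    omega
  · rw [h.wrap]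
    refine ⟨fun e => ⟨h.inj i hij 0 (by omega) e, rfl⟩, fun e => by rw [e.1]⟩

theorem mirror (h : Cyc G b n) (hn : 3 ≤ n) : Cyc G (fun i => b (n - i)) n where
  wrap := by simp [h.wrap]
  inj i hi j hj e := by
    by_contra hij
    rcases lt_or_gt_of_ne hij with h1 | h1
    · have := (h.eq_iff (by omega : n - j < n - i) (by omega)).1 e.symm
      omega
    · have := (h.eq_iff (by omega : n - i < n - j) (by omega)).1 e
      omega
  adj i j hij hj := by
    show G.Adj (b (n - i)) (b (n - j)) ↔ _
    rw [G.adj_comm, h.adj' hn (by omega : n - j < n - i) (by omega)]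
    omega

/-- The bound `l + 2 ≤ n` leaves out a vertex of the cycle, so the arc does not close up. Its last
index may be `n`, the second name of `0`. -/
theorem arc (h : Cyc G b n) (hn : 3 ≤ n) {i l : ℕ} (hl : l + 2 ≤ n) (hil : i + l ≤ n) :
    ISeq G (fun k => b (i + k)) l where
  inj j hj k hk e := by
    by_contra hjk
    rcases lt_or_gt_of_ne hjk with h1 | h1
    · have := (h.eq_iff (by omega : i + j < i + k) (by omega)).1 e
      omega
    · have := (h.eq_iff (by omega : i + k < i + j) (by omega)).1 e.symm
      omega
  adj j hj k hk := by
    show G.Adj (b (i + j)) (b (i + k)) ↔ _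
    rcases lt_trichotomy j k with h1 | rfl | h1
    · rw [h.adj' hn (by omega : i + j < i + k) (by omega)]
      omega
    · simp
    · rw [G.adj_comm, h.adj' hn (by omega : i + k < i + j) (by omega)]
      omega

end Cyc

theorem IsHole.exists_cyc {H : Set V} (hH : IsHole G H) {w : V} (hw : w ∈ H) :
    ∃ b n, 3 ≤ n ∧ Cyc G b n ∧ b 0 = w ∧ H = b '' Set.Iio n := by
  obtain ⟨a, c, hac, hnac, hwa, hwc, hp, hu⟩ := hH.open_at hw
  obtain ⟨f, r, hf, h0, hr, hS⟩ := hp.exists_iSeq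
  have hfH : ∀ k ≤ r, f k ∈ H \ {w} := fun k hk => hS ▸ ⟨k, ⟨k.zero_le, hk⟩, rfl⟩
  have hr0 : r ≠ 0 := by rintro rfl; exact hac (h0.symm.trans hr)
  have hb : ∀ i, i ≠ 0 → i < r + 2 →
      (if i = 0 ∨ i = r + 2 then w else f (i - 1)) = f (i - 1) := fun i h1 h2 => by
    rw [if_neg (by omega)]
  refine ⟨fun k => if k = 0 ∨ k = r + 2 then w else f (k - 1), r + 2, by omega,
    ⟨by simp, ?_, ?_⟩, by simp, ?_⟩
  · intro i hi j hj e
    by_cases hi0 : i = 0 <;> by_cases hj0 : j = 0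
    · omega
    · subst hi0
      simp only [hb j hj0 hj, true_or, if_true] at e
      exact absurd e.symm (hfH _ (by omega)).2
    · subst hj0
      simp only [hb i hi0 hi, true_or, if_true] at e
      exact absurd e (hfH _ (by omega)).2
    · simp only [hb j hj0 hj, hb i hi0 hi] at e
      have := hf.inj _ (by omega) _ (by omega) e
      omega
  · intro i j hij hj
    by_cases hi0 : i = 0
    · subst hi0
      simp only [hb j (by omega) hj, true_or, if_true]
      constructor
      · intro e
        rcases hu _ (hfH (j - 1) (by omega)).1 e with h | h
        · have := hf.inj _ (by omega) 0 (by omega) (h.trans h0.symm)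
          omega
        · have := hf.inj _ (by omega) r (by omega) (h.trans hr.symm)
          exact .inr ⟨trivial, by omega⟩
      · intro h
        rcases (by omega : j - 1 = 0 ∨ j - 1 = r) with h | h
        · rw [h, h0]; exact hwa
        · rw [h, hr]; exact hwc
    · simp only [hb j (by omega) hj, hb i hi0 (by omega)]
      rw [hf.adj _ (by omega) _ (by omega)]
      omega
  · ext x
    constructor
    · intro hx
      by_cases hxw : x = w
      · exact ⟨0, by simp, by simp [hxw]⟩
      · have : x ∈ H \ {w} := ⟨hx, hxw⟩
        rw [hS] at this
        obtain ⟨k, ⟨_, hk⟩, rfl⟩ := this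
        refine ⟨k + 1, by simp; omega, ?_⟩
        show (if k + 1 = 0 ∨ k + 1 = r + 2 then w else f (k + 1 - 1)) = f k
        rw [hb _ (by omega) (by omega), Nat.add_sub_cancel]
    · rintro ⟨k, hk, rfl⟩
      have hk' : k < r + 2 := hk
      by_cases hk0 : k = 0
      · subst hk0; simpa using hw
      · show (if k = 0 ∨ k = r + 2 then w else f (k - 1)) ∈ H
        rw [hb _ hk0 hk']
        exact (hfH _ (by omega)).1

variable [Finite V]
variable (hG : IsC4FreeOddSignable G)

include hG

/-- A path of spokes whose ends are joined by a path in a component has three vertices. -/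
theorem Comp.arc_eq_two {v : V} {D : Set V} (C : Comp G v D) {b p : ℕ → V} {l n : ℕ}
    (hb : ISeq G b l) (hl : 2 ≤ l) (hv : ∀ i ≤ l, G.Adj v (b i)) (hbD : ∀ i ≤ l, b i ∈ closedNbhd G D)
    (hp : ISeq G p n) (hn : n ≠ 0) (hpD : ∀ i ≤ n, p i ∈ D) (h0 : G.Adj (p 0) (b 0))
    (hl' : G.Adj (p n) (b l))
    (hx : ∀ i ≤ n, ∀ j ≤ l, G.Adj (p i) (b j) → i = 0 ∧ j = 0 ∨ i = n ∧ j = l) : l = 2 := by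
  have hbp : ∀ i ≤ n, ∀ j ≤ l, b j ≠ p i := by
    intro i hi j hj e
    exact (C.avoid _ (hpD i hi)).2 (e ▸ hv j hj)
  have hQ := hp.iPath (Nat.zero_le n) le_rfl
  have hB := hb.iPath (Nat.zero_le l) le_rfl
  have hole := hB.isHole_union hQ h0.symm hl'.symm (hb.ne (by omega) le_rfl (by omega))
    (hp.ne (by omega) le_rfl (Ne.symm hn)) (by
      rintro _ ⟨j, ⟨_, hj⟩, rfl⟩ _ ⟨i, ⟨_, hi⟩, rfl⟩
      refine ⟨hbp i hi j hj, fun e => ?_⟩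
      rcases hx i hi j hj e.symm with ⟨rfl, rfl⟩ | ⟨rfl, rfl⟩
      · exact .inl ⟨rfl, rfl⟩
      · exact .inr ⟨rfl, rfl⟩)
  have o := hole.odd hG (z := v) (x := b 0) (y := b l) (by
      rintro (⟨k, ⟨_, hk⟩, e⟩ | ⟨k, ⟨_, hk⟩, e⟩)
      · exact (hv k hk).ne e.symm
      · exact (C.avoid _ (hpD k hk)).1 e)
    (.inl ⟨0, by simp, rfl⟩) (.inl ⟨l, by simp, rfl⟩) (hv 0 (by omega)) (hv l le_rfl)
    (hb.far (by omega) le_rfl (by omega)).1 (hb.far (by omega) le_rfl (by omega)).2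
  rw [show G.neighborSet v ∩ (b '' Set.Icc 0 l ∪ p '' Set.Icc 0 n) = b '' Set.Icc 0 l by
    ext x
    constructor
    · rintro ⟨h, h' | ⟨k, ⟨_, hk⟩, rfl⟩⟩
      · exact h'
      · exact absurd h (C.avoid _ (hpD k hk)).2
    · rintro ⟨k, ⟨hk', hk⟩, rfl⟩
      exact ⟨hv k hk, .inl ⟨k, ⟨hk', hk⟩, rfl⟩⟩,
    Set.InjOn.ncard_image fun i hi j hj e => hb.inj i hi.2 j hj.2 e,
    show Set.Icc 0 l = ((Finset.Icc 0 l : Finset ℕ) : Set ℕ) by simp, Set.ncard_coe_finset,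
    Nat.card_Icc] at o
  -- All `l + 1` vertices of the arc are spokes, so `l` is even. From `l = 4` on, the arc and the
  -- path form a ring with the inner spoke `b 2`, against `HubRing.contra`.
  by_contra hl2
  have hl4 : 4 ≤ l := by
    rw [Nat.odd_iff] at o
    omega
  have R : HubRing G v b l (p '' Set.Icc 0 n) (p n) (p 0) := by
    refine ⟨hb, fun i hi => (hv i hi).ne', hv 0 (by omega), hv l le_rfl, hQ.symm, ?_, ?_, ?_,
      h0.symm, hl'.symm, hl4⟩
    · rintro _ ⟨k, ⟨_, hk⟩, rfl⟩
      exact C.avoid _ (hpD k hk)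
    · rintro _ ⟨k, ⟨_, hk⟩, rfl⟩ j hj
      exact hbp k hk j hj
    · rintro _ ⟨k, ⟨_, hk⟩, rfl⟩ j hj e
      rcases hx k hk j hj e.symm with ⟨rfl, rfl⟩ | ⟨rfl, rfl⟩
      · exact .inl ⟨rfl, rfl⟩
      · exact .inr ⟨rfl, rfl⟩
  refine R.contra hG C.conn C.avoid ?_ (fun i hi h => absurd (hv i hi) h)
    (fun i hi h => C.exists_nbr (hbD i hi) h) (m := 2) le_rfl hl4 (hv 2 (by omega))
  rintro _ ⟨k, ⟨_, hk⟩, rfl⟩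
  exact hpD k hk

/-- A shortest path of a component joining two nonadjacent rim vertices of a universal wheel bounds
the length of the rim on one side. -/
theorem Comp.side {v : V} {D : Set V} (C : Comp G v D) {b p : ℕ → V} {n μ k : ℕ}
    (hb : Cyc G b n) (hn : 3 ≤ n) (hv : ∀ i, i ≤ n → G.Adj v (b i))
    (hbD : ∀ i, i ≤ n → b i ∈ closedNbhd G D)
    (hp : ISeq G p μ) (hμ : μ ≠ 0) (hpD : ∀ i ≤ μ, p i ∈ D) (hk : 2 ≤ k) (hkn : k + 2 ≤ n)
    (h0 : G.Adj (p 0) (b 0)) (hμk : G.Adj (p μ) (b k))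
    (hmin : ∀ e f, e ≤ f → f ≤ μ → f < e + μ → ∀ s ≤ n, ∀ t ≤ n,
      G.Adj (p e) (b s) → G.Adj (p f) (b t) → b s = b t ∨ G.Adj (b s) (b t)) :
    ∃ i j, j ≤ i + 2 ∧ (i = 0 ∨ i = 1 ∧ G.Adj (p 0) (b 1)) ∧
      (j = k ∨ j + 1 = k ∧ G.Adj (p μ) (b (k - 1))) := by
  -- The arc is trimmed by one vertex at each end where the path also sees the next rim vertex.
  obtain ⟨i, hi⟩ : ∃ i, i = 0 ∧ ¬ G.Adj (p 0) (b 1) ∨ i = 1 ∧ G.Adj (p 0) (b 1) := by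
    by_cases h : G.Adj (p 0) (b 1)
    exacts [⟨1, .inr ⟨rfl, h⟩⟩, ⟨0, .inl ⟨rfl, h⟩⟩]
  obtain ⟨j, hj⟩ : ∃ j, j = k ∧ ¬ G.Adj (p μ) (b (k - 1)) ∨
      j + 1 = k ∧ G.Adj (p μ) (b (k - 1)) := by
    by_cases h : G.Adj (p μ) (b (k - 1))
    exacts [⟨k - 1, .inr ⟨by omega, h⟩⟩, ⟨k, .inl ⟨rfl, h⟩⟩]
  refine ⟨i, j, ?_, hi.imp (fun h => h.1) id, hj.imp (fun h => h.1) id⟩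
  by_contra hij
  have hi1 : i ≤ 1 := by rcases hi with h | h <;> omega
  have hjk : j ≤ k := by rcases hj with h | h <;> omega
  have hjk' : k ≤ j + 1 := by rcases hj with h | h <;> omega
  -- By minimality a proper subpath of `p` joins no two nonadjacent rim vertices. So every `p e`
  -- other than `p μ` attaches close to `b 0`, and every one other than `p 0` close to `b k`.
  have near0 : ∀ e < μ, ∀ s, 0 < s → s ≤ k → G.Adj (p e) (b s) → s = 1 := by
    intro e he s hs hsk h
    rcases hmin 0 e (by omega) he.le (by omega) 0 (by omega) s (by omega) h0 h with h1 | h1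
    · rw [hb.eq_iff hs (by omega)] at h1; omega
    · rw [hb.adj' hn hs (by omega)] at h1; omega
  have nearμ : ∀ e ≤ μ, 0 < e → ∀ s < k, G.Adj (p e) (b s) → s + 1 = k := by
    intro e he he0 s hs h
    rcases hmin e μ he le_rfl (by omega) s (by omega) k (by omega) h hμk with h1 | h1
    · rw [hb.eq_iff hs (by omega)] at h1; omega
    · rw [hb.adj' hn hs (by omega)] at h1; omega
  have := C.arc_eq_two hG (hb.arc hn (i := i) (l := j - i) (by omega) (by omega)) (by omega)
    (fun x hx => hv _ (by omega)) (fun x hx => hbD _ (by omega)) hp hμ hpD ?_ ?_ ?_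
  · omega
  · rcases hi with ⟨rfl, -⟩ | ⟨rfl, h⟩
    exacts [h0, h]
  · show G.Adj (p μ) (b (i + (j - i)))
    rw [show i + (j - i) = j by omega]
    rcases hj with ⟨rfl, -⟩ | ⟨h, h'⟩
    · exact hμk
    · rwa [show j = k - 1 by omega]
  · intro e he x hx h
    change G.Adj (p e) (b (i + x)) at h
    by_cases he0 : e = 0
    · subst he0
      left
      by_cases hix : i + x = 0
      · omega
      · have hix1 := near0 0 (by omega) (i + x) (by omega) (by omega) h
        rw [hix1] at h
        rcases hi with ⟨h1, h2⟩ | ⟨h1, -⟩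
        · exact absurd h h2
        · omega
    · by_cases heμ : e = μ
      · subst heμ
        right
        by_cases hix : i + x < k
        · have hix1 := nearμ e le_rfl (by omega) (i + x) hix h
          rcases hj with ⟨h1, h2⟩ | ⟨h1, -⟩
          · rw [show i + x = k - 1 by omega] at h
            exact absurd h h2
          · omega
        · omega
      · have h1 : i + x < k → i + x + 1 = k := fun h' => nearμ e he (by omega) _ h' h
        have h2 : 0 < i + x → i + x = 1 := fun h' => near0 e (by omega) _ h' (by omega) h
        omega

/-- The universal case: all vertices of the hole are neighbours of the hub. -/
theorem IsHole.exists_not_adj {H : Set V} (hH : IsHole G H) {v : V} {D : Set V} (C : Comp G v D)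
    (hHD : H ⊆ closedNbhd G D) {x y z : V} (hm : x ∈ H ∧ y ∈ H ∧ z ∈ H)
    (hne : x ≠ y ∧ x ≠ z ∧ y ≠ z) (hxy : ¬ G.Adj x y) (hxz : ¬ G.Adj x z) (hyz : ¬ G.Adj y z) :
    ∃ w ∈ H, ¬ G.Adj v w := by
  classical
  by_contra! hv
  -- The object to be minimised: a path in the component joining two nonadjacent rim vertices.
  have hex : ∃ μ, ∃ p, ISeq G p μ ∧ (∀ i ≤ μ, p i ∈ D) ∧ ∃ h ∈ H, ∃ h' ∈ H, h ≠ h' ∧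
      ¬ G.Adj h h' ∧ G.Adj (p 0) h ∧ G.Adj (p μ) h' := by
    obtain ⟨c, hc, hcx⟩ := C.exists_nbr (hHD hm.1) (hv x hm.1)
    obtain ⟨d, hd, hdy⟩ := C.exists_nbr (hHD hm.2.1) (hv y hm.2.1)
    obtain ⟨S, hS, hP⟩ := C.conn c hc d hd
    obtain ⟨p, μ, hp, h0, hμ, rfl⟩ := hP.exists_iSeq
    exact ⟨μ, p, hp, fun i hi => hS ⟨i, ⟨i.zero_le, hi⟩, rfl⟩, x, hm.1, y, hm.2.1, hne.1, hxy,
      h0 ▸ hcx, hμ ▸ hdy⟩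
  obtain ⟨p, hp, hpD, h, hhH, h', hhH', hhh, hhh', h0, hμ⟩ := Nat.find_spec hex
  have hleast := fun m hm => Nat.find_min hex (m := m) hm
  generalize Nat.find hex = μ at hp hpD hμ hleast
  have hmin : ∀ e f, e ≤ f → f ≤ μ → f < e + μ → ∀ s ∈ H, ∀ t ∈ H, G.Adj (p e) s → G.Adj (p f) t →
      s = t ∨ G.Adj s t := by
    intro e f hef hf hfe s hs t ht h1 h2
    by_contra! hno
    refine hleast (f - e) (by omega) ⟨fun i => p (e + i), hp.shift (by omega),
      fun i hi => hpD _ (by omega), s, hs, t, ht, hno.1, hno.2, h1, ?_⟩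
    show G.Adj (p (e + (f - e))) t
    rwa [show e + (f - e) = f by omega]
  have hμ0 : μ ≠ 0 := by
    rintro rfl
    have hd := C.avoid _ (hpD 0 le_rfl)
    exact hhh' (square_free hG (hv h hhH) h0.symm hμ (hv h' hhH').symm hd.1.symm hd.2 hhh)
  obtain ⟨b, n, hn, hb, hb0, hHb⟩ := hH.exists_cyc hhH
  have hbH : ∀ i ≤ n, b i ∈ H := by
    intro i hi
    rcases Nat.lt_or_eq_of_le hi with hi | rfl
    · rw [hHb]; exact ⟨i, hi, rfl⟩
    · rw [hb.wrap, hHb]; exact ⟨0, by simp; omega, rfl⟩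
  have hidx : ∀ y ∈ H, ∃ i < n, b i = y := fun y hy => by
    rw [hHb] at hy
    exact hy
  have hodd : Odd n := by
    have o := hH.odd hG (z := v) (fun h => C.hub_notMem (hHD h)) hm.1 hm.2.1 (hv _ hm.1)
      (hv _ hm.2.1) hne.1 hxy
    have e : G.neighborSet v ∩ H = H := Set.inter_eq_right.2 fun y hy => hv y hy
    rwa [e, hHb,
      Set.InjOn.ncard_image (s := Set.Iio n) fun i hi j hj e => hb.inj i hi j hj e,
      show Set.Iio n = ((Finset.range n : Finset ℕ) : Set ℕ) by ext; simp, Set.ncard_coe_finset,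
      Finset.card_range] at o
  have far : ∀ i j, i < n → j < n → b i ≠ b j → ¬ G.Adj (b i) (b j) →
      i + 1 < j ∧ (i ≠ 0 ∨ j + 1 ≠ n) ∨ j + 1 < i ∧ (j ≠ 0 ∨ i + 1 ≠ n) := by
    intro i j hi hj h1 h2
    rcases lt_trichotomy i j with h | rfl | h
    · rw [hb.adj i j h hj] at h2; omega
    · exact absurd rfl h1
    · rw [G.adj_comm, hb.adj j i h hi] at h2; omega
  -- Three pairwise nonadjacent rim vertices give `6 ≤ n`, and `n` is odd.
  have h7 : 7 ≤ n := by
    obtain ⟨i, hi, rfl⟩ := hidx x hm.1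
    obtain ⟨j, hj, rfl⟩ := hidx y hm.2.1
    obtain ⟨k, hk, rfl⟩ := hidx z hm.2.2
    have := far i j hi hj hne.1 hxy
    have := far i k hi hk hne.2.1 hxz
    have := far j k hj hk hne.2.2 hyz
    rw [Nat.odd_iff] at hodd
    clear hb hHb
    omega
  obtain ⟨k, hk, rfl⟩ := hidx h' hhH'
  subst hb0
  have hk2 := far 0 k (by omega) hk hhh hhh'
  obtain ⟨i, j, h1, h2, h3⟩ := C.side hG hb hn (fun i hi => hv _ (hbH i hi))
    (fun i hi => hHD (hbH i hi)) hp hμ0 hpD (k := k) (by omega) (by omega) h0 hμ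
    (fun e f h1 h2 h3 s hs t ht => hmin e f h1 h2 h3 _ (hbH s hs) _ (hbH t ht))
  obtain ⟨i', j', h4, h5, h6⟩ := C.side hG (hb.mirror hn) hn (fun i hi => hv _ (hbH _ (by omega)))
    (fun i hi => hHD (hbH _ (by omega))) hp hμ0 hpD (k := n - k) (by omega) (by omega)
    (by simpa [hb.wrap] using h0) (by rwa [show n - (n - k) = k by omega])
    (fun e f h1 h2 h3 s hs t ht => hmin e f h1 h2 h3 _ (hbH _ (by omega)) _ (hbH _ (by omega)))
  -- Trimming both arcs at the same end would give that end of `p` two nonadjacent rim neighbours,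
  -- against minimality. So at most two trims occur in all, and the two bounds of `side` add up to
  -- `n ≤ 6`.
  have ex0 : ¬ (i = 1 ∧ i' = 1) := by
    rintro ⟨e1, e2⟩
    have e3 := (h2.resolve_left (by omega)).2
    have e4 := (h5.resolve_left (by omega)).2
    rcases hmin 0 0 le_rfl (by omega) (by omega) _ (hbH 1 (by omega)) _ (hbH (n - 1) (by omega))
      e3 e4 with h | h
    · rw [hb.eq_iff (by omega) (by omega)] at h; omega
    · rw [hb.adj' hn (by omega) (by omega)] at h; omega
  have exμ : ¬ (j + 1 = k ∧ j' + 1 = n - k) := by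
    rintro ⟨e1, e2⟩
    have e3 := (h3.resolve_left (by omega)).2
    have e4 := (h6.resolve_left (by omega)).2
    rcases hmin μ μ le_rfl le_rfl (by omega) _ (hbH (k - 1) (by omega))
      _ (hbH (n - (n - k - 1)) (by omega)) e3 e4 with h | h
    · rw [hb.eq_iff (by omega) (by omega)] at h; omega
    · rw [hb.adj' hn (by omega) (by omega)] at h; omega
  have h2' := h2.imp id And.left
  have h5' := h5.imp id And.left
  have h3' := h3.imp id And.left
  have h6' := h6.imp id And.left
  clear h2 h3 h5 h6 hb hHb
  omega

/-- No component of the complement of `N[v]` dominates the hole of a proper wheel with hub `v`. -/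
theorem IsProperWheel.not_subset {H : Set V} {v : V} (hW : IsProperWheel G H v) {D : Set V}
    (C : Comp G v D) (hHD : H ⊆ closedNbhd G D) : False := by
  obtain ⟨x, y, z, hm, ha, hne, hxy, hxz, hyz⟩ := hW.exists_indep
  have hH := hW.1.1
  have hv : v ∉ H := fun h => C.hub_notMem (hHD h)
  obtain ⟨w, hw, hvw⟩ := hH.exists_not_adj hG C hHD hm hne hxy hxz hyz
  obtain ⟨b, l, Q, q₁, q₂, m, R, hb, hQ, hm1, hm2, hm3⟩ :=
    hH.exists_ring hv hw hvw hm ha hne hxy hxz hyz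
  exact R.contra hG C.conn C.avoid
    (fun y hy => C.mem (hHD (hQ hy)) (R.Qv y hy).1 (R.Qv y hy).2)
    (fun i hi h => C.mem (hHD (hb i hi)) (R.bv i hi) h)
    (fun i hi h => C.exists_nbr (hHD (hb i hi)) h) hm1 hm2 hm3

end

/-! ### Loaded pyramids: cores and bridges. -/

section

open SimpleGraph

variable {V : Type*} {G : SimpleGraph V}

/-- Two paths from a neighbour of `a` to spokes of `v`, together with a path from `a` to another
spoke of `v`. -/
theorem no_fork [Finite V] (hG : IsC4FreeOddSignable G) {v a a' b₁ b₃ p : V} {T U A : Set V}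
    (hT : IPath G T a' b₁) (hU : IPath G U a' p) (hA : IPath G A a b₃) (hva : G.Adj v a)
    (hvb₁ : G.Adj v b₁) (hvb₃ : G.Adj v b₃) (hvp : G.Adj v p) (haa' : G.Adj a a')
    (hbb : G.Adj b₁ b₃) (hab₁ : ¬ G.Adj a b₁) (hab₃ : ¬ G.Adj a b₃) (hne₃ : a ≠ b₃)
    (hvT : ∀ y ∈ T, y ≠ v ∧ (G.Adj v y → y = b₁)) (hvU : ∀ y ∈ U, y ≠ v ∧ (G.Adj v y → y = p))
    (hvA : ∀ y ∈ A, y ≠ v ∧ (G.Adj v y → y = a ∨ y = b₃))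
    (haT : ∀ y ∈ T, a ≠ y ∧ (G.Adj a y → y = a')) (haU : ∀ y ∈ U, a ≠ y ∧ (G.Adj a y → y = a'))
    (hTU : ∀ y ∈ T, ∀ z ∈ U, y ≠ a' → y ≠ b₁ → z ≠ a' → y ≠ z ∧ ¬ G.Adj y z)
    (hAU : ∀ y ∈ A, ∀ z ∈ U, y ≠ a → y ≠ z ∧ ¬ G.Adj y z)
    (hAb : ∀ y ∈ A, y ≠ b₁ ∧ (G.Adj y b₁ → y = b₃)) (hbU : b₁ ∉ U) : False := by
  have mT := hT.left_mem
  have mU := hU.left_mem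
  have hva' : ¬ G.Adj v a' := fun h => hab₁ ((hvT a' mT).2 h ▸ haa')
  have hne : a' ≠ b₁ := fun h => hva' (h ▸ hvb₁)
  have hneb : a ≠ b₁ := (haT b₁ hT.right_mem).1
  have ha'b : ¬ G.Adj a' b₁ := fun h =>
    hva' (square_free hG hva.symm hvb₁ h.symm haa'.symm hneb hab₁ (hvT a' mT).1.symm)
  -- If `b₁` sees `U` before `p`, a theta joins `a'` to `b₁`: along `U`, along `T`, and through `a`
  -- and `v`.
  by_cases h1 : ∃ z ∈ U, z ≠ p ∧ G.Adj b₁ z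
  · obtain ⟨z, hz, hzp, hbz⟩ := h1
    obtain ⟨z', U₁, U₂, hs, hbz', hl⟩ := hU.exists_first (p := fun x => G.Adj b₁ x) ⟨z, hz, hbz⟩
    have hp : p ∉ U₁ := by
      intro hp
      have e := hs.eq_of_mem hp hs.right.right_mem
      subst e
      have : z ∈ U₁ := by
        have hz' := hz
        rw [← hs.union, hs.right.eq_singleton] at hz'
        rcases hz' with h | h
        · exact h
        · exact absurd h hzp
      exact hzp (hl z this hbz)
    refine theta_free' hG (a := a') (b := b₁) (X := U₁ \ {a'}) (Y := T \ {a', b₁}) (Z := {a, v})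
      hne ha'b ?_ ?_ ?_ ?_ ?_ ?_
    · refine (hs.left.reach' ?_).snoc (by simp) hbz'.symm
      intro y hy
      by_cases h : y = a'
      · exact .inl h
      · exact .inr (.inr ⟨hy, h⟩)
    · refine hT.reach' fun y hy => ?_
      by_cases h : y = a'
      · exact .inl h
      by_cases h' : y = b₁
      · exact .inr (.inl h')
      · exact .inr (.inr ⟨hy, by simp [h, h']⟩)
    · exact ((Reach.edge (by simp) (by simp) hvb₁).cons (by simp) hva.symm).cons (by simp) haa'.symm
    · intro y hy z hz
      obtain ⟨h2, h3⟩ : z ≠ a' ∧ z ≠ b₁ := by simpa using hz.2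
      have := hTU z hz.1 y (hs.subset_left hy.1) h2 h3 hy.2
      exact ⟨this.1.symm, fun e => this.2 e.symm⟩
    · rintro y hy z (rfl | rfl)
      · have := haU y (hs.subset_left hy.1)
        exact ⟨this.1.symm, fun e => hy.2 (this.2 e.symm)⟩
      · have := hvU y (hs.subset_left hy.1)
        exact ⟨this.1, fun e => hp (this.2 e.symm ▸ hy.1)⟩
    · rintro y hy z (rfl | rfl)
      · have := haT y hy.1
        exact ⟨this.1.symm, fun e => hy.2 (.inl (this.2 e.symm))⟩
      · have := hvT y hy.1
        exact ⟨this.1, fun e => hy.2 (.inr (this.2 e.symm))⟩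
  push Not at h1
  have hpb : b₁ ≠ p := fun e => hbU (e ▸ hU.right_mem)
  -- If `p` is the only neighbour of `b₁` on `U`, then `A`, `U` and `b₁` form a hole on which `v`
  -- has exactly the four neighbours `a`, `b₃`, `b₁`, `p`. If `b₁` sees nothing of `U`, a theta
  -- joins `a'` to `v` through `T`, through `U` and through `a`.
  by_cases h2 : G.Adj b₁ p
  · have hU' : IPath G (U ∪ {b₁}) a' b₁ := by
      refine hU.append (.refl b₁) h2.symm ?_
      rintro y hy _ rfl
      refine ⟨fun e => hbU (e ▸ hy), fun e => ⟨?_, rfl⟩⟩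
      by_contra hyp
      exact h1 y hy hyp e.symm
    have hole := hA.isHole_union hU' haa' hbb.symm hne₃ hne (by
      rintro y hy z (hz | rfl)
      · by_cases hya : y = a
        · subst hya
          exact ⟨(haU z hz).1, fun e => .inl ⟨rfl, (haU z hz).2 e⟩⟩
        · have := hAU y hy z hz hya
          exact ⟨this.1, fun e => absurd e this.2⟩
      · exact ⟨(hAb y hy).1, fun e => .inr ⟨(hAb y hy).2 e, rfl⟩⟩)
    have o := hole.odd hG (z := v) (x := a) (y := b₃) (by
        rintro (h | h | h)
        · exact (hvA v h).1 rfl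
        · exact (hvU v h).1 rfl
        · exact hvb₁.ne h) (.inl hA.left_mem) (.inl hA.right_mem) hva hvb₃ hne₃ hab₃
    have e : G.neighborSet v ∩ (A ∪ (U ∪ {b₁})) = {a, b₃, b₁, p} := by
      ext y
      constructor
      · rintro ⟨h, h' | h' | h'⟩
        · rcases (hvA y h').2 h with rfl | rfl <;> simp
        · rw [(hvU y h').2 h]; simp
        · rw [h']; simp
      · rintro (rfl | rfl | rfl | rfl)
        · exact ⟨hva, .inl hA.left_mem⟩
        · exact ⟨hvb₃, .inl hA.right_mem⟩
        · exact ⟨hvb₁, .inr (.inr rfl)⟩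
        · exact ⟨hvp, .inr (.inl hU.right_mem)⟩
    have hap : a ≠ p := (haU p hU.right_mem).1
    have hbp : b₃ ≠ p := (hAU b₃ hA.right_mem p hU.right_mem hne₃.symm).1
    rw [e, Set.ncard_insert_of_notMem (by simp [hne₃, hneb, hap]),
      Set.ncard_insert_of_notMem (by simp [hbb.ne.symm, hbp]), Set.ncard_pair hpb] at o
    revert o; decide
  · have hbU' : ∀ z ∈ U, b₁ ≠ z ∧ ¬ G.Adj b₁ z := fun z hz => by
      refine ⟨fun e => hbU (e ▸ hz), ?_⟩
      by_cases hzp : z = p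
      · rwa [hzp]
      · exact h1 z hz hzp
    have sub : ∀ S : Set V, S ⊆ insert a' (insert v (S \ {a'})) := fun S y hy => by
      by_cases h : y = a'
      · exact .inl h
      · exact .inr (.inr ⟨hy, h⟩)
    refine theta_free' hG (a := a') (b := v) (X := T \ {a'}) (Y := U \ {a'}) (Z := {a})
      (hvT a' mT).1 (fun e => hva' e.symm) ((hT.reach' (sub T)).snoc (by simp) hvb₁.symm)
      ((hU.reach' (sub U)).snoc (by simp) hvp.symm)
      ((Reach.edge (by simp) (by simp) hva.symm).cons (by simp) haa'.symm) ?_ ?_ ?_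
    · intro y hy z hz
      by_cases hyb : y = b₁
      · subst hyb; exact hbU' z hz.1
      · exact hTU y hy.1 z hz.1 hy.2 hyb hz.2
    · rintro y hy _ rfl
      have := haT y hy.1
      exact ⟨this.1.symm, fun e => hy.2 (this.2 e.symm)⟩
    · rintro y hy _ rfl
      have := haU y hy.1
      exact ⟨this.1.symm, fun e => hy.2 (this.2 e.symm)⟩

/-- The part of a loaded pyramid with corner `v` used in the main argument: the path `A` from the
apex `a` to `b₃`, and a set `K` joining the neighbour `a'` of `a` to `b₁` and to `p`. -/
structure Core (G : SimpleGraph V) (v a a' b₁ b₃ p : V) (A K D : Set V) : Prop where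
  comp : Comp G v D
  va : G.Adj v a
  vb₁ : G.Adj v b₁
  vb₃ : G.Adj v b₃
  vp : G.Adj v p
  aa' : G.Adj a a'
  bb : G.Adj b₁ b₃
  ab₁ : a ≠ b₁ ∧ ¬ G.Adj a b₁
  ab₃ : a ≠ b₃ ∧ ¬ G.Adj a b₃
  bp : b₁ ≠ p
  path : IPath G A a b₃
  KD : K ⊆ D
  a'D : a' ∈ D
  AD : ∀ y ∈ A, y ≠ a → y ≠ b₃ → y ∈ D
  AK : Anti G A K
  Ap : ∀ y ∈ A, y ≠ p ∧ ¬ G.Adj y p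
  Aa' : ∀ y ∈ A, y ≠ a → y ≠ a' ∧ ¬ G.Adj y a'
  Ab₁ : ∀ y ∈ A, y ≠ b₁ ∧ (G.Adj y b₁ → y = b₃)
  reach₁ : ∀ x ∈ K, Reach G (insert b₁ K) x b₁
  reachp : ∀ x ∈ K, Reach G (insert p K) x p
  nbr : ∃ x ∈ K, G.Adj a' x

namespace Core

variable {v a a' b₁ b₃ p : V} {A K D : Set V}

theorem a'v (C : Core G v a a' b₁ b₃ p A K D) : a' ≠ v ∧ ¬ G.Adj v a' := C.comp.avoid a' C.a'D

theorem spoke_ne (C : Core G v a a' b₁ b₃ p A K D) {x y : V} (hx : G.Adj v x) (hy : y ∈ D) : x ≠ y :=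
  fun e => (C.comp.avoid y hy).2 (e ▸ hx)

theorem Av (C : Core G v a a' b₁ b₃ p A K D) : ∀ y ∈ A, y ≠ v ∧ (G.Adj v y → y = a ∨ y = b₃) := by
  intro y hy
  by_cases h : y = a
  · exact ⟨h ▸ C.va.ne.symm, fun _ => .inl h⟩
  by_cases h' : y = b₃
  · exact ⟨h' ▸ C.vb₃.ne.symm, fun _ => .inr h'⟩
  have := C.comp.avoid y (C.AD y hy h h')
  exact ⟨this.1, fun e => absurd e this.2⟩

theorem path₁ (C : Core G v a a' b₁ b₃ p A K D) : Reach G (insert a' (insert b₁ K)) a' b₁ := by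
  obtain ⟨x, hx, e⟩ := C.nbr
  exact ((C.reach₁ x hx).mono (Set.subset_insert _ _)).cons (by simp) e

theorem pathp (C : Core G v a a' b₁ b₃ p A K D) : Reach G (insert a' (insert p K)) a' p := by
  obtain ⟨x, hx, e⟩ := C.nbr
  exact ((C.reachp x hx).mono (Set.subset_insert _ _)).cons (by simp) e

variable (hG : IsC4FreeOddSignable G)
include hG

theorem a'b₁ (C : Core G v a a' b₁ b₃ p A K D) : ¬ G.Adj a' b₁ := fun h =>
  C.a'v.2 (square_free hG C.va.symm C.vb₁ h.symm C.aa'.symm C.ab₁.1 C.ab₁.2 C.a'v.1.symm)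

theorem a'p (C : Core G v a a' b₁ b₃ p A K D) : ¬ G.Adj a' p := fun h =>
  C.a'v.2 (square_free hG C.va.symm C.vp h.symm C.aa'.symm (C.Ap a C.path.left_mem).1
    (C.Ap a C.path.left_mem).2 C.a'v.1.symm)

end Core

/-- A connected set `F` joining `a`, `b₃` and the vertex `c`, with no edges to `K`. -/
structure Bridge (G : SimpleGraph V) (v a a' b₁ b₃ p : V) (A K D : Set V) (c : V) (F : Set V) : Prop
    extends Core G v a a' b₁ b₃ p A K D where
  cD : c ∈ D
  cK : c ∉ K
  ca' : c ≠ a'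
  FD : F ⊆ D
  FK : Anti G F (insert a' (insert p K))
  reacha : Reach G (insert c (insert a F)) c a
  reachb : Reach G (insert c (insert b₃ F)) c b₃
  reachab : ∀ x ∈ F, Reach G (insert a F) a x
  hit : (∃ x ∈ K, G.Adj c x) ∨ G.Adj c a' ∨ G.Adj c p

namespace Bridge

variable {v a a' b₁ b₃ p c : V} {A K D F : Set V}
variable (hG : IsC4FreeOddSignable G)
include hG

/-- Otherwise `a` and `b₁` would be the ends of a theta: through `F`, through `a'` and `K`, and
through `v`. -/
theorem Fb₁ (B : Bridge G v a a' b₁ b₃ p A K D c F) : ∀ y ∈ F, y ≠ b₁ ∧ ¬ G.Adj y b₁ := by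
  intro y hy
  refine ⟨(B.spoke_ne B.vb₁ (B.FD hy)).symm, fun e => ?_⟩
  have hv : Anti G (insert a' K) {v} := by
    rintro z hz _ rfl
    have := B.comp.avoid z (by rcases hz with rfl | h; exacts [B.a'D, B.KD h])
    exact ⟨this.1, fun e => this.2 e.symm⟩
  have hv' : Anti G F {v} := by
    rintro z hz _ rfl
    have := B.comp.avoid z (B.FD hz)
    exact ⟨this.1, fun e => this.2 e.symm⟩
  refine theta_free' hG (a := a) (b := b₁) (X := F) (Y := insert a' K) (Z := {v}) B.ab₁.1 B.ab₁.2
    ?_ ?_ ?_ ?_ hv' hv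
  · exact ((B.reachab y hy).mono (by clear * -; intro; simp; tauto)).snoc (by simp) e
  · exact (B.path₁.mono (by clear * -; intro; simp; tauto)).cons (by simp) B.aa'
  · exact (Reach.edge (by simp) (by simp) B.vb₁).cons (by simp) B.va.symm
  · exact B.FK.mono subset_rfl (by clear * -; intro; simp; tauto)

variable [Finite V]

/-- `no_four_spokes` at `c`: `b₃` and `a` are reached through `F`, `b₁` and `p` through `K`. The
only edge between the two kinds of path, away from `c`, is `b₃ b₁`. -/
theorem false_of_K (B : Bridge G v a a' b₁ b₃ p A K D c F) {x : V} (hx : x ∈ K) (hc : G.Adj c x) :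
    False := by
  obtain ⟨L, hLs, hL⟩ := B.reachb
  obtain ⟨L', hLs', hL'⟩ := B.reacha
  obtain ⟨T, hTs, hT⟩ := ((B.reach₁ x hx).mono (Set.subset_insert c _)).cons (by simp) hc
  obtain ⟨R, hRs, hR⟩ := ((B.reachp x hx).mono (Set.subset_insert c _)).cons (by simp) hc
  have vD : ∀ y ∈ D, ∀ z, y ≠ v ∧ (G.Adj v y → y = z) := fun y hy z =>
    ⟨(B.comp.avoid y hy).1, fun e => absurd e (B.comp.avoid y hy).2⟩
  have vS : ∀ {S : Set V} {w : V}, S ⊆ D → G.Adj v w → ∀ y ∈ insert c (insert w S),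
      y ≠ v ∧ (G.Adj v y → y = w) := by
    rintro S w hS hw y (rfl | rfl | hy)
    · exact vD _ B.cD _
    · exact ⟨hw.ne.symm, fun _ => rfl⟩
    · exact vD _ (hS hy) _
  have ha := B.path.left_mem
  have hb := B.path.right_mem
  refine no_four_spokes hG hL hL' hT hR (B.comp.avoid c B.cD).2 B.vb₃ B.va B.vb₁ B.vp
    (fun y hy => vS B.FD B.vb₃ y (hLs hy)) (fun y hy => vS B.FD B.va y (hLs' hy))
    (fun y hy => vS B.KD B.vb₁ y (hTs hy)) (fun y hy => vS B.KD B.vp y (hRs hy))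
    (fun e => B.ab₃.2 e.symm) B.ab₃.1.symm B.bb (fun e => B.ab₁.2 e.symm)
    (fun e => (B.Ap b₃ hb).2 e.symm) (fun e => (B.Ap a ha).2 e.symm) ?_ ?_ ?_ ?_
  · intro y hy t ht hyc htc
    rcases hLs hy with h | rfl | hyF
    · exact absurd h hyc
    · rcases hTs ht with h | rfl | htK
      · exact absurd h htc
      · exact ⟨B.bb.ne.symm, fun _ => ⟨rfl, rfl⟩⟩
      · have := B.AK y hb t htK
        exact ⟨this.1, fun e => absurd e this.2⟩
    · rcases hTs ht with h | rfl | htK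
      · exact absurd h htc
      · have := B.Fb₁ hG y hyF
        exact ⟨this.1, fun e => absurd e this.2⟩
      · have := B.FK y hyF t (.inr (.inr htK))
        exact ⟨this.1, fun e => absurd e this.2⟩
  · intro y hy t ht hyc htc
    rcases hLs hy with h | rfl | hyF
    · exact absurd h hyc
    · rcases hRs ht with h | rfl | htK
      · exact absurd h htc
      · exact B.Ap y hb
      · exact B.AK y hb t htK
    · rcases hRs ht with h | rfl | htK
      · exact absurd h htc
      · exact B.FK y hyF t (.inr (.inl rfl))
      · exact B.FK y hyF t (.inr (.inr htK))
  · intro y hy t ht hyc htc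
    rcases hLs' hy with h | rfl | hyF
    · exact absurd h hyc
    · rcases hTs ht with h | rfl | htK
      · exact absurd h htc
      · exact B.ab₁
      · exact B.AK y ha t htK
    · rcases hTs ht with h | rfl | htK
      · exact absurd h htc
      · exact B.Fb₁ hG y hyF
      · exact B.FK y hyF t (.inr (.inr htK))
  · intro y hy t ht hyc htc
    rcases hLs' hy with h | rfl | hyF
    · exact absurd h hyc
    · rcases hRs ht with h | rfl | htK
      · exact absurd h htc
      · exact B.Ap y ha
      · exact B.AK y ha t htK
    · rcases hRs ht with h | rfl | htK
      · exact absurd h htc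
      · exact B.FK y hyF t (.inr (.inl rfl))
      · exact B.FK y hyF t (.inr (.inr htK))

end Bridge

end

section

open SimpleGraph

variable {V : Type*} {G : SimpleGraph V}

namespace Bridge

variable {v a a' b₁ b₃ p c : V} {A K D F : Set V}
variable (hG : IsC4FreeOddSignable G)
include hG

/-- Theta with ends `a` and `p`: through `F` and `c`, through `a'` and `K`, and through `v`. -/
theorem false_of_p (B : Bridge G v a a' b₁ b₃ p A K D c F) (hK : ∀ x ∈ K, ¬ G.Adj c x)
    (ha' : ¬ G.Adj c a') (hp : G.Adj c p) : False := by
  have hap := B.Ap a B.path.left_mem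
  have hv : ∀ S ⊆ D, Anti G S {v} := by
    rintro S hS z hz _ rfl
    have := B.comp.avoid z (hS hz)
    exact ⟨this.1, fun e => this.2 e.symm⟩
  refine theta_free' hG (a := a) (b := p) (X := insert c F) (Y := insert a' K) (Z := {v}) hap.1 hap.2
    ?_ ?_ ?_ ?_ (hv _ (Set.insert_subset B.cD B.FD)) (hv _ (Set.insert_subset B.a'D B.KD))
  · exact ((B.reacha.symm).mono (by clear * -; intro; simp; tauto)).snoc (by simp) hp
  · exact (B.pathp.mono (by clear * -; intro; simp; tauto)).cons (by simp) B.aa'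
  · exact (Reach.edge (by simp) (by simp) B.vp).cons (by simp) B.va.symm
  · rintro x (rfl | hx) y (rfl | hy)
    · exact ⟨B.ca', ha'⟩
    · exact ⟨fun e => B.cK (e ▸ hy), hK y hy⟩
    · exact B.FK x hx _ (.inl rfl)
    · exact B.FK x hx y (.inr (.inr hy))

variable [Finite V]

/-- Otherwise `c` would see exactly `a'` and `p`, which are nonadjacent, on the hole formed by `v`,
`a` and a path from `a'` through `K` to `p`. -/
theorem not_adj_p (B : Bridge G v a a' b₁ b₃ p A K D c F) (hK : ∀ x ∈ K, ¬ G.Adj c x)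
    (ha' : G.Adj c a') : ¬ G.Adj c p := by
  intro hp
  have hap := B.Ap a B.path.left_mem
  have hcv := B.comp.avoid c B.cD
  have hca : ¬ G.Adj c a := fun e =>
    hcv.2 (square_free hG B.va.symm B.vp hp.symm e hap.1 hap.2 hcv.1.symm)
  obtain ⟨S, hS, hP⟩ := B.pathp
  have haK : ∀ y ∈ K, a ≠ y ∧ ¬ G.Adj a y := B.AK a B.path.left_mem
  have hP' : IPath G (insert a S) a p := by
    refine hP.cons' B.aa' fun y hy => ?_
    rcases hS hy with rfl | rfl | h
    · exact ⟨B.aa'.ne.symm, fun _ => rfl⟩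
    · exact ⟨hap.1.symm, fun e => absurd e hap.2⟩
    · exact ⟨(haK y h).1.symm, fun e => absurd e (haK y h).2⟩
  have hSv : ∀ y ∈ insert a S, y ≠ v ∧ (G.Adj v y → y = a ∨ y = p) := by
    rintro y (rfl | hy)
    · exact ⟨B.va.ne.symm, fun _ => .inl rfl⟩
    rcases hS hy with rfl | rfl | h
    · exact ⟨B.a'v.1, fun e => absurd e B.a'v.2⟩
    · exact ⟨B.vp.ne.symm, fun _ => .inr rfl⟩
    · have := B.comp.avoid y (B.KD h)
      exact ⟨this.1, fun e => absurd e this.2⟩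
  have hole := hP'.isHole (fun h => (hSv v h).1 rfl) B.va B.vp (fun x hx => (hSv x hx).2) hap.1 hap.2
  have hne : a' ≠ p := (B.spoke_ne B.vp B.a'D).symm
  have o := hole.odd hG (z := c) (x := a') (y := p) (by
      rintro (h | h | h)
      · exact hcv.1 h
      · exact B.spoke_ne B.va B.cD h.symm
      · rcases hS h with h | h | h
        · exact B.ca' h
        · exact B.spoke_ne B.vp B.cD h.symm
        · exact B.cK h)
    (.inr (.inr hP.left_mem)) (.inr (.inr hP.right_mem)) ha' hp hne (B.a'p hG)
  have e : G.neighborSet c ∩ insert v (insert a S) = {a', p} := by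
    ext y
    constructor
    · rintro ⟨h, rfl | rfl | hy⟩
      · exact absurd h.symm hcv.2
      · exact absurd h hca
      · rcases hS hy with rfl | rfl | hy
        · exact .inl rfl
        · exact .inr rfl
        · exact absurd h (hK y hy)
    · rintro (rfl | rfl)
      · exact ⟨ha', .inr (.inr hP.left_mem)⟩
      · exact ⟨hp, .inr (.inr hP.right_mem)⟩
  rw [e, Set.ncard_pair hne] at o
  revert o; decide

/-- If `c` sees `b₁`, then `no_fork` applies with the path `a'`, `c`, `b₁`. If not, `no_four_spokes`
applies at `a'`: `b₃` is reached through `c` and `F`, `a` by an edge, and `b₁` and `p` through `K`.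
-/
theorem false_of_a' (B : Bridge G v a a' b₁ b₃ p A K D c F) (hK : ∀ x ∈ K, ¬ G.Adj c x)
    (ha' : G.Adj c a') : False := by
  have hcp := B.not_adj_p hG hK ha'
  have ha := B.path.left_mem
  have hb := B.path.right_mem
  have hap := B.Ap a ha
  have hcv := B.comp.avoid c B.cD
  have haK : ∀ y ∈ K, a ≠ y ∧ ¬ G.Adj a y := B.AK a ha
  obtain ⟨R, hRs, hR⟩ := B.pathp
  have vD : ∀ y ∈ D, ∀ z, y ≠ v ∧ (G.Adj v y → y = z) := fun y hy z =>
    ⟨(B.comp.avoid y hy).1, fun e => absurd e (B.comp.avoid y hy).2⟩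
  have vS : ∀ {S : Set V} {w : V}, S ⊆ D → G.Adj v w → ∀ y ∈ insert a' (insert w S),
      y ≠ v ∧ (G.Adj v y → y = w) := by
    rintro S w hS hw y (rfl | rfl | hy)
    · exact vD _ B.a'D _
    · exact ⟨hw.ne.symm, fun _ => rfl⟩
    · exact vD _ (hS hy) _
  have cK : ∀ y ∈ K, c ≠ y ∧ ¬ G.Adj c y := fun y hy => ⟨fun e => B.cK (e ▸ hy), hK y hy⟩
  have cp : c ≠ p ∧ ¬ G.Adj c p := ⟨(B.spoke_ne B.vp B.cD).symm, hcp⟩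
  by_cases hcb : G.Adj c b₁
  · have hca : ¬ G.Adj a c := fun e =>
      hcv.2 (square_free hG B.va.symm B.vb₁ hcb.symm e.symm B.ab₁.1 B.ab₁.2 hcv.1.symm)
    have hcb' : c ≠ b₁ := (B.spoke_ne B.vb₁ B.cD).symm
    have hT : IPath G {a', c, b₁} a' b₁ := by
      refine (IPath.edge hcb).cons' ha'.symm ?_
      rintro x (rfl | rfl)
      · exact ⟨B.ca', fun _ => rfl⟩
      · exact ⟨B.spoke_ne B.vb₁ B.a'D, fun e => absurd e (B.a'b₁ hG)⟩
    refine no_fork hG hT hR B.path B.va B.vb₁ B.vb₃ B.vp B.aa' B.bb B.ab₁.2 B.ab₃.2 B.ab₃.1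
      ?_ (fun y hy => vS B.KD B.vp y (hRs hy)) B.Av ?_ ?_ ?_ ?_ B.Ab₁ ?_
    · rintro y (rfl | rfl | rfl)
      · exact vD _ B.a'D _
      · exact vD _ B.cD _
      · exact ⟨B.vb₁.ne.symm, fun _ => rfl⟩
    · rintro y (rfl | rfl | rfl)
      · exact ⟨B.aa'.ne, fun _ => rfl⟩
      · exact ⟨B.spoke_ne B.va B.cD, fun e => absurd e hca⟩
      · exact ⟨B.ab₁.1, fun e => absurd e B.ab₁.2⟩
    · intro y hy
      rcases hRs hy with rfl | rfl | hy
      · exact ⟨B.aa'.ne, fun _ => rfl⟩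
      · exact ⟨hap.1, fun e => absurd e hap.2⟩
      · exact ⟨(haK y hy).1, fun e => absurd e (haK y hy).2⟩
    · rintro y (h | rfl | h) z hz h1 h2 h3
      · exact absurd h h1
      · rcases hRs hz with h | rfl | h
        · exact absurd h h3
        · exact cp
        · exact cK z h
      · exact absurd h h2
    · intro y hy z hz hya
      rcases hRs hz with rfl | rfl | h
      · exact B.Aa' y hy hya
      · exact B.Ap y hy
      · exact B.AK y hy z h
    · intro h
      rcases hRs h with h | h | h
      · exact B.spoke_ne B.vb₁ B.a'D h
      · exact B.bp h
      · exact B.spoke_ne B.vb₁ (B.KD h) rfl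
  · obtain ⟨L, hLs, hL⟩ := (B.reachb.mono (Set.subset_insert a' _)).cons (by simp) ha'.symm
    obtain ⟨T, hTs, hT⟩ := B.path₁
    have cb : c ≠ b₁ ∧ ¬ G.Adj c b₁ := ⟨(B.spoke_ne B.vb₁ B.cD).symm, hcb⟩
    refine no_four_spokes hG hL (IPath.edge B.aa'.symm) hT hR B.a'v.2 B.vb₃ B.va B.vb₁ B.vp
      (fun y hy => ?_) ?_
      (fun y hy => vS B.KD B.vb₁ y (hTs hy)) (fun y hy => vS B.KD B.vp y (hRs hy))
      (fun e => B.ab₃.2 e.symm) B.ab₃.1.symm B.bb (fun e => B.ab₁.2 e.symm)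
      (fun e => (B.Ap b₃ hb).2 e.symm) (fun e => hap.2 e.symm) ?_ ?_ ?_ ?_
    · rcases hLs hy with rfl | rfl | rfl | h
      · exact vD _ B.a'D _
      · exact vD _ B.cD _
      · exact ⟨B.vb₃.ne.symm, fun _ => rfl⟩
      · exact vD _ (B.FD h) _
    · rintro y (rfl | rfl)
      · exact vD _ B.a'D _
      · exact ⟨B.va.ne.symm, fun _ => rfl⟩
    · intro y hy t ht h1 h2
      rcases hLs hy with h | rfl | rfl | hyF
      · exact absurd h h1
      · rcases hTs ht with h | rfl | htK
        · exact absurd h h2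
        · exact ⟨cb.1, fun e => absurd e cb.2⟩
        · exact ⟨(cK t htK).1, fun e => absurd e (cK t htK).2⟩
      · rcases hTs ht with h | rfl | htK
        · exact absurd h h2
        · exact ⟨B.bb.ne.symm, fun _ => ⟨rfl, rfl⟩⟩
        · have := B.AK y hb t htK
          exact ⟨this.1, fun e => absurd e this.2⟩
      · rcases hTs ht with h | rfl | htK
        · exact absurd h h2
        · have := B.Fb₁ hG y hyF
          exact ⟨this.1, fun e => absurd e this.2⟩
        · have := B.FK y hyF t (.inr (.inr htK))
          exact ⟨this.1, fun e => absurd e this.2⟩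
    · intro y hy t ht h1 h2
      rcases hLs hy with h | rfl | rfl | hyF
      · exact absurd h h1
      · rcases hRs ht with h | rfl | htK
        · exact absurd h h2
        · exact cp
        · exact cK t htK
      · rcases hRs ht with h | rfl | htK
        · exact absurd h h2
        · exact B.Ap y hb
        · exact B.AK y hb t htK
      · rcases hRs ht with h | rfl | htK
        · exact absurd h h2
        · exact B.FK y hyF t (.inr (.inl rfl))
        · exact B.FK y hyF t (.inr (.inr htK))
    · rintro y (h | rfl) t ht h1 h2
      · exact absurd h h1
      · rcases hTs ht with h | rfl | htK
        · exact absurd h h2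
        · exact B.ab₁
        · exact haK t htK
    · rintro y (h | rfl) t ht h1 h2
      · exact absurd h h1
      · rcases hRs ht with h | rfl | htK
        · exact absurd h h2
        · exact hap
        · exact haK t htK

theorem contra (B : Bridge G v a a' b₁ b₃ p A K D c F) : False := by
  by_cases hK : ∃ x ∈ K, G.Adj c x
  · obtain ⟨x, hx, hc⟩ := hK
    exact B.false_of_K hG hx hc
  · push Not at hK
    by_cases ha' : G.Adj c a'
    · exact B.false_of_a' hG hK ha'
    · rcases B.hit with ⟨x, hx, h⟩ | h | h
      · exact hK x hx h
      · exact ha' h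
      · exact B.false_of_p hG hK ha' h

end Bridge

/-- Both `a'` and the nonempty interior of `A` lie in the connected set `D`. On a path in `D` from
the interior to `a'`, let `c` be the first vertex in or next to `K`, `a'` or `p`. The part before
`c`, together with the interior of `A`, is the set `F` of a `Bridge`. -/
theorem Core.contra [Finite V] (hG : IsC4FreeOddSignable G) {v a a' b₁ b₃ p : V} {A K D : Set V}
    (C : Core G v a a' b₁ b₃ p A K D) : False := by
  have ha := C.path.left_mem
  have hb := C.path.right_mem
  obtain ⟨a₁, haa₁, hA₁, hu₁⟩ := C.path.tail C.ab₃.1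
  have ha₁b : a₁ ≠ b₃ := by rintro rfl; exact C.ab₃.2 haa₁
  obtain ⟨a₂, hba₂, hA₂, hu₂⟩ := hA₁.symm.tail ha₁b.symm
  set I := (A \ {a}) \ {b₃} with hI
  have hIA : ∀ y ∈ I, y ∈ A ∧ y ≠ a ∧ y ≠ b₃ := fun y hy => ⟨hy.1.1, hy.1.2, hy.2⟩
  have hID : I ⊆ D := fun y hy => C.AD y (hIA y hy).1 (hIA y hy).2.1 (hIA y hy).2.2
  have hIK : Anti G I (insert a' (insert p K)) := by
    rintro y hy z (rfl | rfl | hz)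
    · exact C.Aa' y (hIA y hy).1 (hIA y hy).2.1
    · exact C.Ap y (hIA y hy).1
    · exact C.AK y (hIA y hy).1 z hz
  obtain ⟨S, hSD, hS⟩ := C.comp.conn a₂ (hID hA₂.left_mem) a' C.a'D
  obtain ⟨c, S₁, S₂, hs, hc, hl⟩ := hS.exists_first
    (p := fun x => ∃ y ∈ insert a' (insert p K), x = y ∨ G.Adj x y)
    ⟨a', hS.right_mem, a', by simp, .inl rfl⟩
  have hca₂ : a₂ ≠ c := by
    rintro rfl
    obtain ⟨y, hy, h⟩ := hc
    have := hIK a₂ hA₂.left_mem y hy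
    exact h.elim this.1 this.2
  have hcI : c ∉ I := by
    intro h
    obtain ⟨y, hy, h'⟩ := hc
    have := hIK c h y hy
    exact h'.elim this.1 this.2
  obtain ⟨d, hcd, hS₁, -⟩ := hs.left.symm.tail hca₂.symm
  have hcK : c ∉ insert a' (insert p K) := fun h =>
    hS₁.left_mem.2 (hl d hS₁.left_mem.1 ⟨c, h, .inr hcd.symm⟩)
  have hcD : c ∈ D := hSD hs.mem
  obtain ⟨y, hy, hcy⟩ := hc
  have hcy : G.Adj c y := hcy.resolve_left fun e => hcK (e ▸ hy)
  have hmid : Reach G (I ∪ S₁ \ {c}) d a₂ := hS₁.reach' Set.subset_union_right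
  have hI' : ∀ x ∈ I, ∀ y ∈ I, Reach G (I ∪ S₁ \ {c}) x y := fun x hx y hy =>
    (hA₂.reach_mem hx hy).mono Set.subset_union_left
  have B : Bridge G v a a' b₁ b₃ p A K D c (I ∪ S₁ \ {c}) := by
    refine ⟨C, hcD, fun h => hcK (.inr (.inr h)), fun h => hcK (.inl h), ?_, ?_, ?_, ?_, ?_, ?_⟩
    · exact Set.union_subset hID fun y hy => hSD (hs.subset_left hy.1)
    · rintro x (hx | hx) z hz
      · exact hIK x hx z hz
      · refine ⟨fun e => hx.2 (hl x hx.1 ⟨z, hz, .inl e⟩), fun e => hx.2 (hl x hx.1 ⟨z, hz, .inr e⟩)⟩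
    · exact (((hmid.trans (hI' a₂ hA₂.left_mem a₁ hA₂.right_mem)).mono
        (by clear * -; intro; simp; tauto)).cons (by simp) hcd).snoc (by simp) haa₁.symm
    · exact ((hmid.mono (by clear * -; intro; simp; tauto)).cons (by simp) hcd).snoc (by simp)
        hba₂.symm
    · rintro x hx
      have : Reach G (I ∪ S₁ \ {c}) a₂ x := by
        rcases hx with hx | hx
        · exact hI' _ hA₂.left_mem x hx
        · exact (hS₁.reach_mem hS₁.right_mem hx).mono Set.subset_union_right
      exact (((hI' a₁ hA₂.right_mem a₂ hA₂.left_mem).trans this).mono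
        (Set.subset_insert _ _)).cons (by simp) haa₁
    · rcases hy with rfl | rfl | hy
      · exact .inr (.inl hcy)
      · exact .inr (.inr hcy)
      · exact .inl ⟨y, hy, hcy⟩
  exact B.contra hG

end

/-! ### Extracting a core from a loaded pyramid. -/

section

open SimpleGraph

variable {V : Type*} {G : SimpleGraph V}

/-- No step of a path crosses between anticomplete sets. -/
theorem IPath.subset_of_anti {S X Y : Set V} {a b : V} (h : IPath G S a b) (hS : S ⊆ X ∪ Y)
    (hXY : Anti G X Y) (ha : a ∈ Y) : S ⊆ Y := by
  induction h with
  | refl a => simpa using ha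
  | @cons S a e b hab h haS hu ih =>
    have he : e ∈ Y := by
      rcases hS (.inr h.left_mem) with h1 | h1
      · exact absurd hab.symm (hXY e h1 a ha).2
      · exact h1
    exact Set.insert_subset ha (ih (fun x hx => hS (.inr hx)) he)

/-- A path whose ends are adjacent to `v`, if its union with `v` is a hole. -/
theorem IPath.of_isHole_insert {S : Set V} {a b v : V} (h : IPath G S a b) (hva : G.Adj v a)
    (hvb : G.Adj v b) (hH : IsHole G (insert v S)) :
    v ∉ S ∧ a ≠ b ∧ ¬ G.Adj a b ∧ ∀ y ∈ S, G.Adj v y → y = a ∨ y = b := by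
  obtain ⟨x, y, hxy, hnxy, hvx, hvy, hP, hu⟩ := hH.open_at (Set.mem_insert v S)
  have hab : a ≠ b := by
    rintro rfl
    rw [h.eq_singleton] at hP
    have hx := hP.left_mem; have hy := hP.right_mem
    have hx' : x = a := hx.1.resolve_left hx.2
    have hy' : y = a := hy.1.resolve_left hy.2
    exact hxy (hx'.trans hy'.symm)
  have ha := hu a (.inr h.left_mem) hva
  have hb := hu b (.inr h.right_mem) hvb
  have key : ¬ G.Adj a b ∧ ∀ y ∈ S, G.Adj v y → y = a ∨ y = b := by
    rcases ha with rfl | rfl <;> rcases hb with rfl | rfl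
    · exact absurd rfl hab
    · exact ⟨hnxy, fun z hz e => hu z (.inr hz) e⟩
    · exact ⟨fun e => hnxy e.symm, fun z hz e => (hu z (.inr hz) e).symm⟩
    · exact absurd rfl hab
  refine ⟨fun hv => ?_, hab, key⟩
  rw [Set.insert_eq_of_mem hv] at hH
  obtain ⟨x', y', hxy', -, hax', hay', hP', -⟩ := hH.open_at h.left_mem
  obtain ⟨a', -, -, hu'⟩ := h.tail hab
  exact hxy' ((hu' x' hP'.left_mem.1 hax').trans (hu' y' hP'.right_mem.1 hay').symm)

/-- Two paths starting at `a` with adjacent ends, if their union is a hole. -/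
theorem IPath.cross_of_isHole {S T : Set V} {a b c : V} (hS : IPath G S a b) (hT : IPath G T a c)
    (hab : a ≠ b) (hnab : ¬ G.Adj a b) (hac : a ≠ c) (hbc : G.Adj b c) (hbT : b ∉ T)
    (hH : IsHole G (S ∪ T)) : ∀ x ∈ S, ∀ y ∈ T, x ≠ a → y ≠ a →
      x ≠ y ∧ (G.Adj x y → x = b ∧ y = c) := by
  obtain ⟨a', haa', hS', huS⟩ := hS.tail hab
  obtain ⟨d, had, hT', huT⟩ := hT.tail hac
  obtain ⟨Z, hZ, hZa⟩ : ∃ Z, IPath G Z a' d ∧ Z = (S ∪ T) \ {a} := by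
    obtain ⟨x, y, hxy, -, hax, hay, hP, -⟩ := hH.open_at (.inl hS.left_mem)
    have hx : x = a' ∨ x = d := hP.left_mem.1.imp (fun h => huS x h hax) (fun h => huT x h hax)
    have hy : y = a' ∨ y = d := hP.right_mem.1.imp (fun h => huS y h hay) (fun h => huT y h hay)
    rcases hx with rfl | rfl <;> rcases hy with rfl | rfl
    · exact absurd rfl hxy
    · exact ⟨_, hP, rfl⟩
    · exact ⟨_, hP.symm, rfl⟩
    · exact absurd rfl hxy
  have hbZ : b ∈ Z := hZa ▸ ⟨.inl hS.right_mem, hab.symm⟩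
  have ha'b : a' ≠ b := fun e => hnab (e ▸ haa')
  -- Opened at `a`, the hole is a path, which `b` divides into two anticomplete sides. Apart from
  -- `a` and `b`, `S` stays on one side and `T` on the other.
  obtain ⟨Z₁, Z₂, hs⟩ := hZ.split hbZ
  have hsub : ∀ x ∈ Z, x ≠ b → x ∈ Z₁ \ {b} ∪ Z₂ \ {b} := by
    intro x hx hxb
    rw [← hs.union] at hx
    exact hx.imp (fun h => ⟨h, hxb⟩) (fun h => ⟨h, hxb⟩)
  obtain ⟨e, -, hS'', -⟩ := hS'.symm.tail ha'b.symm
  have h1 : (S \ {a}) \ {b} ⊆ Z₁ \ {b} := by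
    refine hS''.symm.subset_of_anti ?_ hs.anti.symm ⟨hs.left.left_mem, ha'b⟩
    rintro x ⟨⟨hx, hxa⟩, hxb⟩
    exact (hsub x (hZa ▸ ⟨.inl hx, hxa⟩) hxb).symm
  have hdb : d ≠ b := fun e => hbT (e ▸ hT'.left_mem.1)
  have h2 : T \ {a} ⊆ Z₂ \ {b} := by
    refine hT'.subset_of_anti ?_ hs.anti ⟨hs.right.right_mem, hdb⟩
    rintro x ⟨hx, hxa⟩
    exact hsub x (hZa ▸ ⟨.inr hx, hxa⟩) fun e => hbT (e ▸ hx)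
  obtain ⟨f, -, -, huf⟩ := hs.right.tail hdb.symm
  intro x hx y hy hxa hya
  have hy2 := h2 ⟨hy, hya⟩
  by_cases hxb : x = b
  · subst hxb
    refine ⟨fun e => hbT (e ▸ hy), fun e => ⟨rfl, ?_⟩⟩
    rw [huf y hy2.1 e, huf c (h2 ⟨hT.right_mem, hac.symm⟩).1 hbc]
  · have := hs.anti x (h1 ⟨⟨hx, hxa⟩, hxb⟩) y hy2
    exact ⟨this.1, fun e => absurd e this.2⟩

/-- No component of the complement of `N[b₂]` dominates a loaded pyramid with corner `b₂`. -/
theorem LoadedPyramid.not_subset [Finite V] (hG : IsC4FreeOddSignable G) (L : LoadedPyramid G)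
    {D : Set V} (C : Comp G L.b₂ D) (hD : L.verts \ {L.b₂} ⊆ closedNbhd G D) : False := by
  have hV : L.verts = walkVerts L.P₁ ∪ walkVerts L.P₂ ∪ walkVerts L.P₃ ∪ walkVerts L.P := rfl
  rw [hV] at hD
  have p₁ := L.path₁.iPath
  have p₃ := L.path₃.iPath
  have pp := L.path.iPath
  have e₂ := L.path₂.iPath.eq_pair L.apex_adj
  have h₁₂ := L.hole₁₂; have h₁₃ := L.hole₁₃; have h₂₃ := L.hole₂₃
  have hlast := L.last_adj
  have a₁ := L.anti₁; have a₂ := L.anti₂; have a₃ := L.anti₃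
  have hva := L.apex_adj.symm
  have hvb₁ := L.adj₁₂.symm
  have hvb₃ := L.adj₂₃
  have hbb := L.adj₁₃
  have hvp := L.first_adj.symm
  simp only [walkInterior] at hlast
  generalize walkVerts L.P₁ = S at *
  generalize walkVerts L.P₃ = A at *
  generalize walkVerts L.P = W at *
  generalize walkVerts L.P₂ = E at *
  generalize L.a = a at *
  generalize L.b₁ = b₁ at *
  generalize L.b₂ = v at *
  generalize L.b₃ = b₃ at *
  generalize L.p = p at *
  generalize L.q = q at *
  subst e₂
  have haS := p₁.left_mem
  have haA := p₃.left_mem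
  rw [show S ∪ {a, v} = insert v S by ext x; simp; grind] at h₁₂
  rw [show {a, v} ∪ A = insert v A by ext x; simp; grind] at h₂₃
  obtain ⟨hvS, hab₁, hnab₁, hSv⟩ := p₁.of_isHole_insert hva hvb₁ h₁₂
  obtain ⟨hvA, hab₃, hnab₃, hAv⟩ := p₃.of_isHole_insert hva hvb₃ h₂₃
  have hb₁A : b₁ ∉ A := fun h => (hAv b₁ h hvb₁).elim (fun e => hab₁ e.symm) hbb.ne
  have cross := p₁.cross_of_isHole p₃ hab₁ hnab₁ hab₃ hbb hb₁A h₁₃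
  obtain ⟨a', haa', hT, huS⟩ := p₁.tail hab₁
  have hvW : v ∉ W := fun h => Set.disjoint_left.1 a₂.1 rfl ⟨h, hvp.ne⟩
  have hWv : ∀ y ∈ W, G.Adj v y → y = p := by
    intro y hy e
    by_contra hyp
    exact a₂.2 v rfl y ⟨hy, hyp⟩ e
  have hAW : Anti G A W := fun x hx y hy =>
    ⟨fun e => Set.disjoint_left.1 a₃.1 hx (e ▸ hy), a₃.2 x hx y hy⟩
  have hb₁W : b₁ ∉ W := fun h => (hAW b₃ p₃.right_mem b₁ h).2 hbb.symm
  have hSW : ∀ x ∈ S, x ∉ W := by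
    intro x hx hxW
    have hxb : x ≠ b₁ := fun e => hb₁W (e ▸ hxW)
    -- The condition `anti₁` leaves out `q`. That `q` is not on `P₁` follows from its predecessor on
    -- `P`, or, when `P` is a single vertex, from the adjacency of `p` and `b₂`.
    by_cases hxq : x = q
    · subst hxq
      by_cases hpx : x = p
      · subst hpx
        rcases hSv x hx hvp with rfl | h
        · exact (hAW x haA x hxW).1 rfl
        · exact hxb h
      · obtain ⟨d, hd, hP, -⟩ := pp.symm.tail hpx
        exact a₁.2 x ⟨hx, hxb⟩ d hP.left_mem hd
    · exact Set.disjoint_left.1 a₁.1 ⟨hx, hxb⟩ ⟨hxW, hxq⟩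
  have hSq : ∀ x ∈ S, x ≠ b₁ → ∀ y ∈ W, G.Adj x y → y = q := by
    intro x hx hxb y hy e
    by_contra hyq
    exact a₁.2 x ⟨hx, hxb⟩ y ⟨hy, hyq⟩ e
  have hap := hAW a haA p pp.left_mem
  have ha'S : a' ∈ S := hT.left_mem.1
  have ha'a : a' ≠ a := haa'.ne.symm
  have ha'b : a' ≠ b₁ := fun e => hnab₁ (e ▸ haa')
  have hva' : ¬ G.Adj v a' := fun e => (hSv a' ha'S e).elim ha'a ha'b
  have ha'v : a' ≠ v := fun e => hvS (e ▸ ha'S)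
  have hnab : ¬ G.Adj a' b₁ := fun h =>
    hva' (square_free hG hva.symm hvb₁ h.symm haa'.symm hab₁ hnab₁ ha'v.symm)
  have hSv' : ∀ y ∈ S, y ≠ v := fun y hy e => hvS (e ▸ hy)
  have hWv' : ∀ y ∈ W, y ≠ v := fun y hy e => hvW (e ▸ hy)
  -- If `a'` were the only neighbour of `q` in the interior of `P₁`, then `a'` followed by the
  -- reverse of `P` would be a path as required by `no_fork`.
  have hq : ∃ u ∈ S, u ≠ a ∧ u ≠ a' ∧ u ≠ b₁ ∧ G.Adj q u := by
    by_contra! hno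
    obtain ⟨u, ⟨huS', hu⟩, hqu⟩ := hlast
    obtain ⟨hua, hub⟩ : u ≠ a ∧ u ≠ b₁ := by simpa using hu
    have hua' : u = a' := by
      by_contra h
      exact hno u huS' hua h hub hqu
    subst hua'
    have hU : IPath G (insert u W) u p := by
      refine pp.symm.cons' hqu.symm fun x hx => ⟨fun e => hSW u ha'S (e ▸ hx), fun e => ?_⟩
      exact hSq u ha'S hub x hx e
    refine no_fork hG hT hU p₃ hva hvb₁ hvb₃ hvp haa' hbb hnab₁ hnab₃ hab₃ ?_ ?_ ?_ ?_ ?_ ?_ ?_ ?_ ?_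
    · exact fun y hy => ⟨hSv' y hy.1, fun e => (hSv y hy.1 e).resolve_left hy.2⟩
    · rintro y (rfl | hy)
      · exact ⟨ha'v, fun e => absurd e hva'⟩
      · exact ⟨hWv' y hy, hWv y hy⟩
    · exact fun y hy => ⟨fun e => hvA (e ▸ hy), hAv y hy⟩
    · exact fun y hy => ⟨fun e => hy.2 e.symm, huS y hy.1⟩
    · rintro y (rfl | hy)
      · exact ⟨haa'.ne, fun _ => rfl⟩
      · have := hAW a haA y hy
        exact ⟨this.1, fun e => absurd e this.2⟩
    · rintro y hy z (h | hz) h1 h2 h3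
      · exact absurd h h3
      · refine ⟨fun e => hSW y hy.1 (e ▸ hz), fun e => ?_⟩
        have := hSq y hy.1 h2 z hz e
        subst this
        exact hno y hy.1 hy.2 h1 h2 e.symm
    · rintro y hy z (rfl | hz) h1
      · have := cross z ha'S y hy ha'a h1
        exact ⟨this.1.symm, fun e => hub (this.2 e.symm).1⟩
      · exact hAW y hy z hz
    · intro y hy
      refine ⟨fun e => hb₁A (e ▸ hy), fun e => ?_⟩
      by_cases hya : y = a
      · subst hya; exact absurd e hnab₁
      · exact ((cross b₁ p₁.right_mem y hy hab₁.symm hya).2 e.symm).2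
    · rintro (h | h)
      · exact hub h.symm
      · exact hb₁W h
  obtain ⟨u, huS', hua, hua', hub, hqu⟩ := hq
  obtain ⟨a'', ha'', hT₂, -⟩ := hT.tail ha'b
  have ha''b : a'' ≠ b₁ := fun e => hnab (e ▸ ha'')
  obtain ⟨b', -, hT₃, -⟩ := hT₂.symm.tail ha''b.symm
  set R := ((S \ {a}) \ {a'}) \ {b₁} with hR
  have hRS : ∀ x ∈ R, x ∈ S ∧ x ≠ a ∧ x ≠ a' ∧ x ≠ b₁ := fun x hx =>
    ⟨hx.1.1.1, hx.1.1.2, hx.1.2, hx.2⟩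
  have huR : u ∈ R := ⟨⟨⟨huS', hua⟩, hua'⟩, hub⟩
  have hmemS : ∀ x ∈ S, x ≠ a → x ≠ b₁ → x ∈ D := fun x hx h1 h2 =>
    C.mem (hD ⟨.inl (.inl (.inl hx)), hSv' x hx⟩) (hSv' x hx) fun e => (hSv x hx e).elim h1 h2
  have hRT : (S \ {a}) \ {a'} ⊆ insert b₁ (R ∪ W \ {p}) := by
    intro x hx
    by_cases h : x = b₁
    · exact .inl h
    · exact .inr (.inl ⟨hx, h⟩)
  have hWp : W ⊆ insert p (R ∪ W \ {p}) := by
    intro x hx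
    by_cases h : x = p
    · exact .inl h
    · exact .inr (.inr ⟨hx, h⟩)
  -- The set `K` consists of the interior of `P₁` without `a'` and of `P` without `p`. The edge from
  -- `q` to `u` connects its two parts, so that `b₁` and `p` are both reached from everywhere in
  -- `K`.
  refine Core.contra hG (v := v) (a := a) (a' := a') (b₁ := b₁) (b₃ := b₃) (p := p) (A := A)
    (K := R ∪ W \ {p}) (D := D) ⟨C, hva, hvb₁, hvb₃, hvp, haa', hbb, ⟨hab₁, hnab₁⟩, ⟨hab₃, hnab₃⟩,
      fun e => hb₁W (e ▸ pp.left_mem), p₃, ?_, hmemS a' ha'S ha'a ha'b, ?_, ?_,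
      fun y hy => hAW y hy p pp.left_mem, ?_, ?_, ?_, ?_,
      ⟨a'', .inl ⟨hT₂.left_mem, ha''b⟩, ha''⟩⟩
  · rintro x (hx | hx)
    · exact hmemS x (hRS x hx).1 (hRS x hx).2.1 (hRS x hx).2.2.2
    · exact C.mem (hD ⟨.inr hx.1, hWv' x hx.1⟩) (hWv' x hx.1) fun e => hx.2 (hWv x hx.1 e)
  · intro y hy h1 h2
    have hyv : y ≠ v := fun e => hvA (e ▸ hy)
    exact C.mem (hD ⟨.inl (.inr hy), hyv⟩) hyv fun e => (hAv y hy e).elim h1 h2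
  · rintro y hy x (hx | hx)
    · obtain ⟨h1, h2, h3, h4⟩ := hRS x hx
      by_cases hya : y = a
      · subst hya
        exact ⟨h2.symm, fun e => h3 (huS x h1 e)⟩
      · have := cross x h1 y hy h2 hya
        exact ⟨this.1.symm, fun e => h4 (this.2 e.symm).1⟩
    · exact hAW y hy x hx.1
  · intro y hy hya
    have := cross a' ha'S y hy ha'a hya
    exact ⟨this.1.symm, fun e => ha'b (this.2 e.symm).1⟩
  · intro y hy
    refine ⟨fun e => hb₁A (e ▸ hy), fun e => ?_⟩
    by_cases hya : y = a
    · subst hya; exact absurd e hnab₁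
    · exact ((cross b₁ p₁.right_mem y hy hab₁.symm hya).2 e.symm).2
  · have hu : ∀ x ∈ R, Reach G (insert b₁ (R ∪ W \ {p})) x b₁ := fun x hx =>
      (hT₂.reach_mem hx.1 hT₂.right_mem).mono hRT
    rintro x (hx | hx)
    · exact hu x hx
    · have hqp : p ≠ q := by
        rintro rfl
        have h := hx.1
        rw [pp.eq_singleton] at h
        exact hx.2 h
      obtain ⟨p', -, hP, -⟩ := pp.tail hqp
      have h1 : Reach G (insert b₁ (R ∪ W \ {p})) x q :=
        (hP.reach_mem hx hP.right_mem).mono (by clear * -; intro; simp; tauto)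
      exact h1.trans ((hu u huR).cons (.inr (.inr hP.right_mem)) hqu)
  · rintro x (hx | hx)
    · have h1 : Reach G (insert p (R ∪ W \ {p})) x u :=
        (hT₃.reach_mem hx huR).mono (by clear * -; intro; simp; tauto)
      exact (h1.snoc (hWp pp.right_mem) hqu.symm).trans (pp.symm.reach' hWp)
    · exact (pp.reach_mem hx.1 pp.left_mem).mono hWp

end

theorem mainTheorem9 {V : Type*} [Finite V] (G : SimpleGraph V)
    (hG : IsC4FreeOddSignable G) :
    (∀ (H : Set V) (v : V), IsProperWheel G H v →
      ¬ ∃ D : Set V, IsComponentOfDelete G (closedNbhd G {v}) D ∧ H ⊆ closedNbhd G D) ∧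
    (∀ L : LoadedPyramid G,
      ¬ ∃ D : Set V, IsComponentOfDelete G (closedNbhd G {L.b₂}) D ∧
        L.verts \ {L.b₂} ⊆ closedNbhd G D) := by
  refine ⟨?_, ?_⟩
  · rintro H v hW ⟨D, hD, hH⟩
    exact hW.not_subset hG hD.comp hH
  · rintro L ⟨D, hD, hL⟩
    exact L.not_subset hG hD.comp hL
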